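/- Let $M$ be a connected, oriented, complete Riemannian manifold (smooth, without boundary) of dimension $3$, with Levi-Civita connection $\nabla$ and Riemannian measure $dx$. Write $\tilde A=\langle A,\cdot\rangle$ for the 1-form of a vector field $A$, and $\square A=(\square\tilde A)^{\sharp}$ with $\square=dd^*+d^*d$ the de Rham-Hodge Laplacian. Let $\nu>0$, let $J\subset\mathbb R$ be an open set of times, and let $(u_t,p_t)_{t\in J}$ be a smooth solution of the Navier-Stokes equation $$\partial_t u_t+\nabla_{u_t}u_t+\nu\,\square u_t=-\nabla p_t,\qquad \operatorname{div}(u_t)=0 \qquad\text{on } J\times M ,$$ that is, $u$ is smooth on $J\times M$ and each $p_t$ is smooth on $M$. Assume that for every $t\in J$ the field $u_t$ is bounded and $|u_t|,|\nabla u_t|,|\nabla^2u_t|\in L^2(M)$, and that $t\mapsto u_t$ is differentiable as a map with values in $H^1(M)$, with derivative $\partial_tu_t$, i.e. $\int_M(|r_h|^2+|\nabla r_h|^2)\,dx\to0$ as $h\to0$ for $r_h=h^{-1}(u_{t+h}-u_t)-\partial_tu_t$. (This regularity at infinity is automatic if $M$ is compact.) Let $\omega_t=*\,d\tilde u_t$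 be the vorticity 1-form, where $*$ is the Hodge star operator. For a vector field $v$ let $\nabla^v$ be the connection $\nabla^v_XY=\nabla_XY-\frac{2}{n-1}\big(\langle Y,v\rangle X-\langle X,Y\rangle v\big)$ with $n=\dim M=3$, let $T^v$ be its torsion and $\mathrm{Ric}^v(X)=\sum_iR^v(X,e_i)e_i$ its Ricci tensor, where $R^v$ is the curvature of $\nabla^v$ and $(e_i)$ is an orthonormal basis, and let $$\widehat{\mathrm{Ric}^{v}}(X)=\mathrm{Ric}^v(X)+\sum_{i}(\nabla^v_{e_i}T^v)(X,e_i)$$ be its intrinsic Ricci tensor. Put $\widehat{\mathrm{Ric}^t}=\widehat{\mathrm{Ric}^{v}}$ with $v=-u_t/(2\nu)$. Let $(\cdot,\cdot)$ denote the pairing of 1-forms with vector fields, and set $(\nabla\omega_t,\nabla u_t)=\sum_i(\nabla_{e_i}\omega_t,\nabla_{e_i}u_t)$. Then for every $t\in J$ the integrals below converge absolutely, the helicity $s\mapsto\int_M(\omega_s,u_s)\,dx$ is differentiable at $t$, and $$\frac{d}{dt}\int_M(\omega_t,u_t)\,dx=-\nu\int_M\langle d\omega_t,*\omega_t\rangle_{\Lambda^2}\,dx-\nu\int_M(\nabla\omega_t,\nabla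 u_t)\,dx-\nu\int_M(\omega_t,\widehat{\mathrm{Ric}^t}\,u_t)\,dx+\frac1{2\nu}\int_M(\omega_t,u_t)\,|u_t|^2\,dx .$$ -/

import Mathlib

open Bundle Manifold MeasureTheory Set Filter Topology Module
open scoped ContDiff ENNReal

noncomputable section

namespace HelicityNS

/-! ### Vector fields, forms and orthonormal frames on a Riemannian manifold -/

section Riemannian

variable {n : ℕ} {M : Type*} [TopologicalSpace M] [ChartedSpace (EuclideanSpace ℝ (Fin n)) M]

variable (n M) in
/-- Vector fields on `M` (no regularity is built in). -/
abbrev VecField := ∀ x : M, TangentSpace (𝓡 n) x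

variable (n M) in
/-- Differential 1-forms on `M` (no regularity is built in). -/
abbrev OneForm := ∀ x : M, TangentSpace (𝓡 n) x →L[ℝ] ℝ

variable (n M) in
/-- Tensor fields of type `(0, 2)`; a differential 2-form `β` is regarded as the tensor field
`β x X Y`. -/
abbrev TwoTensor := ∀ x : M, TangentSpace (𝓡 n) x →L[ℝ] TangentSpace (𝓡 n) x →L[ℝ] ℝ

instance finiteDimensionalTangent (x : M) : FiniteDimensional ℝ (TangentSpace (𝓡 n) x) :=
  inferInstanceAs (FiniteDimensional ℝ (EuclideanSpace ℝ (Fin n)))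

instance finrankTangent (x : M) : Fact (finrank ℝ (TangentSpace (𝓡 n) x) = n) :=
  ⟨finrank_euclideanSpace_fin (𝕜 := ℝ) (n := n)⟩

variable [IsManifold (𝓡 n) ∞ M]

variable (n M) in
/-- Affine connections on `M`. For a connection `D`, the vector `D Y x v` is `(D_v Y)(x)`. -/
abbrev AffineConnection :=
  CovariantDerivative (𝓡 n) (EuclideanSpace ℝ (Fin n)) (fun x : M => TangentSpace (𝓡 n) x)

/-- A vector field, smooth near `x`, whose value at `x` is `v`. -/
def ext {x : M} (v : TangentSpace (𝓡 n) x) : VecField n M :=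
  FiberBundle.extend (EuclideanSpace ℝ (Fin n)) v

/-- Differentiability of a vector field at a point. -/
abbrev DiffAt (X : VecField n M) (x : M) : Prop :=
  MDifferentiableAt (𝓡 n) (𝓡 n).tangent
    (fun y => TotalSpace.mk' (EuclideanSpace ℝ (Fin n)) y (X y)) x

theorem diffAt_ext {x : M} (v : TangentSpace (𝓡 n) x) : DiffAt (ext v) x :=
  FiberBundle.mdifferentiableAt_extend ..

variable [RiemannianBundle (fun x : M => TangentSpace (𝓡 n) x)]

/-- The bilinear map `(Y, X) ↦ K_v(X, Y) = ⟨Y, v⟩ X - ⟨X, Y⟩ v` on the tangent space at `x`. -/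
def driftTensor {x : M} (v : TangentSpace (𝓡 n) x) :
    TangentSpace (𝓡 n) x →L[ℝ] TangentSpace (𝓡 n) x →L[ℝ] TangentSpace (𝓡 n) x :=
  (innerSL ℝ v).smulRight (ContinuousLinearMap.id ℝ (TangentSpace (𝓡 n) x))
    - ((ContinuousLinearMap.smulRightL ℝ (TangentSpace (𝓡 n) x) (TangentSpace (𝓡 n) x)).flip v)
      ∘L (innerSL ℝ : TangentSpace (𝓡 n) x →L[ℝ] TangentSpace (𝓡 n) x →L[ℝ] ℝ)

theorem driftTensor_apply {x : M} (v Y X : TangentSpace (𝓡 n) x) :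
    driftTensor v Y X = (inner ℝ Y v : ℝ) • X - (inner ℝ X Y : ℝ) • v := by
  rw [real_inner_comm, real_inner_comm Y X]
  simp [driftTensor, innerSL_apply_apply ℝ]

/-- An orthonormal basis `e₁, …, eₙ` of the tangent space at `x`. -/
def frame (x : M) : OrthonormalBasis (Fin n) ℝ (TangentSpace (𝓡 n) x) :=
  (stdOrthonormalBasis ℝ (TangentSpace (𝓡 n) x)).reindex
    (finCongr (finrankTangent x).out)

/-- The linear form on the tangent space at `x` which has the same values as `f` on `e₁, …, eₙ`. -/
def linearOfFrame (x : M) (f : TangentSpace (𝓡 n) x → ℝ) : TangentSpace (𝓡 n) x →L[ℝ] ℝ :=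
  ∑ i, f (frame x i) • innerSL ℝ (frame x i)

/-- The bilinear form on the tangent space at `x` which has the same values as `f` on pairs of
vectors among `e₁, …, eₙ`. -/
def bilinearOfFrame (x : M) (f : TangentSpace (𝓡 n) x → TangentSpace (𝓡 n) x → ℝ) :
    TangentSpace (𝓡 n) x →L[ℝ] TangentSpace (𝓡 n) x →L[ℝ] ℝ :=
  ∑ i, ∑ j, f (frame x i) (frame x j) •
    (innerSL ℝ (frame x i)).smulRight (innerSL ℝ (frame x j))

/-- The 1-form `Ã = ⟨A, ·⟩` of a vector field `A`. -/
def flat (A : VecField n M) : OneForm n M := fun x => innerSL ℝ (A x)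

/-- The vector field `α^♯` of a 1-form `α`, so that `⟨α^♯, A⟩ = α(A)`. -/
def sharp (α : OneForm n M) : VecField n M := fun x => ∑ i, α x (frame x i) • frame x i

/-- The gradient of a function. -/
def grad (f : M → ℝ) : VecField n M := sharp (fun x => mvfderiv (𝓡 n) f x)

/-! ### The Levi-Civita connection -/

/-- The right-hand side of Koszul's formula for `⟨∇_X Y, Z⟩`. -/
def koszul (X Y Z : VecField n M) (x : M) : ℝ :=
  (1 / 2) * (mvfderiv (𝓡 n) (fun y => inner ℝ (Y y) (Z y)) x (X x)
    + mvfderiv (𝓡 n) (fun y => inner ℝ (X y) (Z y)) x (Y x)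
    - mvfderiv (𝓡 n) (fun y => inner ℝ (X y) (Y y)) x (Z x)
    + inner ℝ (VectorField.mlieBracket (𝓡 n) X Y x) (Z x)
    - inner ℝ (VectorField.mlieBracket (𝓡 n) X Z x) (Y x)
    - inner ℝ (VectorField.mlieBracket (𝓡 n) Y Z x) (X x))

variable [IsContMDiffRiemannianBundle (𝓡 n) ∞ (EuclideanSpace ℝ (Fin n))
  (fun x : M => TangentSpace (𝓡 n) x)]

instance isContMDiffRiemannianBundleOne : IsContMDiffRiemannianBundle (𝓡 n) 1
    (EuclideanSpace ℝ (Fin n)) (fun x : M => TangentSpace (𝓡 n) x) :=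
  IsContMDiffRiemannianBundle.of_le (n := ∞) (by decide)

theorem diff_inner {X Y : VecField n M} {x : M} (hX : DiffAt X x) (hY : DiffAt Y x) :
    MDifferentiableAt (𝓡 n) 𝓘(ℝ) (fun y => inner ℝ (X y) (Y y)) x :=
  MDifferentiableAt.inner_bundle hX hY

theorem koszul_add {X Y Y' Z : VecField n M} {x : M}
    (hX : DiffAt X x) (hY : DiffAt Y x) (hY' : DiffAt Y' x) (hZ : DiffAt Z x) :
    koszul X (Y + Y') Z x = koszul X Y Z x + koszul X Y' Z x := by
  simp only [koszul, Pi.add_apply, inner_add_left, inner_add_right,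
    VectorField.mlieBracket_add_right hY hY', VectorField.mlieBracket_add_left hY hY']
  rw [mvfderiv_fun_add (diff_inner hY hZ) (diff_inner hY' hZ),
    mvfderiv_fun_add (diff_inner hX hY) (diff_inner hX hY')]
  simp only [add_apply, map_add]
  ring

theorem koszul_smul {X Y Z : VecField n M} {g : M → ℝ} {x : M}
    (hX : DiffAt X x) (hY : DiffAt Y x) (hg : MDifferentiableAt (𝓡 n) 𝓘(ℝ) g x)
    (hZ : DiffAt Z x) :
    koszul X (g • Y) Z x =
      g x * koszul X Y Z x + mvfderiv (𝓡 n) g x (X x) * inner ℝ (Y x) (Z x) := by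
  simp only [koszul, Pi.smul_apply', inner_smul_left, inner_smul_right,
    VectorField.mlieBracket_smul_right hg hY, VectorField.mlieBracket_smul_left hg hY]
  simp only [RCLike.conj_to_real]
  rw [mvfderiv_fun_mul hg (diff_inner hY hZ), mvfderiv_fun_mul hg (diff_inner hX hY)]
  simp [inner_add_left, inner_smul_left]
  rw [real_inner_comm (X x) (Y x)]
  ring

/-- The Levi-Civita connection, by Koszul's formula. -/
def leviCivita : AffineConnection n M where
  toFun Y x := ∑ i, ∑ j, koszul (ext (frame x i)) Y (ext (frame x j)) x •
    (innerSL ℝ (frame x i)).smulRight (frame x j)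
  isCovariantDerivativeOnUniv :=
    { add := by
        intro Y Y' x hY hY' _
        simp only [koszul_add (diffAt_ext _) hY hY' (diffAt_ext _), add_smul,
          Finset.sum_add_distrib]
      leibniz := by
        intro Y g x hY hg _
        simp only [koszul_smul (diffAt_ext _) hY hg (diffAt_ext _), add_smul,
          Finset.sum_add_distrib, mul_smul, ← Finset.smul_sum]
        congr 1
        have h1 : ∀ w : TangentSpace (𝓡 n) x,
            ∑ j, (inner ℝ w (frame x j) : ℝ) • frame x j = w := fun w => by
          simpa [real_inner_comm] using (frame x).sum_repr' w
        have h2 : ∀ y w : TangentSpace (𝓡 n) x, ext w x = w := fun y w =>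
          FiberBundle.extend_apply_self _ w
        ext v
        simp only [FunLike.coe_sum, Finset.sum_apply, FunLike.coe_smul, Pi.smul_apply, h2 v,
          ContinuousLinearMap.smulRight_apply, innerSL_apply_apply, smul_comm _ (inner ℝ _ v : ℝ),
          ← Finset.smul_sum, h1]
        simp only [← smul_assoc, ← Finset.sum_smul, smul_eq_mul]
        conv_rhs => rw [← (frame x).sum_repr' v]
        simp only [map_sum, map_smul, smul_eq_mul] }

theorem tensorial_koszul_left {Y Z : VecField n M} {x : M} (hY : DiffAt Y x) (hZ : DiffAt Z x) :
    TensorialAt (𝓡 n) (EuclideanSpace ℝ (Fin n)) (koszul · Y Z x) x where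
  smul {g X} hg hX := by
    simp only [koszul, Pi.smul_apply', inner_smul_left, inner_smul_right,
      VectorField.mlieBracket_smul_left hg hX]
    simp only [RCLike.conj_to_real]
    rw [mvfderiv_fun_mul hg (diff_inner hX hZ), mvfderiv_fun_mul hg (diff_inner hX hY)]
    simp [inner_add_left, inner_smul_left]
    ring
  add {X X'} hX hX' := by
    simp only [koszul, Pi.add_apply, inner_add_left, inner_add_right,
      VectorField.mlieBracket_add_left hX hX']
    rw [mvfderiv_fun_add (diff_inner hX hZ) (diff_inner hX' hZ),
      mvfderiv_fun_add (diff_inner hX hY) (diff_inner hX' hY)]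
    simp only [add_apply, map_add]
    ring

theorem tensorial_koszul_right {X Y : VecField n M} {x : M} (hX : DiffAt X x) (hY : DiffAt Y x) :
    TensorialAt (𝓡 n) (EuclideanSpace ℝ (Fin n)) (koszul X Y · x) x where
  smul {g Z} hg hZ := by
    simp only [koszul, Pi.smul_apply', inner_smul_right,
      VectorField.mlieBracket_smul_right hg hZ]
    rw [mvfderiv_fun_mul hg (diff_inner hY hZ), mvfderiv_fun_mul hg (diff_inner hX hZ)]
    simp [inner_add_left, inner_smul_left]
    rw [real_inner_comm (Y x) (Z x), real_inner_comm (X x) (Z x)]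
    ring
  add {Z Z'} hZ hZ' := by
    simp only [koszul, Pi.add_apply, inner_add_left, inner_add_right,
      VectorField.mlieBracket_add_right hZ hZ']
    rw [mvfderiv_fun_add (diff_inner hY hZ) (diff_inner hY hZ'),
      mvfderiv_fun_add (diff_inner hX hZ) (diff_inner hX hZ')]
    simp only [add_apply, map_add]
    ring

/-- Koszul's formula. -/
theorem inner_leviCivita {X Y Z : VecField n M} {x : M}
    (hX : DiffAt X x) (hY : DiffAt Y x) (hZ : DiffAt Z x) :
    inner ℝ (leviCivita Y x (X x)) (Z x) = koszul X Y Z x := by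
  have hl : ∀ Z, DiffAt Z x → koszul X Y Z x = ∑ i, inner ℝ (frame x i) (X x) *
      koszul (ext (frame x i)) Y Z x := by
    intro Z hZ
    rw [← TensorialAt.mkHom_apply (tensorial_koszul_left hY hZ) hX]
    conv_lhs => rw [← (frame x).sum_repr' (X x)]
    simp only [map_sum, map_smul, smul_eq_mul]
    rfl
  have hr : ∀ X, DiffAt X x → koszul X Y Z x = ∑ j, inner ℝ (frame x j) (Z x) *
      koszul X Y (ext (frame x j)) x := by
    intro X hX
    rw [← TensorialAt.mkHom_apply (tensorial_koszul_right hX hY) hZ]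
    conv_lhs => rw [← (frame x).sum_repr' (Z x)]
    simp only [map_sum, map_smul, smul_eq_mul]
    rfl
  rw [hl Z hZ]
  simp only [hr _ (diffAt_ext _)]
  simp [leviCivita, sum_inner, inner_smul_left, Finset.mul_sum]
  refine Finset.sum_congr rfl fun i _ => Finset.sum_congr rfl fun j _ => ?_
  ring

theorem torsion_leviCivita : (leviCivita : AffineConnection n M).torsion = 0 := by
  rw [CovariantDerivative.torsion_eq_zero_iff]
  intro X Y x hX hY
  refine ext_inner_right ℝ fun w => ?_
  have hw := diffAt_ext w
  have e : w = ext w x := (FiberBundle.extend_apply_self _ w).symm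
  rw [e, inner_sub_left, inner_leviCivita hX hY hw, inner_leviCivita hY hX hw]
  simp only [koszul]
  rw [VectorField.mlieBracket_swap_apply (V := Y) (W := X)]
  simp only [inner_neg_left]
  simp only [fun y => real_inner_comm (X y) (Y y)]
  ring

theorem isMetricCompatible_leviCivita :
    (leviCivita : AffineConnection n M).IsMetricCompatible := by
  rw [CovariantDerivative.isMetricCompatible_iff]
  intro x X Y Z hX hY hZ
  change _ = inner ℝ (leviCivita Y x (X x)) (Z x) + inner ℝ (Y x) (leviCivita Z x (X x))
  rw [real_inner_comm _ (Y x), inner_leviCivita hX hY hZ, inner_leviCivita hX hZ hY]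
  simp only [koszul]
  rw [VectorField.mlieBracket_swap_apply (V := Z) (W := Y)]
  simp only [inner_neg_left]
  simp only [fun y => real_inner_comm (Y y) (Z y)]
  ring

/-- The Hilbert-Schmidt norm squared `|∇X|²`. -/
def normSqCov (X : VecField n M) (x : M) : ℝ :=
  ∑ i, ‖leviCivita X x (frame x i)‖ ^ 2

/-- The second covariant derivative `∇²_{v,w} X = ∇_v ∇_w X - ∇_{∇_v w} X`. -/
def secondCov (X : VecField n M) (x : M) (v w : TangentSpace (𝓡 n) x) : TangentSpace (𝓡 n) x :=
  leviCivita (fun y => leviCivita X y (ext w y)) x v - leviCivita X x (leviCivita (ext w) x v)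

/-- The Hilbert-Schmidt norm squared `|∇²X|²`. -/
def normSqSecondCov (X : VecField n M) (x : M) : ℝ :=
  ∑ i, ∑ j, ‖secondCov X x (frame x i) (frame x j)‖ ^ 2

/-- The divergence of a vector field. -/
def divergence (X : VecField n M) (x : M) : ℝ :=
  ∑ i, inner ℝ (leviCivita X x (frame x i)) (frame x i)

/-- The covariant derivative `(∇_v α)(w)` of a 1-form, as the bilinear form `(v, w) ↦ (∇_v α)(w)`. -/
def covOneForm (α : OneForm n M) : TwoTensor n M := fun x =>
  bilinearOfFrame x fun v w =>
    mvfderiv (𝓡 n) (fun y => α y (ext w y)) x v - α x (leviCivita (ext w) x v)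

/-- The covariant derivative `(∇_v β)(w, z)` of a tensor field of type `(0, 2)`. -/
def covTwoTensor (β : TwoTensor n M) (x : M) (v w z : TangentSpace (𝓡 n) x) : ℝ :=
  mvfderiv (𝓡 n) (fun y => β y (ext w y) (ext z y)) x v
    - β x (leviCivita (ext w) x v) z - β x w (leviCivita (ext z) x v)

/-! ### Exterior derivative, codifferential and the de Rham-Hodge Laplacian -/

/-- The exterior derivative of a 1-form,
`dα(X, Y) = X(α(Y)) - Y(α(X)) - α([X, Y])`. -/
def extDerivOne (α : OneForm n M) : TwoTensor n M := fun x =>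
  bilinearOfFrame x fun v w =>
    mvfderiv (𝓡 n) (fun y => α y (ext w y)) x v - mvfderiv (𝓡 n) (fun y => α y (ext v y)) x w
      - α x (VectorField.mlieBracket (𝓡 n) (ext v) (ext w) x)

/-- The codifferential on 1-forms, `d*α = -∑ᵢ (∇_{eᵢ} α)(eᵢ)`. -/
def codiffOne (α : OneForm n M) (x : M) : ℝ := -∑ i, covOneForm α x (frame x i) (frame x i)

/-- The codifferential on 2-forms, `(d*β)(X) = -∑ᵢ (∇_{eᵢ} β)(eᵢ, X)`. -/
def codiffTwo (β : TwoTensor n M) : OneForm n M := fun x =>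
  linearOfFrame x fun v => -∑ i, covTwoTensor β x (frame x i) (frame x i) v

/-- The de Rham-Hodge Laplacian `□ = dd* + d*d` on 1-forms. -/
def hodgeLaplacianOne (α : OneForm n M) : OneForm n M := fun x =>
  mvfderiv (𝓡 n) (codiffOne α) x + codiffTwo (extDerivOne α) x

/-- The de Rham-Hodge Laplacian on vector fields, `□A = (□Ã)^♯`. -/
def hodgeLaplacian (A : VecField n M) : VecField n M := sharp (hodgeLaplacianOne (flat A))

/-! ### Curvature and the intrinsic Ricci tensor of a connection -/

/-- The curvature `R(X, Y)Z = D_X D_Y Z - D_Y D_X Z - D_{[X, Y]} Z` of a connection `D`. -/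
def curvature (D : AffineConnection n M) (X Y Z : VecField n M) : VecField n M := fun x =>
  D (fun y => D Z y (Y y)) x (X x) - D (fun y => D Z y (X y)) x (Y x)
    - D Z x (VectorField.mlieBracket (𝓡 n) X Y x)

/-- The Ricci tensor `Ric(v) = ∑ᵢ R(v, eᵢ)eᵢ` of a connection. -/
def ricci (D : AffineConnection n M) (x : M) (v : TangentSpace (𝓡 n) x) : TangentSpace (𝓡 n) x :=
  ∑ i, curvature D (ext v) (ext (frame x i)) (ext (frame x i)) x

/-- The covariant derivative of the torsion `T` of a connection `D`:
`(D_v T)(w, z) = D_v (T(w, z)) - T(D_v w, z) - T(w, D_v z)`. -/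
def covTorsion (D : AffineConnection n M) (x : M) (v w z : TangentSpace (𝓡 n) x) :
    TangentSpace (𝓡 n) x :=
  D (fun y => D.torsion y (ext w y) (ext z y)) x v
    - D.torsion x (D (ext w) x v) z - D.torsion x w (D (ext z) x v)

/-- The intrinsic Ricci tensor `Ric(v) + ∑ᵢ (D_{eᵢ} T)(v, eᵢ)` of a connection `D` with
torsion `T`. -/
def intrinsicRicci (D : AffineConnection n M) (x : M) (v : TangentSpace (𝓡 n) x) :
    TangentSpace (𝓡 n) x :=
  ricci D x v + ∑ i, covTorsion D x (frame x i) v (frame x i)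

/-- The metric connection attached to the vector field `v`,
`∇^v_X Y = ∇_X Y - (2 / (n - 1)) (⟨Y, v⟩ X - ⟨X, Y⟩ v)`. -/
def driftConnection (v : VecField n M) : AffineConnection n M :=
  leviCivita.addOneForm fun x => (-(2 / ((n : ℝ) - 1))) • driftTensor (v x)

/-! ### The Riemannian measure -/

variable [MeasurableSpace M]

/-- The density `√(det (g_{ij}))` of the Riemannian measure at the point `z` of the chart around
`x₀`, where `g_{ij} = ⟨∂_i, ∂_j⟩`. -/
def chartDensity (x₀ : M) (z : EuclideanSpace ℝ (Fin n)) : ℝ :=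
  √(Matrix.det (Matrix.of fun i j : Fin n =>
    (inner ℝ
      (mfderiv 𝓘(ℝ, EuclideanSpace ℝ (Fin n)) (𝓡 n) (extChartAt (𝓡 n) x₀).symm z
        (EuclideanSpace.single i (1 : ℝ)))
      (mfderiv 𝓘(ℝ, EuclideanSpace ℝ (Fin n)) (𝓡 n) (extChartAt (𝓡 n) x₀).symm z
        (EuclideanSpace.single j (1 : ℝ))) : ℝ)))

/-- The Riemannian measure on the domain of the chart around `x₀`: the image under the inverse
chart of `√(det (g_{ij})) dz`. -/
def chartMeasure (x₀ : M) : Measure M :=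
  (((volume : Measure (EuclideanSpace ℝ (Fin n))).restrict
    (extChartAt (𝓡 n) x₀).target).withDensity fun z => ENNReal.ofReal (chartDensity x₀ z)).map
      (extChartAt (𝓡 n) x₀).symm

variable (n M) in
/-- The Riemannian measure. The measures `chartMeasure x₀` agree on the overlaps of the charts, and
the Riemannian measure, whose restriction to the domain of each chart is `chartMeasure x₀`, is their
supremum in the lattice of measures. -/
def riemannianMeasure : Measure M := ⨆ x₀ : M, chartMeasure (n := n) x₀

/-- The squared `H¹` norm `∫ (|X|² + |∇X|²)`, possibly infinite. -/
def sobolevSqOne (X : VecField n M) : ℝ≥0∞ :=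
  ∫⁻ x, ENNReal.ofReal (‖X x‖ ^ 2 + normSqCov X x) ∂(riemannianMeasure n M)

/-- The squared `H²` norm `∫ (|X|² + |∇X|² + |∇²X|²)`, possibly infinite. -/
def sobolevSqTwo (X : VecField n M) : ℝ≥0∞ :=
  ∫⁻ x, ENNReal.ofReal (‖X x‖ ^ 2 + normSqCov X x + normSqSecondCov X x) ∂(riemannianMeasure n M)

/-! ### The Navier-Stokes equation -/

/-- The time derivative `∂_t u_t` of a time-dependent vector field. -/
def timeDeriv (u : ℝ → VecField n M) (t : ℝ) : VecField n M := fun x => deriv (fun s => u s x) t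

/-- `(u, p)` is a smooth solution of the Navier-Stokes equation
`∂_t u_t + ∇_{u_t} u_t + ν □u_t = -∇p_t`, `div u_t = 0` on `M` for times `t ∈ J`. -/
structure IsSmoothSolution (ν : ℝ) (J : Set ℝ) (u : ℝ → VecField n M) (p : ℝ → M → ℝ) : Prop where
  smooth_velocity : ContMDiffOn (𝓘(ℝ, ℝ).prod (𝓡 n)) (𝓡 n).tangent ∞
    (fun q : ℝ × M => TotalSpace.mk' (EuclideanSpace ℝ (Fin n)) q.2 (u q.1 q.2)) (J ×ˢ univ)
  smooth_pressure : ∀ t ∈ J, ContMDiff (𝓡 n) 𝓘(ℝ, ℝ) ∞ (p t)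
  momentum : ∀ t ∈ J, ∀ x, timeDeriv u t x + leviCivita (u t) x (u t x) + ν • hodgeLaplacian (u t) x
    = -grad (p t) x
  incompressible : ∀ t ∈ J, ∀ x, divergence (u t) x = 0

/-- The regularity of the velocity field at spatial infinity (automatic for a smooth velocity field
on a compact manifold): at each time `u_t` is bounded and of class `H²`, and `t ↦ u_t` is
differentiable as a map with values in `H¹`, with derivative `∂_t u_t`. -/
structure IsRegularVelocity (J : Set ℝ) (u : ℝ → VecField n M) : Prop where
  bounded : ∀ t ∈ J, ∃ C : ℝ, ∀ x, ‖u t x‖ ≤ C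
  sobolev : ∀ t ∈ J, sobolevSqTwo (u t) < ⊤
  differentiable : ∀ t ∈ J, Tendsto
    (fun h : ℝ => sobolevSqOne (h⁻¹ • (u (t + h) - u t) - timeDeriv u t)) (𝓝[≠] 0) (𝓝 0)

end Riemannian

/-! ### Oriented Riemannian manifolds of dimension three -/

section DimThree

variable {M : Type*} [TopologicalSpace M] [ChartedSpace (EuclideanSpace ℝ (Fin 3)) M]
  [IsManifold (𝓡 3) ∞ M]

/-- An orientation of `M`: an orientation of each tangent space such that around each point there is
a smooth local frame which is positively oriented. -/
structure ManifoldOrientation (M : Type*) [TopologicalSpace M]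
    [ChartedSpace (EuclideanSpace ℝ (Fin 3)) M] [IsManifold (𝓡 3) ∞ M] where
  orient : ∀ x : M, Orientation ℝ (TangentSpace (𝓡 3) x) (Fin 3)
  exists_frame : ∀ x : M, ∃ U ∈ 𝓝 x, ∃ s : Fin 3 → VecField 3 M,
    ∃ hs : IsLocalFrameOn (𝓡 3) (EuclideanSpace ℝ (Fin 3)) ∞ s U,
      ∀ (y : M) (hy : y ∈ U), (hs.toBasisAt hy).orientation = orient y

variable [RiemannianBundle (fun x : M => TangentSpace (𝓡 3) x)]

/-- The Riemannian volume form. -/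
def volForm (o : ManifoldOrientation M) (x : M) (a b c : TangentSpace (𝓡 3) x) : ℝ :=
  (o.orient x).volumeForm ![a, b, c]

/-- The Hodge star of a 1-form, `(*α)(X, Y) = vol(α^♯, X, Y)`. -/
def starOne (o : ManifoldOrientation M) (α : OneForm 3 M) : TwoTensor 3 M := fun x =>
  bilinearOfFrame x fun v w => volForm o x (sharp α x) v w

/-- The Hodge star of a 2-form, `(*β)(X) = ∑_{i<j} β(eᵢ, eⱼ) vol(eᵢ, eⱼ, X)`. -/
def starTwo (o : ManifoldOrientation M) (β : TwoTensor 3 M) : OneForm 3 M := fun x =>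
  linearOfFrame x fun v =>
    ∑ i, ∑ j ∈ Finset.Ioi i, β x (frame x i) (frame x j) * volForm o x (frame x i) (frame x j) v

/-- The inner product of 2-forms, `⟨β, γ⟩ = ∑_{i<j} β(eᵢ, eⱼ) γ(eᵢ, eⱼ)`. -/
def innerTwo (β γ : TwoTensor 3 M) (x : M) : ℝ :=
  ∑ i, ∑ j ∈ Finset.Ioi i, β x (frame x i) (frame x j) * γ x (frame x i) (frame x j)

variable [IsContMDiffRiemannianBundle (𝓡 3) ∞ (EuclideanSpace ℝ (Fin 3))
  (fun x : M => TangentSpace (𝓡 3) x)]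

/-- The pairing `(∇α, ∇A) = ∑ᵢ (∇_{eᵢ}α)(∇_{eᵢ}A)` of a 1-form and a vector field. -/
def covPairing (α : OneForm 3 M) (A : VecField 3 M) (x : M) : ℝ :=
  ∑ i, covOneForm α x (frame x i) (leviCivita A x (frame x i))

/-- The vorticity `*dũ` of a vector field `u`. -/
def vorticity (o : ManifoldOrientation M) (u : VecField 3 M) : OneForm 3 M :=
  starTwo o (extDerivOne (flat u))

/-- The intrinsic Ricci tensor of the connection attached to `-u / (2ν)`. -/
def velocityRicci (ν : ℝ) (u : VecField 3 M) (x : M) (v : TangentSpace (𝓡 3) x) :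
    TangentSpace (𝓡 3) x :=
  intrinsicRicci (driftConnection ((-(1 / (2 * ν))) • u)) x v

end DimThree

end HelicityNS

end

/-!
Helicity balance for the Navier-Stokes equation on a complete oriented Riemannian 3-manifold.

Everything is expressed through the cross product and the curl, `curl A = ∑ᵢ eᵢ × ∇_{eᵢ} A`. The
vorticity 1-form of `u` is dual to `ω = curl u` (`vorticity_eq`), one has `⟨dω, *ω⟩ = ⟨curl ω, ω⟩`
(`innerTwo_extDerivOne_starOne`), and `□u = curl curl u` for divergence-free `u` (`curl_curl`).
Since the curl is symmetric, the helicity `∫ ⟨curl u, u⟩` is a symmetric quadratic form which is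
bounded on `H¹`, so its time derivative is `2 ∫ ⟨ω, ∂_t u⟩` (`hasDerivAt_curlPairing`). In this
integral the momentum equation is inserted. The pressure gradient is orthogonal to every curl, and
so is the convection term `∇_u u` to `ω`, because `⟨∇_u u, ω⟩ = ⟨∇_ω u, u⟩` is half the derivative
of `|u|²` along `ω`. What remains is `-2ν ∫ ⟨ω, □u⟩` (`curlPairing_timeDeriv`).

One of the two copies of `∫ ⟨ω, □u⟩` is `∫ ⟨dω, *ω⟩`. The other one is rewritten with Bochner's
formula, `∫ ⟨ω, □u⟩ = ∫ (∇ω, ∇u) + ∫ ⟨ω, Ric u⟩` (`integral_inner_curl_curl_eq`). In dimension three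
the intrinsic Ricci tensor of `∇^v` is `Ric + ∇v + (∇v)ᵀ + 2 ⟨·, v⟩ v`
(`inner_intrinsicRicci_driftConnection`); for `v = -u / (2ν)` the terms with `∇v` integrate to zero
against `(ω, u)` as above, and the last one contributes `(2ν²)⁻¹ ∫ ⟨ω, u⟩ |u|²`
(`integral_inner_velocityRicci`).

All integrations by parts are instances of Gaffney's theorem: `∫ div X = 0` if `X` and `div X` are
integrable (`integral_divergence_eq_zero`), applied to `X × Y` and to the contraction of `ω` with
`∇u`. Its proof needs three facts about the Riemannian measure and distance. First, closed balls of
a complete manifold are compact (`properSpace_of_isRiemannianManifold`), so there are compactly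
supported cutoff functions of small Lipschitz constant. Second, in a chart the measure has density
`√g` and `√g div X = ∑ᵢ ∂ᵢ (√g Xⁱ)` (`coordDensity_mul_divergence`); in dimension three `√g` is, up
to sign, the triple product of the coordinate vector fields, which is differentiated with `∇vol = 0`.
Third, a `K`-Lipschitz function `φ` has `|dφ(X)| ≤ K |X|` in charts almost everywhere. Together they
give `|∫ φ div X| ≤ K ∫ |X|` for compactly supported `φ` (`abs_integral_mul_divergence_le`).
-/

set_option linter.unusedSectionVars false

noncomputable section

namespace HelicityNS

/-! ### Smooth vector fields -/

section Calculus

variable {n : ℕ} {M : Type*} [TopologicalSpace M] [ChartedSpace (EuclideanSpace ℝ (Fin n)) M]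
  [IsManifold (𝓡 n) ∞ M]

/-- Smoothness of a vector field at a point. -/
abbrev SmoothAt (X : VecField n M) (x : M) : Prop :=
  ContMDiffAt (𝓡 n) (𝓡 n).tangent ∞
    (fun y => TotalSpace.mk' (EuclideanSpace ℝ (Fin n)) y (X y)) x

/-- Smoothness of a function at a point. -/
abbrev FunSmoothAt (f : M → ℝ) (x : M) : Prop := ContMDiffAt (𝓡 n) 𝓘(ℝ, ℝ) ∞ f x

theorem two_le_infty : (2 : ℕ∞ω) ≤ ((⊤ : ℕ∞) : ℕ∞ω) := by decide

theorem SmoothAt.diffAt {X : VecField n M} {x : M} (h : SmoothAt X x) : DiffAt X x :=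
  h.mdifferentiableAt (by simp)

theorem SmoothAt.eventually_diffAt {X : VecField n M} {x : M} (h : SmoothAt X x) :
    ∀ᶠ y in 𝓝 x, DiffAt X y := by
  have h1 : ContMDiffAt (𝓡 n) (𝓡 n).tangent 1
    (fun y => TotalSpace.mk' (EuclideanSpace ℝ (Fin n)) y (X y)) x := h.of_le (by simp)
  filter_upwards [(contMDiffAt_iff_contMDiffAt_nhds (by simp)).1 h1] with y hy
    using hy.mdifferentiableAt (by simp)

theorem FunSmoothAt.diff {f : M → ℝ} {x : M} (h : FunSmoothAt (n := n) f x) :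
    MDifferentiableAt (𝓡 n) 𝓘(ℝ) f x :=
  h.mdifferentiableAt (by simp)

theorem FunSmoothAt.eventually_diff {f : M → ℝ} {x : M} (h : FunSmoothAt (n := n) f x) :
    ∀ᶠ y in 𝓝 x, MDifferentiableAt (𝓡 n) 𝓘(ℝ) f y := by
  have h1 : ContMDiffAt (𝓡 n) 𝓘(ℝ, ℝ) 1 f x := h.of_le (by simp)
  filter_upwards [(contMDiffAt_iff_contMDiffAt_nhds (by simp)).1 h1] with y hy
    using hy.mdifferentiableAt (by simp)

theorem ext_self {x : M} (v : TangentSpace (𝓡 n) x) : ext v x = v :=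
  FiberBundle.extend_apply_self _ v

theorem smoothAt_ext {x : M} (v : TangentSpace (𝓡 n) x) : SmoothAt (ext v) x :=
  FiberBundle.contMDiffAt_extend ..

theorem SmoothAt.add {X Y : VecField n M} {x : M} (hX : SmoothAt X x) (hY : SmoothAt Y x) :
    SmoothAt (fun y => X y + Y y) x := ContMDiffAt.add_section hX hY

theorem SmoothAt.sub {X Y : VecField n M} {x : M} (hX : SmoothAt X x) (hY : SmoothAt Y x) :
    SmoothAt (fun y => X y - Y y) x := ContMDiffAt.sub_section hX hY

theorem SmoothAt.neg {X : VecField n M} {x : M} (hX : SmoothAt X x) :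
    SmoothAt (fun y => - X y) x := ContMDiffAt.neg_section hX

theorem SmoothAt.const_smul (c : ℝ) {X : VecField n M} {x : M} (hX : SmoothAt X x) :
    SmoothAt (fun y => c • X y) x := ContMDiffAt.const_smul_section hX

theorem SmoothAt.smul {f : M → ℝ} {X : VecField n M} {x : M} (hf : FunSmoothAt (n := n) f x)
    (hX : SmoothAt X x) : SmoothAt (fun y => f y • X y) x := ContMDiffAt.smul_section hf hX

theorem SmoothAt.sum {ι : Type*} {s : Finset ι} {X : ι → VecField n M} {x : M}
    (hX : ∀ i ∈ s, SmoothAt (X i) x) : SmoothAt (fun y => ∑ i ∈ s, X i y) x :=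
  ContMDiffAt.sum_section hX

theorem SmoothAt.congr {X Y : VecField n M} {x : M} (hX : SmoothAt X x)
    (h : ∀ᶠ y in 𝓝 x, Y y = X y) : SmoothAt Y x :=
  ContMDiffAt.congr_of_eventuallyEq hX (h.mono fun y hy => by simp [hy])

theorem DiffAt.smul {f : M → ℝ} {X : VecField n M} {x : M}
    (hf : MDifferentiableAt (𝓡 n) 𝓘(ℝ) f x)
    (hX : DiffAt X x) : DiffAt (fun y => f y • X y) x := MDifferentiableAt.smul_section hf hX

theorem DiffAt.add {X Y : VecField n M} {x : M} (hX : DiffAt X x) (hY : DiffAt Y x) :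
    DiffAt (fun y => X y + Y y) x := mdifferentiableAt_add_section hX hY

theorem DiffAt.sum {ι : Type*} {s : Finset ι} {X : ι → VecField n M} {x : M}
    (hX : ∀ i ∈ s, DiffAt (X i) x) : DiffAt (fun y => ∑ i ∈ s, X i y) x :=
  MDifferentiableAt.sum_section hX

theorem DiffAt.congr {X Y : VecField n M} {x : M} (hX : DiffAt X x)
    (h : ∀ᶠ y in 𝓝 x, Y y = X y) : DiffAt Y x :=
  MDifferentiableAt.congr_of_eventuallyEq hX (h.mono fun y hy => by simp [hy])

theorem smoothAt_mlieBracket {X Y : VecField n M} {x : M} (hX : SmoothAt X x)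
    (hY : SmoothAt Y x) : SmoothAt (VectorField.mlieBracket (𝓡 n) X Y) x := by
  have : IsManifold (𝓡 n) ((⊤ : ℕ∞) + 1 : ℕ∞ω) M := by
    simpa using (inferInstance : IsManifold (𝓡 n) ∞ M)
  have : IsManifold (𝓡 n) (minSmoothness ℝ 2) M := by
    rw [minSmoothness_of_isRCLikeNormedField]
    infer_instance
  exact ContMDiffAt.mlieBracket_vectorField (n := ⊤) (m := ⊤) hX hY (by simp)

theorem mvfderiv_congr {f g : M → ℝ} {x : M} (h : f =ᶠ[𝓝 x] g) :
    mvfderiv (𝓡 n) f x = mvfderiv (𝓡 n) g x := by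
  simp only [mvfderiv]
  rw [h.mfderiv_eq, h.eq_of_nhds]

/-- The derivative of a smooth function along a smooth vector field is smooth: if `Z` does not
vanish at `x`, it is the coefficient of `Z` in `[X, fZ] - f[X, Z]`. -/
theorem contMDiffAt_mvfderiv {f : M → ℝ} {X : VecField n M} {x : M}
    [RiemannianBundle (fun x : M => TangentSpace (𝓡 n) x)]
    [IsContMDiffRiemannianBundle (𝓡 n) ∞ (EuclideanSpace ℝ (Fin n))
      (fun x : M => TangentSpace (𝓡 n) x)]
    (hf : FunSmoothAt (n := n) f x) (hX : SmoothAt X x) :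
    FunSmoothAt (n := n) (fun y => mvfderiv (𝓡 n) f y (X y)) x := by
  by_cases hz : ∃ z : TangentSpace (𝓡 n) x, z ≠ 0
  · obtain ⟨z, hz⟩ := hz
    have hZ := smoothAt_ext z
    have hW : SmoothAt (fun y => VectorField.mlieBracket (𝓡 n) X (fun y => f y • ext z y) y -
        f y • VectorField.mlieBracket (𝓡 n) X (ext z) y) x :=
      (smoothAt_mlieBracket hX (hZ.smul hf)).sub ((smoothAt_mlieBracket hX hZ).smul hf)
    have hWZ := ContMDiffAt.inner_bundle hW hZ
    have hZZ := ContMDiffAt.inner_bundle hZ hZ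
    have h0 : (inner ℝ (ext z x) (ext z x) : ℝ) ≠ 0 := by
      rw [ext_self]; exact inner_self_ne_zero.2 hz
    have hne : ∀ᶠ y in 𝓝 x, (inner ℝ (ext z y) (ext z y) : ℝ) ≠ 0 :=
      hZZ.continuousAt.eventually_ne h0
    refine (hWZ.div₀ hZZ h0).congr_of_eventuallyEq ?_
    filter_upwards [hne, hf.eventually_diff, hZ.eventually_diffAt] with y hy hfy hZy
    have := VectorField.mlieBracket_smul_right (V := X) hfy hZy
    change VectorField.mlieBracket (𝓡 n) X (fun y => f y • ext z y) y = _ at this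
    simp only [Pi.div_apply]
    rw [this, add_sub_cancel_right, inner_smul_left]
    simp only [RCLike.conj_to_real]
    field_simp
  -- the tangent space is zero, and so is the dimension
  · push Not at hz
    have hn : Subsingleton (EuclideanSpace ℝ (Fin n)) := by
      refine subsingleton_of_forall_eq 0 fun y => ?_
      exact hz y
    have : (fun y => mvfderiv (𝓡 n) f y (X y)) = fun _ => 0 := by
      funext y
      have : X y = 0 := hn.elim _ _
      rw [this, map_zero]
    rw [this]
    exact contMDiffAt_const

/-- The Lie bracket acts on smooth functions as the commutator of derivations. The proof compares
both sides of the Jacobi identity `[X, [Y, fZ]] = [[X, Y], fZ] + [Y, [X, fZ]]`. -/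
theorem mvfderiv_mlieBracket {f : M → ℝ} {X Y : VecField n M} {x : M}
    [RiemannianBundle (fun x : M => TangentSpace (𝓡 n) x)]
    [IsContMDiffRiemannianBundle (𝓡 n) ∞ (EuclideanSpace ℝ (Fin n))
      (fun x : M => TangentSpace (𝓡 n) x)]
    (hf : FunSmoothAt (n := n) f x) (hX : SmoothAt X x) (hY : SmoothAt Y x) :
    mvfderiv (𝓡 n) f x (VectorField.mlieBracket (𝓡 n) X Y x) =
      mvfderiv (𝓡 n) (fun y => mvfderiv (𝓡 n) f y (Y y)) x (X x) -
      mvfderiv (𝓡 n) (fun y => mvfderiv (𝓡 n) f y (X y)) x (Y x) := by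
  by_cases hz : ∃ z : TangentSpace (𝓡 n) x, z ≠ 0
  · obtain ⟨z, hz⟩ := hz
    have hZ := smoothAt_ext z
    have hms : minSmoothness ℝ 2 = 2 := by simp
    have : IsManifold (𝓡 n) (minSmoothness ℝ 3) M := by
      simp only [minSmoothness_of_isRCLikeNormedField]
      infer_instance
    have jac : ∀ Z : VecField n M, SmoothAt Z x → _ := fun Z hZ =>
      VectorField.leibniz_identity_mlieBracket_apply (I := 𝓡 n) (U := X) (V := Y) (W := Z) (x := x)
        (by rw [hms]; exact hX.of_le two_le_infty)
        (by rw [hms]; exact hY.of_le two_le_infty) (by rw [hms]; exact hZ.of_le two_le_infty)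
    have hXf := contMDiffAt_mvfderiv hf hX
    have hYf := contMDiffAt_mvfderiv hf hY
    have key : ∀ {U V : VecField n M}, SmoothAt U x → SmoothAt V x →
        VectorField.mlieBracket (𝓡 n) U (VectorField.mlieBracket (𝓡 n) V (f • ext z)) x =
        mvfderiv (𝓡 n) (fun y => mvfderiv (𝓡 n) f y (V y)) x (U x) • z +
        mvfderiv (𝓡 n) f x (V x) • VectorField.mlieBracket (𝓡 n) U (ext z) x +
        (mvfderiv (𝓡 n) f x (U x) • VectorField.mlieBracket (𝓡 n) V (ext z) x +
        f x • VectorField.mlieBracket (𝓡 n) U (VectorField.mlieBracket (𝓡 n) V (ext z)) x) := by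
      intro U V hU hV
      have e : VectorField.mlieBracket (𝓡 n) V (f • ext z) =ᶠ[𝓝 x]
          (fun y => mvfderiv (𝓡 n) f y (V y)) • ext z +
            f • VectorField.mlieBracket (𝓡 n) V (ext z) := by
        filter_upwards [hf.eventually_diff, hZ.eventually_diffAt] with y hfy hZy
        rw [VectorField.mlieBracket_smul_right hfy hZy]
        rfl
      have hVf := contMDiffAt_mvfderiv hf hV
      have hVZ := smoothAt_mlieBracket hV hZ
      rw [Filter.EventuallyEq.mlieBracket_vectorField_eq (EventuallyEq.refl _ U) e,
        VectorField.mlieBracket_add_right (W := (fun y => mvfderiv (𝓡 n) f y (V y)) • ext z)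
          (W₁ := f • VectorField.mlieBracket (𝓡 n) V (ext z)) (hZ.smul hVf).diffAt
          (hVZ.smul hf).diffAt,
        VectorField.mlieBracket_smul_right hVf.diff hZ.diffAt,
        VectorField.mlieBracket_smul_right hf.diff hVZ.diffAt, ext_self]
    have h1 := jac (f • ext z) (hZ.smul hf)
    rw [key hX hY, key hY hX, VectorField.mlieBracket_smul_right hf.diff hZ.diffAt,
      jac _ hZ, ext_self] at h1
    have h2 : (mvfderiv (𝓡 n) f x (VectorField.mlieBracket (𝓡 n) X Y x) -
      (mvfderiv (𝓡 n) (fun y => mvfderiv (𝓡 n) f y (Y y)) x (X x) -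
      mvfderiv (𝓡 n) (fun y => mvfderiv (𝓡 n) f y (X y)) x (Y x))) • z = 0 := by
      simp only [smul_add] at h1
      simp only [sub_smul]
      rw [← sub_eq_zero] at h1
      rw [← neg_eq_zero, ← h1]
      abel
    have := (smul_eq_zero.1 h2).resolve_right hz
    linarith
  · push Not at hz
    rw [hz (VectorField.mlieBracket (𝓡 n) X Y x), hz (X x), hz (Y x)]
    simp only [map_zero, sub_self]

end Calculus

section LeviCivita

variable {n : ℕ} {M : Type*} [TopologicalSpace M] [ChartedSpace (EuclideanSpace ℝ (Fin n)) M]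
  [IsManifold (𝓡 n) ∞ M] [RiemannianBundle (fun x : M => TangentSpace (𝓡 n) x)]
  [IsContMDiffRiemannianBundle (𝓡 n) ∞ (EuclideanSpace ℝ (Fin n))
    (fun x : M => TangentSpace (𝓡 n) x)]

theorem SmoothAt.inner {X Y : VecField n M} {x : M} (hX : SmoothAt X x) (hY : SmoothAt Y x) :
    FunSmoothAt (n := n) (fun y => inner ℝ (X y) (Y y)) x :=
  ContMDiffAt.inner_bundle hX hY

/-! ### Smooth orthonormal frames -/

/-- A family of vector fields which are smooth at `x` and orthonormal near `x`. -/
structure IsFrameAt (E : Fin n → VecField n M) (x : M) : Prop where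
  smooth : ∀ i, SmoothAt (E i) x
  orthonormal : ∀ᶠ y in 𝓝 x, Orthonormal ℝ (fun i => E i y)

/-- `n` orthonormal tangent vectors form an orthonormal basis. -/
def basisOfOrthonormal {x : M} {e : Fin n → TangentSpace (𝓡 n) x} (h : Orthonormal ℝ e) :
    OrthonormalBasis (Fin n) ℝ (TangentSpace (𝓡 n) x) :=
  (basisOfLinearIndependentOfCardEqFinrank' e h.linearIndependent
    (by rw [(finrankTangent x).out, Fintype.card_fin])).toOrthonormalBasis (by
      simpa using h)

theorem basisOfOrthonormal_apply {x : M} {e : Fin n → TangentSpace (𝓡 n) x}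
    (h : Orthonormal ℝ e) (i : Fin n) : basisOfOrthonormal h i = e i := by
  simp [basisOfOrthonormal]

theorem coe_basisOfOrthonormal {x : M} {e : Fin n → TangentSpace (𝓡 n) x}
    (h : Orthonormal ℝ e) : ⇑(basisOfOrthonormal h) = e :=
  funext (basisOfOrthonormal_apply h)

/-- The Gram-Schmidt process turns a smooth local frame into a smooth orthonormal one. -/
theorem isFrameAt_gramSchmidtNormed {s : Fin n → VecField n M} {U : Set M} {x : M} (hU : U ∈ 𝓝 x)
    (hs : IsLocalFrameOn (𝓡 n) (EuclideanSpace ℝ (Fin n)) ∞ s U) :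
    IsFrameAt (fun i y => InnerProductSpace.gramSchmidtNormed ℝ (fun j => s j y) i) x where
  orthonormal := by
    filter_upwards [hU] with y hy
    exact InnerProductSpace.gramSchmidtNormed_orthonormal (hs.linearIndependent hy)
  smooth := by
    have hli := hs.linearIndependent (mem_of_mem_nhds hU)
    have hsq : ∀ i, SmoothAt (fun y => InnerProductSpace.gramSchmidt ℝ (fun j => s j y) i) x →
        FunSmoothAt (n := n)
          (fun y => ‖InnerProductSpace.gramSchmidt ℝ (fun j => s j y) i‖ ^ 2) x := by
      intro i h
      refine (h.inner h).congr_of_eventuallyEq (Eventually.of_forall fun y => ?_)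
      exact (real_inner_self_eq_norm_sq _).symm
    have hne : ∀ i, ‖InnerProductSpace.gramSchmidt ℝ (fun j => s j x) i‖ ≠ 0 := fun i =>
      norm_ne_zero_iff.2 (InnerProductSpace.gramSchmidt_ne_zero i hli)
    have hg : ∀ i, SmoothAt (fun y => InnerProductSpace.gramSchmidt ℝ (fun j => s j y) i) x := by
      intro i
      induction i using WellFoundedLT.induction with
      | ind i ih =>
        have e : (fun y => InnerProductSpace.gramSchmidt ℝ (fun j => s j y) i) = fun y =>
            s i y - ∑ j ∈ Finset.Iio i, ((inner ℝ (InnerProductSpace.gramSchmidt ℝ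
              (fun j => s j y) j) (s i y) : ℝ) /
              ‖InnerProductSpace.gramSchmidt ℝ (fun j => s j y) j‖ ^ 2) •
              InnerProductSpace.gramSchmidt ℝ (fun j => s j y) j := by
          funext y
          rw [eq_sub_iff_add_eq]
          exact (InnerProductSpace.gramSchmidt_def'' ℝ (fun j => s j y) i).symm
        rw [e]
        refine SmoothAt.sub ((hs.contMDiffOn i).contMDiffAt hU) (SmoothAt.sum fun j hj => ?_)
        have hj' := ih j (Finset.mem_Iio.1 hj)
        refine SmoothAt.smul ?_ hj'
        exact ContMDiffAt.div₀ (hj'.inner ((hs.contMDiffOn i).contMDiffAt hU)) (hsq j hj')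
          (pow_ne_zero 2 (hne j))
    intro i
    have e : (fun y => InnerProductSpace.gramSchmidtNormed ℝ (fun j => s j y) i) = fun y =>
        (√(‖InnerProductSpace.gramSchmidt ℝ (fun j => s j y) i‖ ^ 2))⁻¹ •
          InnerProductSpace.gramSchmidt ℝ (fun j => s j y) i := by
      funext y
      rw [Real.sqrt_sq (norm_nonneg _)]
      rfl
    rw [e]
    refine SmoothAt.smul ?_ (hg i)
    have h1 : ContMDiffAt 𝓘(ℝ, ℝ) 𝓘(ℝ, ℝ) ∞ (fun r : ℝ => (√r)⁻¹)
        (‖InnerProductSpace.gramSchmidt ℝ (fun j => s j x) i‖ ^ 2) := by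
      refine ContDiffAt.contMDiffAt (ContDiffAt.inv (Real.contDiffAt_sqrt ?_) ?_)
      · exact pow_ne_zero 2 (hne i)
      · rw [Real.sqrt_sq (norm_nonneg _)]
        exact hne i
    exact ContMDiffAt.comp (g := fun r : ℝ => (√r)⁻¹) x h1 (hsq i (hg i))

theorem exists_isFrameAt (x : M) : ∃ E : Fin n → VecField n M, IsFrameAt E x := by
  have h := Bundle.Trivialization.isLocalFrameOn_localFrame_baseSet (𝓡 n) ∞
    (trivializationAt (EuclideanSpace ℝ (Fin n)) (TangentSpace (𝓡 n)) x)
    (EuclideanSpace.basisFun (Fin n) ℝ).toBasis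
  exact ⟨_, isFrameAt_gramSchmidtNormed ((Bundle.Trivialization.open_baseSet _).mem_nhds
    (FiberBundle.mem_baseSet_trivializationAt' x)) h⟩

theorem IsFrameAt.eventually_sum {E : Fin n → VecField n M} {x : M} (hE : IsFrameAt E x)
    (X : VecField n M) : ∀ᶠ y in 𝓝 x, X y = ∑ i, (inner ℝ (E i y) (X y) : ℝ) • E i y := by
  filter_upwards [hE.orthonormal] with y hy
  conv_lhs => rw [← (basisOfOrthonormal hy).sum_repr' (X y)]
  simp only [basisOfOrthonormal_apply]

/-- A vector field is smooth if its components in a smooth orthonormal frame are. -/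
theorem IsFrameAt.smoothAt {E : Fin n → VecField n M} {x : M} (hE : IsFrameAt E x)
    {X : VecField n M} (h : ∀ i, FunSmoothAt (n := n) (fun y => inner ℝ (E i y) (X y)) x) :
    SmoothAt X x :=
  SmoothAt.congr (SmoothAt.sum fun i _ => SmoothAt.smul (h i) (hE.smooth i))
    (hE.eventually_sum X)

/-! ### Calculus with the Levi-Civita connection -/

theorem leviCivita_add {X Y : VecField n M} {x : M} (hX : DiffAt X x) (hY : DiffAt Y x) :
    leviCivita (fun y => X y + Y y) x = leviCivita X x + leviCivita Y x :=
  leviCivita.isCovariantDerivativeOnUniv.add hX hY (mem_univ x)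

theorem leviCivita_smul {f : M → ℝ} {X : VecField n M} {x : M}
    (hf : MDifferentiableAt (𝓡 n) 𝓘(ℝ) f x) (hX : DiffAt X x) (v : TangentSpace (𝓡 n) x) :
    leviCivita (fun y => f y • X y) x v =
      f x • leviCivita X x v + mvfderiv (𝓡 n) f x v • X x := by
  have := leviCivita.isCovariantDerivativeOnUniv.leibniz hX hf (mem_univ x)
  change leviCivita (fun y => f y • X y) x = _ at this
  rw [this]
  simp

theorem leviCivita_const_smul (c : ℝ) {X : VecField n M} {x : M} (hX : DiffAt X x) :
    leviCivita (fun y => c • X y) x = c • leviCivita X x := by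
  ext1 v
  rw [leviCivita_smul (f := fun _ => c) mdifferentiableAt_const hX, mvfderiv_const]
  simp

theorem leviCivita_sub {X Y : VecField n M} {x : M} (hX : DiffAt X x) (hY : DiffAt Y x) :
    leviCivita (fun y => X y - Y y) x = leviCivita X x - leviCivita Y x := by
  have hY' : DiffAt (fun y => (-1 : ℝ) • Y y) x := DiffAt.smul mdifferentiableAt_const hY
  have h := leviCivita_add hX hY'
  rw [leviCivita_const_smul _ hY] at h
  simpa [sub_eq_add_neg] using h

theorem leviCivita_congr {X Y : VecField n M} {x : M} (hX : DiffAt X x)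
    (h : ∀ᶠ y in 𝓝 x, Y y = X y) : leviCivita Y x = leviCivita X x :=
  IsCovariantDerivativeOn.congr_of_eventuallyEq (leviCivita.isCovariantDerivativeOn (s := univ))
    (hX.congr h) hX univ_mem h

theorem leviCivita_sum {ι : Type*} {s : Finset ι} {X : ι → VecField n M} {x : M}
    (hX : ∀ i ∈ s, DiffAt (X i) x) :
    leviCivita (fun y => ∑ i ∈ s, X i y) x = ∑ i ∈ s, leviCivita (X i) x := by
  classical
  induction s using Finset.induction_on with
  | empty =>
    simp only [Finset.sum_empty]
    exact congrFun (CovariantDerivative.zero (leviCivita (n := n) (M := M))) x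
  | insert a s ha ih =>
    simp only [Finset.sum_insert ha]
    rw [leviCivita_add (hX a (by simp)) (DiffAt.sum fun i hi => hX i (by simp [hi])),
      ih fun i hi => hX i (by simp [hi])]

theorem mvfderiv_inner {X Y : VecField n M} {x : M} (hX : DiffAt X x) (hY : DiffAt Y x)
    (v : TangentSpace (𝓡 n) x) :
    mvfderiv (𝓡 n) (fun y => inner ℝ (X y) (Y y)) x v =
      inner ℝ (leviCivita X x v) (Y x) + inner ℝ (X x) (leviCivita Y x v) := by
  have := (isMetricCompatible_leviCivita (n := n) (M := M)).mvfderiv_inner_eq (ext v) hX hY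
  simpa only [ext_self] using this

theorem leviCivita_sub_leviCivita {X Y : VecField n M} {x : M} (hX : DiffAt X x)
    (hY : DiffAt Y x) :
    (leviCivita : AffineConnection n M) Y x (X x) - leviCivita X x (Y x) =
      VectorField.mlieBracket (𝓡 n) X Y x :=
  (CovariantDerivative.torsion_eq_zero_iff (leviCivita (n := n) (M := M))).1 torsion_leviCivita
    hX hY

theorem smoothAt_leviCivita {X Y : VecField n M} {x : M} (hX : SmoothAt X x)
    (hY : SmoothAt Y x) : SmoothAt (fun y => leviCivita X y (Y y)) x := by
  obtain ⟨E, hE⟩ := exists_isFrameAt (n := n) x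
  refine hE.smoothAt fun i => ?_
  have hZ := hE.smooth i
  have hk : FunSmoothAt (n := n) (koszul Y X (E i)) x := by
    unfold koszul
    refine contMDiffAt_const.mul ((((((contMDiffAt_mvfderiv (hX.inner hZ) hY).add
      (contMDiffAt_mvfderiv (hY.inner hZ) hX)).sub
      (contMDiffAt_mvfderiv (hY.inner hX) hZ)).add
      ((smoothAt_mlieBracket hY hX).inner hZ)).sub
      ((smoothAt_mlieBracket hY hZ).inner hX)).sub
      ((smoothAt_mlieBracket hX hZ).inner hY))
  refine hk.congr_of_eventuallyEq ?_
  filter_upwards [hX.eventually_diffAt, hY.eventually_diffAt, hZ.eventually_diffAt]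
    with y h1 h2 h3
  rw [real_inner_comm, inner_leviCivita h2 h1 h3]

end LeviCivita

/-! ### Traces in orthonormal bases -/

section Trace

variable {V F : Type*} [NormedAddCommGroup V] [InnerProductSpace ℝ V] [AddCommGroup F] [Module ℝ F]
  {ι : Type*} [Fintype ι]

/-- The trace of a bilinear map does not depend on the orthonormal basis. -/
theorem sum_bilin_eq (B : V →ₗ[ℝ] V →ₗ[ℝ] F) (b c : OrthonormalBasis ι ℝ V) :
    ∑ i, B (b i) (b i) = ∑ i, B (c i) (c i) := by
  classical
  have h1 : ∀ i, B (b i) (b i) =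
      ∑ j, ∑ k, ((inner ℝ (b i) (c k) : ℝ) * inner ℝ (b i) (c j)) • B (c j) (c k) := by
    intro i
    conv_lhs => rw [← c.sum_repr' (b i)]
    simp only [map_sum, map_smul, LinearMap.sum_apply, LinearMap.smul_apply, Finset.smul_sum,
      smul_smul, real_inner_comm (b i)]
    rw [Finset.sum_comm]
  simp only [h1]
  rw [Finset.sum_comm]
  refine Finset.sum_congr rfl fun j _ => ?_
  rw [Finset.sum_comm]
  have h2 : ∀ k, ∑ i, ((inner ℝ (b i) (c k) : ℝ) * inner ℝ (b i) (c j)) • B (c j) (c k) =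
      (if j = k then (1 : ℝ) else 0) • B (c j) (c k) := by
    intro k
    rw [← Finset.sum_smul]
    congr 1
    have := b.sum_inner_mul_inner (c j) (c k)
    rw [orthonormal_iff_ite.1 c.orthonormal j k] at this
    rw [← this]
    exact Finset.sum_congr rfl fun i _ => by rw [real_inner_comm (b i) (c j), mul_comm]
  simp only [h2]
  simp

/-- The derivative of a trace does not see the rotation of the orthonormal basis: the vectors `wᵢ`
are the derivatives of the basis vectors `eᵢ`, so their coefficients are skew-symmetric. -/
theorem sum_bilin_skew (B : V →ₗ[ℝ] V →ₗ[ℝ] F) (e : OrthonormalBasis ι ℝ V) (w : ι → V)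
    (hw : ∀ i j, (inner ℝ (w i) (e j) : ℝ) = - inner ℝ (e i) (w j)) :
    ∑ i, (B (w i) (e i) + B (e i) (w i)) = 0 := by
  have h1 : ∑ i, B (w i) (e i) = ∑ i, ∑ j, (inner ℝ (e j) (w i) : ℝ) • B (e j) (e i) := by
    refine Finset.sum_congr rfl fun i _ => ?_
    conv_lhs => rw [← e.sum_repr' (w i)]
    simp only [map_sum, map_smul, LinearMap.sum_apply, LinearMap.smul_apply]
  have h2 : ∑ i, B (e i) (w i) = ∑ i, ∑ j, (inner ℝ (e i) (w j) : ℝ) • B (e j) (e i) := by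
    rw [Finset.sum_comm]
    refine Finset.sum_congr rfl fun i _ => ?_
    conv_lhs => rw [← e.sum_repr' (w i)]
    simp only [map_sum, map_smul]
  rw [Finset.sum_add_distrib, h1, h2, ← Finset.sum_add_distrib]
  refine Finset.sum_eq_zero fun i _ => ?_
  rw [← Finset.sum_add_distrib]
  refine Finset.sum_eq_zero fun j _ => ?_
  rw [← add_smul, real_inner_comm, hw i j, neg_add_cancel, zero_smul]

/-- The bilinear form `(v, w) ↦ ⟨Tv, w⟩`. -/
def innerBilin (T : V →ₗ[ℝ] V) : V →ₗ[ℝ] V →ₗ[ℝ] ℝ :=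
  LinearMap.mk₂ ℝ (fun v w => inner ℝ (T v) w) (by simp [inner_add_left])
    (by simp [inner_smul_left]) (by simp [inner_add_right]) (by simp [inner_smul_right])

theorem innerBilin_apply (T : V →ₗ[ℝ] V) (v w : V) : innerBilin T v w = inner ℝ (T v) w := rfl

end Trace

section Curvature

variable {n : ℕ} {M : Type*} [TopologicalSpace M] [ChartedSpace (EuclideanSpace ℝ (Fin n)) M]
  [IsManifold (𝓡 n) ∞ M] [RiemannianBundle (fun x : M => TangentSpace (𝓡 n) x)]
  [IsContMDiffRiemannianBundle (𝓡 n) ∞ (EuclideanSpace ℝ (Fin n))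
    (fun x : M => TangentSpace (𝓡 n) x)]

/-! ### The second covariant derivative -/

theorem diffAt_leviCivita {X W : VecField n M} {x : M} (hX : SmoothAt X x) (hW : DiffAt W x) :
    DiffAt (fun y => leviCivita X y (W y)) x := by
  obtain ⟨E, hE⟩ := exists_isFrameAt (n := n) x
  refine DiffAt.congr (X := fun y => ∑ i, (inner ℝ (E i y) (W y) : ℝ) • leviCivita X y (E i y))
    (DiffAt.sum fun i _ => DiffAt.smul (diff_inner (hE.smooth i).diffAt hW)
      (smoothAt_leviCivita hX (hE.smooth i)).diffAt) ?_
  filter_upwards [hE.eventually_sum W] with y hy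
  conv_lhs => rw [hy]
  simp only [map_sum, map_smul]

/-- The expression `∇_v ∇_W X - ∇_{∇_v W} X` depends on `W` only through its value at the point. -/
theorem tensorial_secondCov {X : VecField n M} {x : M} (hX : SmoothAt X x)
    (v : TangentSpace (𝓡 n) x) : TensorialAt (𝓡 n) (EuclideanSpace ℝ (Fin n))
      (fun W : VecField n M => leviCivita (fun y => leviCivita X y (W y)) x v -
        leviCivita X x (leviCivita W x v)) x where
  smul {f W} hf hW := by
    have h1 := leviCivita_smul hf (diffAt_leviCivita hX hW) v
    have h2 := leviCivita_smul hf hW v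
    have e : f • W = fun y => f y • W y := rfl
    simp only [e, map_smul, h1, h2, map_add, smul_sub]
    abel
  add {W W'} hW hW' := by
    have h1 := leviCivita_add (diffAt_leviCivita hX hW) (diffAt_leviCivita hX hW')
    have h2 := leviCivita_add hW hW'
    have e : W + W' = fun y => W y + W' y := rfl
    simp only [e, map_add, h1, h2, add_apply]
    abel

/-- The second covariant derivative does not depend on the extension of the second vector. -/
theorem secondCov_eq {X W : VecField n M} {x : M} (hX : SmoothAt X x) (hW : DiffAt W x)
    (v : TangentSpace (𝓡 n) x) :
    secondCov X x v (W x) = leviCivita (fun y => leviCivita X y (W y)) x v -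
        leviCivita X x (leviCivita W x v) := by
  rw [← (tensorial_secondCov hX v).pointwise (diffAt_ext (W x)) hW (ext_self _)]
  rfl

/-- The second covariant derivative as a bilinear map. -/
def secondCovBilin {X : VecField n M} {x : M} (hX : SmoothAt X x) :
    TangentSpace (𝓡 n) x →ₗ[ℝ] TangentSpace (𝓡 n) x →ₗ[ℝ] TangentSpace (𝓡 n) x :=
  have h : ∀ v w, secondCov X x v w = TensorialAt.mkHom _ _ (tensorial_secondCov hX v) w :=
    fun v w => (TensorialAt.mkHom_apply_eq_extend (tensorial_secondCov hX v) w).symm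
  LinearMap.mk₂ ℝ (secondCov X x)
    (fun v v' w => by simp only [secondCov, map_add]; abel)
    (fun c v w => by simp only [secondCov, map_smul, smul_sub])
    (fun v w w' => by simp only [h, map_add])
    (fun c v w => by simp only [h, map_smul])

theorem secondCovBilin_apply {X : VecField n M} {x : M} (hX : SmoothAt X x)
    (v w : TangentSpace (𝓡 n) x) : secondCovBilin hX v w = secondCov X x v w := rfl

/-! ### Symmetries of the curvature tensor -/

theorem curvature_eq {X Y Z : VecField n M} {x : M} (hX : SmoothAt X x) (hY : SmoothAt Y x)
    (hZ : SmoothAt Z x) : curvature leviCivita X Y Z x =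
      secondCov Z x (X x) (Y x) - secondCov Z x (Y x) (X x) := by
  rw [secondCov_eq hZ hY.diffAt, secondCov_eq hZ hX.diffAt, curvature,
    ← leviCivita_sub_leviCivita hX.diffAt hY.diffAt, map_sub]
  abel

theorem mvfderiv_mvfderiv_inner {X Y Z W : VecField n M} {x : M} (hX : SmoothAt X x)
    (hZ : SmoothAt Z x) (hW : SmoothAt W x) :
    mvfderiv (𝓡 n) (fun y => mvfderiv (𝓡 n) (fun y => inner ℝ (Z y) (W y)) y (X y)) x (Y x) =
      inner ℝ (leviCivita (fun y => leviCivita Z y (X y)) x (Y x)) (W x) +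
      inner ℝ (leviCivita Z x (X x)) (leviCivita W x (Y x)) +
      (inner ℝ (leviCivita Z x (Y x)) (leviCivita W x (X x)) +
      inner ℝ (Z x) (leviCivita (fun y => leviCivita W y (X y)) x (Y x))) := by
  have e : (fun y => mvfderiv (𝓡 n) (fun y => inner ℝ (Z y) (W y)) y (X y)) =ᶠ[𝓝 x] fun y =>
      inner ℝ (leviCivita Z y (X y)) (W y) + inner ℝ (Z y) (leviCivita W y (X y)) := by
    filter_upwards [hZ.eventually_diffAt, hW.eventually_diffAt] with y h1 h2
    rw [mvfderiv_inner h1 h2]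
  have h1 := smoothAt_leviCivita hZ hX
  have h2 := smoothAt_leviCivita hW hX
  rw [mvfderiv_congr e, mvfderiv_fun_add (h1.inner hW).diff (hZ.inner h2).diff, add_apply,
    mvfderiv_inner h1.diffAt hW.diffAt, mvfderiv_inner hZ.diffAt h2.diffAt]

theorem inner_curvature_skew {X Y Z W : VecField n M} {x : M} (hX : SmoothAt X x)
    (hY : SmoothAt Y x) (hZ : SmoothAt Z x) (hW : SmoothAt W x) :
    inner ℝ (curvature leviCivita X Y Z x) (W x) =
      - inner ℝ (Z x) (curvature leviCivita X Y W x) := by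
  have h := mvfderiv_mlieBracket (hZ.inner hW) hX hY
  rw [mvfderiv_mvfderiv_inner hX hZ hW, mvfderiv_mvfderiv_inner hY hZ hW,
    mvfderiv_inner hZ.diffAt hW.diffAt] at h
  simp only [curvature, inner_sub_left, inner_sub_right]
  linarith

/-- The curvature tensor `R(v, w)z` of the Levi-Civita connection. -/
def riemann (x : M) (v w z : TangentSpace (𝓡 n) x) : TangentSpace (𝓡 n) x :=
  curvature leviCivita (ext v) (ext w) (ext z) x

theorem riemann_eq {Z : VecField n M} {x : M} (hZ : SmoothAt Z x) (v w : TangentSpace (𝓡 n) x) :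
    riemann x v w (Z x) = secondCov Z x v w - secondCov Z x w v := by
  have h : ∀ v w : TangentSpace (𝓡 n) x, curvature leviCivita (ext v) (ext w) Z x =
      secondCov Z x v w - secondCov Z x w v := fun v w => by
    rw [curvature_eq (smoothAt_ext v) (smoothAt_ext w) hZ, ext_self, ext_self]
  rw [← h]
  refine ext_inner_right ℝ fun u => ?_
  have hu := smoothAt_ext u
  have e : u = ext u x := (ext_self u).symm
  rw [e, riemann, inner_curvature_skew (smoothAt_ext v) (smoothAt_ext w) (smoothAt_ext _) hu,
    inner_curvature_skew (smoothAt_ext v) (smoothAt_ext w) hZ hu, ext_self (Z x)]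

theorem riemann_swap (x : M) (v w z : TangentSpace (𝓡 n) x) :
    riemann x v w z = - riemann x w v z := by
  have h := fun v w => riemann_eq (smoothAt_ext z) v w
  simp only [ext_self] at h
  rw [h, h, neg_sub]

theorem inner_riemann_skew (x : M) (v w z u : TangentSpace (𝓡 n) x) :
    (inner ℝ (riemann x v w z) u : ℝ) = - inner ℝ (riemann x v w u) z := by
  have h := inner_curvature_skew (smoothAt_ext v) (smoothAt_ext w) (smoothAt_ext z)
    (smoothAt_ext u)
  rw [ext_self z, ext_self u] at h
  rw [riemann, h, real_inner_comm]
  rfl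

/-- The first Bianchi identity, which for a torsion-free connection is the Jacobi identity. -/
theorem riemann_bianchi (x : M) (a b c : TangentSpace (𝓡 n) x) :
    riemann x a b c + riemann x b c a + riemann x c a b = 0 := by
  have ha := smoothAt_ext a
  have hb := smoothAt_ext b
  have hc := smoothAt_ext c
  have hms : minSmoothness ℝ 2 = 2 := by simp
  have : IsManifold (𝓡 n) (minSmoothness ℝ 3) M := by
    simp only [minSmoothness_of_isRCLikeNormedField]
    infer_instance
  have jac := VectorField.leibniz_identity_mlieBracket_apply (I := 𝓡 n)
    (U := ext a) (V := ext b) (W := ext c) (x := x)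
    (by rw [hms]; exact ha.of_le two_le_infty) (by rw [hms]; exact hb.of_le two_le_infty)
    (by rw [hms]; exact hc.of_le two_le_infty)
  -- `∇_X ∇_Y Z - ∇_X ∇_Z Y = ∇_X [Y, Z]`
  have key : ∀ {X Y Z : VecField n M}, SmoothAt X x → SmoothAt Y x → SmoothAt Z x →
      leviCivita (fun y => leviCivita Z y (Y y)) x (X x) -
      leviCivita (fun y => leviCivita Y y (Z y)) x (X x) =
        VectorField.mlieBracket (𝓡 n) X (VectorField.mlieBracket (𝓡 n) Y Z) x +
        leviCivita X x (VectorField.mlieBracket (𝓡 n) Y Z x) := by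
    intro X Y Z hX hY hZ
    have hYZ := smoothAt_mlieBracket hY hZ
    rw [← leviCivita_sub_leviCivita hX.diffAt hYZ.diffAt, sub_add_cancel, ← sub_apply,
      ← leviCivita_sub (smoothAt_leviCivita hZ hY).diffAt (smoothAt_leviCivita hY hZ).diffAt]
    rw [leviCivita_congr hYZ.diffAt]
    filter_upwards [hY.eventually_diffAt, hZ.eventually_diffAt] with y h1 h2
    exact leviCivita_sub_leviCivita h1 h2
  have k1 := key ha hb hc
  have k2 := key hb hc ha
  have k3 := key hc ha hb
  have s1 := VectorField.mlieBracket_swap_apply (I := 𝓡 n)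
    (V := VectorField.mlieBracket (𝓡 n) (ext a) (ext b)) (W := ext c) (x := x)
  have s2 : VectorField.mlieBracket (𝓡 n) (ext b) (VectorField.mlieBracket (𝓡 n) (ext c) (ext a)) x
    = - VectorField.mlieBracket (𝓡 n) (ext b)
      (VectorField.mlieBracket (𝓡 n) (ext a) (ext c)) x := by
    rw [VectorField.mlieBracket_swap (V := ext c) (W := ext a)]
    have := VectorField.mlieBracket_const_smul_right (I := 𝓡 n) (c := (-1 : ℝ)) (V := ext b)
      (smoothAt_mlieBracket ha hc).diffAt
    simpa using this
  rw [s1] at jac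
  rw [s2] at k2
  simp only [riemann, curvature]
  rw [jac] at k1
  have := congrArg₂ (· + ·) (congrArg₂ (· + ·) k1 k2) k3
  rw [← sub_eq_zero] at this
  refine Eq.trans ?_ this
  abel

/-- The pair symmetry of the curvature tensor, a linear combination of the Bianchi identities and
the skew-symmetries. -/
theorem inner_riemann_pair (x : M) (a b c d : TangentSpace (𝓡 n) x) :
    (inner ℝ (riemann x a b c) d : ℝ) = inner ℝ (riemann x c d a) b := by
  have B : ∀ a b c d : TangentSpace (𝓡 n) x, (inner ℝ (riemann x a b c) d : ℝ) +
      inner ℝ (riemann x b c a) d + inner ℝ (riemann x c a b) d = 0 := fun a b c d => by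
    rw [← inner_add_left, ← inner_add_left, riemann_bianchi, inner_zero_left]
  have S : ∀ a b c d : TangentSpace (𝓡 n) x, (inner ℝ (riemann x a b c) d : ℝ) =
      - inner ℝ (riemann x b a c) d := fun a b c d => by rw [riemann_swap, inner_neg_left]
  have K := inner_riemann_skew (n := n) x
  linarith [B a b c d, B b c d a, B c d a b, B d a b c, S a b c d, S b c a d, S c a b d,
    S b c d a, S c d b a, S d b c a, S c d a b, S d a c b, S a c d b, S d a b c, S a b d c,
    S b d a c, K a b c d, K b c a d, K c a b d, K b c d a, K c d b a, K d b c a, K c d a b,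
    K d a c b, K a c d b, K d a b c, K a b d c, K b d a c, K a c b d, K d b a c, K a d b c]

theorem ricci_eq (x : M) (v : TangentSpace (𝓡 n) x) :
    ricci leviCivita x v = ∑ i, riemann x v (frame x i) (frame x i) := rfl

/-- Commuting covariant derivatives in a divergence produces the Ricci tensor. -/
theorem sum_inner_secondCov {X : VecField n M} {x : M} (hX : SmoothAt X x)
    (v : TangentSpace (𝓡 n) x) :
    ∑ i, (inner ℝ (secondCov X x (frame x i) v) (frame x i) : ℝ) =
      ∑ i, inner ℝ (secondCov X x v (frame x i)) (frame x i) +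
        inner ℝ (ricci leviCivita x (X x)) v := by
  rw [ricci_eq, sum_inner, ← Finset.sum_add_distrib]
  refine Finset.sum_congr rfl fun i _ => ?_
  rw [inner_riemann_pair, riemann_eq hX, inner_sub_left]
  ring

theorem mvfderiv_finset_sum {ι : Type*} {s : Finset ι} {f : ι → M → ℝ} {x : M}
    (hf : ∀ i ∈ s, MDifferentiableAt (𝓡 n) 𝓘(ℝ) (f i) x) :
    mvfderiv (𝓡 n) (fun y => ∑ i ∈ s, f i y) x = ∑ i ∈ s, mvfderiv (𝓡 n) (f i) x := by
  classical
  have : MDifferentiableAt (𝓡 n) 𝓘(ℝ) (fun y => ∑ i ∈ s, f i y) x ∧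
      mvfderiv (𝓡 n) (fun y => ∑ i ∈ s, f i y) x = ∑ i ∈ s, mvfderiv (𝓡 n) (f i) x := by
    induction s using Finset.induction_on with
    | empty => simpa using ⟨mdifferentiableAt_const, mvfderiv_const (I := 𝓡 n) (0 : ℝ)⟩
    | insert a s ha ih =>
      obtain ⟨h1, h2⟩ := ih fun i hi => hf i (by simp [hi])
      simp only [Finset.sum_insert ha]
      exact ⟨(hf a (by simp)).add h1, by rw [mvfderiv_fun_add (hf a (by simp)) h1, h2]⟩
  exact this.2

/-! ### Differential operators in orthonormal frames -/

theorem IsFrameAt.inner_leviCivita_skew {E : Fin n → VecField n M} {x : M} (hE : IsFrameAt E x)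
    (v : TangentSpace (𝓡 n) x) (i j : Fin n) :
    (inner ℝ (leviCivita (E i) x v) (E j x) : ℝ) = - inner ℝ (E i x) (leviCivita (E j) x v) := by
  have h := mvfderiv_inner (hE.smooth i).diffAt (hE.smooth j).diffAt v
  have e : (fun y => (inner ℝ (E i y) (E j y) : ℝ)) =ᶠ[𝓝 x]
      fun _ => if i = j then (1 : ℝ) else 0 := by
    filter_upwards [hE.orthonormal] with y hy
    exact orthonormal_iff_ite.1 hy i j
  rw [mvfderiv_congr e, mvfderiv_const] at h
  simp only [zero_apply] at h
  linarith

theorem IsFrameAt.divergence_eq {E : Fin n → VecField n M} {x : M} (hE : IsFrameAt E x)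
    (X : VecField n M) : ∀ᶠ y in 𝓝 x,
      divergence X y = ∑ i, inner ℝ (leviCivita X y (E i y)) (E i y) := by
  filter_upwards [hE.orthonormal] with y hy
  have := sum_bilin_eq (innerBilin (leviCivita X y).toLinearMap) (frame y) (basisOfOrthonormal hy)
  rw [coe_basisOfOrthonormal] at this
  exact this

theorem funSmoothAt_divergence {X : VecField n M} {x : M} (hX : SmoothAt X x) :
    FunSmoothAt (n := n) (divergence X) x := by
  obtain ⟨E, hE⟩ := exists_isFrameAt (n := n) x
  refine ContMDiffAt.congr_of_eventuallyEq ?_ (hE.divergence_eq X)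
  exact ContMDiffAt.sum fun i _ => (smoothAt_leviCivita hX (hE.smooth i)).inner (hE.smooth i)

theorem mvfderiv_divergence {X : VecField n M} {x : M} (hX : SmoothAt X x)
    (v : TangentSpace (𝓡 n) x) : mvfderiv (𝓡 n) (divergence X) x v =
      ∑ i, inner ℝ (secondCov X x v (frame x i)) (frame x i) := by
  obtain ⟨E, hE⟩ := exists_isFrameAt (n := n) x
  have hs := fun i => smoothAt_leviCivita hX (hE.smooth i)
  have hx := hE.orthonormal.self_of_nhds
  rw [mvfderiv_congr (hE.divergence_eq X)]
  have h1 : mvfderiv (𝓡 n) (fun y => ∑ i, inner ℝ (leviCivita X y (E i y)) (E i y)) x v =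
      ∑ i, mvfderiv (𝓡 n) (fun y => inner ℝ (leviCivita X y (E i y)) (E i y)) x v := by
    rw [mvfderiv_finset_sum (fun i _ => ((hs i).inner (hE.smooth i)).diff)]
    simp
  have h2 : ∑ i, (inner ℝ (secondCov X x v (frame x i)) (frame x i) : ℝ) =
      ∑ i, inner ℝ (secondCov X x v (E i x)) (E i x) := by
    have := sum_bilin_eq (innerBilin (secondCovBilin hX v)) (frame x) (basisOfOrthonormal hx)
    rw [coe_basisOfOrthonormal] at this
    exact this
  have h3 := sum_bilin_skew (innerBilin (leviCivita X x).toLinearMap) (basisOfOrthonormal hx)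
    (fun i => leviCivita (E i) x v) (by
      simpa only [coe_basisOfOrthonormal] using hE.inner_leviCivita_skew v)
  rw [h1, h2, ← sub_eq_zero, ← h3, ← Finset.sum_sub_distrib]
  refine Finset.sum_congr rfl fun i _ => ?_
  rw [mvfderiv_inner (hs i).diffAt (hE.smooth i).diffAt, secondCov_eq hX (hE.smooth i).diffAt]
  simp only [coe_basisOfOrthonormal, innerBilin_apply, inner_sub_left,
    ContinuousLinearMap.coe_coe]
  ring

end Curvature

section Forms

variable {n : ℕ} {M : Type*} [TopologicalSpace M] [ChartedSpace (EuclideanSpace ℝ (Fin n)) M]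
  [IsManifold (𝓡 n) ∞ M] [RiemannianBundle (fun x : M => TangentSpace (𝓡 n) x)]

/-! ### One-forms and two-tensors in terms of vector fields -/

theorem linearOfFrame_eq {x : M} {f : TangentSpace (𝓡 n) x → ℝ} (L : TangentSpace (𝓡 n) x →ₗ[ℝ] ℝ)
    (h : ∀ v, f v = L v) (v : TangentSpace (𝓡 n) x) : linearOfFrame x f v = L v := by
  conv_rhs => rw [← (frame x).sum_repr' v]
  simp [linearOfFrame, h, mul_comm]

theorem bilinearOfFrame_eq {x : M} {f : TangentSpace (𝓡 n) x → TangentSpace (𝓡 n) x → ℝ}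
    (B : TangentSpace (𝓡 n) x →ₗ[ℝ] TangentSpace (𝓡 n) x →ₗ[ℝ] ℝ) (h : ∀ v w, f v w = B v w)
    (v w : TangentSpace (𝓡 n) x) : bilinearOfFrame x f v w = B v w := by
  conv_rhs => rw [← (frame x).sum_repr' v, ← (frame x).sum_repr' w]
  simp only [bilinearOfFrame, h, map_sum, map_smul, LinearMap.sum_apply, LinearMap.smul_apply,
    smul_eq_mul, sum_apply, smul_apply, ContinuousLinearMap.smulRight_apply, innerSL_apply_apply ℝ,
    Finset.mul_sum]
  rw [Finset.sum_comm]
  refine Finset.sum_congr rfl fun i _ => Finset.sum_congr rfl fun j _ => ?_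
  ring

theorem inner_sharp (α : OneForm n M) (x : M) (v : TangentSpace (𝓡 n) x) :
    (inner ℝ (sharp α x) v : ℝ) = α x v := by
  conv_rhs => rw [← (frame x).sum_repr' v]
  simp [sharp, sum_inner, inner_smul_left, mul_comm]

theorem sharp_flat (A : VecField n M) (x : M) : sharp (flat A) x = A x :=
  ext_inner_right ℝ fun v => by rw [inner_sharp]; rfl

theorem inner_grad (f : M → ℝ) (x : M) (v : TangentSpace (𝓡 n) x) :
    (inner ℝ (grad f x) v : ℝ) = mvfderiv (𝓡 n) f x v :=
  inner_sharp _ x v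

variable [IsContMDiffRiemannianBundle (𝓡 n) ∞ (EuclideanSpace ℝ (Fin n))
    (fun x : M => TangentSpace (𝓡 n) x)]

theorem smoothAt_sharp {α : OneForm n M} {x : M} (h : ∀ X : VecField n M, SmoothAt X x →
    FunSmoothAt (n := n) (fun y => α y (X y)) x) : SmoothAt (sharp α) x := by
  obtain ⟨E, hE⟩ := exists_isFrameAt (n := n) x
  refine hE.smoothAt fun i => (h _ (hE.smooth i)).congr_of_eventuallyEq
    (Eventually.of_forall fun y => ?_)
  simp only
  rw [real_inner_comm, inner_sharp]

theorem smoothAt_grad {f : M → ℝ} {x : M} (hf : FunSmoothAt (n := n) f x) :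
    SmoothAt (grad (n := n) f) x :=
  smoothAt_sharp fun _ hX => contMDiffAt_mvfderiv hf hX

/-- The Hessian of a function is symmetric. -/
theorem inner_leviCivita_grad_comm {f : M → ℝ} {x : M} (hf : FunSmoothAt (n := n) f x)
    (v w : TangentSpace (𝓡 n) x) : (inner ℝ (leviCivita (grad (n := n) f) x v) w : ℝ) =
      inner ℝ (leviCivita (grad (n := n) f) x w) v := by
  have hv := smoothAt_ext v
  have hw := smoothAt_ext w
  have hg := smoothAt_grad (n := n) hf
  have h1 := mvfderiv_inner hg.diffAt hv.diffAt w
  have h2 := mvfderiv_inner hg.diffAt hw.diffAt v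
  simp only [inner_grad, ext_self] at h1 h2
  have h3 := mvfderiv_mlieBracket hf hv hw
  rw [← leviCivita_sub_leviCivita hv.diffAt hw.diffAt, map_sub] at h3
  simp only [ext_self] at h3
  linarith

theorem mvfderiv_flat_ext {A : VecField n M} {x : M} (hA : DiffAt A x)
    (v w : TangentSpace (𝓡 n) x) : mvfderiv (𝓡 n) (fun y => flat A y (ext w y)) x v =
      inner ℝ (leviCivita A x v) w + inner ℝ (A x) (leviCivita (ext w) x v) := by
  have := mvfderiv_inner hA (diffAt_ext w) v
  rwa [ext_self] at this

theorem covOneForm_flat {A : VecField n M} {x : M} (hA : DiffAt A x)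
    (v w : TangentSpace (𝓡 n) x) :
    covOneForm (flat A) x v w = inner ℝ (leviCivita A x v) w := by
  refine bilinearOfFrame_eq (innerBilin (leviCivita A x).toLinearMap) (fun v w => ?_) v w
  rw [mvfderiv_flat_ext hA]
  exact add_sub_cancel_right _ _

theorem extDerivOne_flat {A : VecField n M} {x : M} (hA : DiffAt A x)
    (v w : TangentSpace (𝓡 n) x) : extDerivOne (flat A) x v w =
      inner ℝ (leviCivita A x v) w - inner ℝ (leviCivita A x w) v := by
  refine bilinearOfFrame_eq (innerBilin (leviCivita A x).toLinearMap -
    (innerBilin (leviCivita A x).toLinearMap).flip) (fun v w => ?_) v w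
  rw [mvfderiv_flat_ext hA, mvfderiv_flat_ext hA,
    ← leviCivita_sub_leviCivita (diffAt_ext v) (diffAt_ext w), map_sub, ext_self, ext_self]
  change _ = (inner ℝ (leviCivita A x v) w : ℝ) - inner ℝ (leviCivita A x w) v
  change _ - (inner ℝ (A x) _ - inner ℝ (A x) _ : ℝ) = _
  ring

theorem codiffOne_flat {A : VecField n M} {x : M} (hA : DiffAt A x) :
    codiffOne (flat A) x = - divergence A x := by
  simp only [codiffOne, divergence, covOneForm_flat hA]

theorem covTwoTensor_extDerivOne_flat {A : VecField n M} {x : M} (hA : SmoothAt A x)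
    (v w z : TangentSpace (𝓡 n) x) : covTwoTensor (extDerivOne (flat A)) x v w z =
      inner ℝ (secondCov A x v w) z - inner ℝ (secondCov A x v z) w := by
  have hw := smoothAt_ext w
  have hz := smoothAt_ext z
  have e : (fun y => extDerivOne (flat A) y (ext w y) (ext z y)) =ᶠ[𝓝 x] fun y =>
      inner ℝ (leviCivita A y (ext w y)) (ext z y) -
        inner ℝ (leviCivita A y (ext z y)) (ext w y) := by
    filter_upwards [hA.eventually_diffAt] with y hy
    rw [extDerivOne_flat hy]
  have h1 := smoothAt_leviCivita hA hw
  have h2 := smoothAt_leviCivita hA hz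
  rw [covTwoTensor, mvfderiv_congr e, mvfderiv_fun_sub (h1.inner hz).diff (h2.inner hw).diff,
    sub_apply, mvfderiv_inner h1.diffAt hz.diffAt, mvfderiv_inner h2.diffAt hw.diffAt,
    extDerivOne_flat hA.diffAt, extDerivOne_flat hA.diffAt]
  simp only [secondCov, inner_sub_left, ext_self]
  ring

theorem codiffTwo_extDerivOne_flat {A : VecField n M} {x : M} (hA : SmoothAt A x)
    (z : TangentSpace (𝓡 n) x) : codiffTwo (extDerivOne (flat A)) x z =
      ∑ i, (inner ℝ (secondCov A x (frame x i) z) (frame x i) : ℝ) -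
        ∑ i, inner ℝ (secondCov A x (frame x i) (frame x i)) z := by
  refine linearOfFrame_eq (∑ i, ((innerBilin (secondCovBilin hA (frame x i))).flip (frame x i) -
    innerBilin (secondCovBilin hA (frame x i)) (frame x i))) (fun v => ?_) z |>.trans ?_
  · simp only [covTwoTensor_extDerivOne_flat hA, LinearMap.sum_apply, LinearMap.sub_apply,
      LinearMap.flip_apply, innerBilin_apply, secondCovBilin_apply, ← Finset.sum_neg_distrib,
      neg_sub]
  · simp only [LinearMap.sum_apply, LinearMap.sub_apply,
      LinearMap.flip_apply, innerBilin_apply, secondCovBilin_apply, Finset.sum_sub_distrib]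

/-- The Hodge Laplacian of a divergence-free vector field is `d*d`. -/
theorem inner_hodgeLaplacian {A : VecField n M} (hA : ∀ x, SmoothAt A x)
    (hdiv : ∀ x, divergence A x = 0) (x : M) (z : TangentSpace (𝓡 n) x) :
    (inner ℝ (hodgeLaplacian A x) z : ℝ) =
      ∑ i, inner ℝ (secondCov A x (frame x i) z) (frame x i) -
        ∑ i, inner ℝ (secondCov A x (frame x i) (frame x i)) z := by
  have h0 : codiffOne (flat A) = fun _ => 0 := by
    funext y
    rw [codiffOne_flat (hA y).diffAt, hdiv, neg_zero]
  rw [hodgeLaplacian, inner_sharp, hodgeLaplacianOne, h0, mvfderiv_const, zero_add,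
    codiffTwo_extDerivOne_flat (hA x)]

/-- The Bochner formula `□A = -ΔA + Ric A` for a divergence-free vector field. -/
theorem inner_hodgeLaplacian_bochner {A : VecField n M} (hA : ∀ x, SmoothAt A x)
    (hdiv : ∀ x, divergence A x = 0) (x : M) (z : TangentSpace (𝓡 n) x) :
    (inner ℝ (hodgeLaplacian A x) z : ℝ) = inner ℝ (ricci leviCivita x (A x)) z -
        ∑ i, inner ℝ (secondCov A x (frame x i) (frame x i)) z := by
  have h0 : divergence A = fun _ => 0 := funext hdiv
  have h1 := mvfderiv_divergence (hA x) z
  rw [h0, mvfderiv_const, zero_apply] at h1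
  rw [inner_hodgeLaplacian hA hdiv, sum_inner_secondCov (hA x), ← h1, zero_add]

/-- The vector field `X` with `⟨X, z⟩ = ⟨A, ∇_z B⟩`. -/
def contractCov (A B : VecField n M) : VecField n M :=
  sharp fun x => innerSL ℝ (A x) ∘L leviCivita B x

theorem inner_contractCov (A B : VecField n M) (x : M) (z : TangentSpace (𝓡 n) x) :
    (inner ℝ (contractCov A B x) z : ℝ) = inner ℝ (A x) (leviCivita B x z) :=
  inner_sharp _ x z

theorem smoothAt_contractCov {A B : VecField n M} {x : M} (hA : SmoothAt A x)
    (hB : SmoothAt B x) : SmoothAt (contractCov A B) x :=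
  smoothAt_sharp fun _ hX => hA.inner (smoothAt_leviCivita hB hX)

/-- Bochner's integration by parts: `div ⟨A, ∇B⟩ = ⟨∇A, ∇B⟩ + ⟨A, tr ∇²B⟩`. -/
theorem divergence_contractCov {A B : VecField n M} {x : M} (hA : SmoothAt A x)
    (hB : SmoothAt B x) : divergence (contractCov A B) x =
      ∑ i, inner ℝ (leviCivita A x (frame x i)) (leviCivita B x (frame x i)) +
      ∑ i, inner ℝ (secondCov B x (frame x i) (frame x i)) (A x) := by
  rw [divergence, ← Finset.sum_add_distrib]
  refine Finset.sum_congr rfl fun i _ => ?_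
  have he := smoothAt_ext (frame x i)
  have h1 := mvfderiv_inner (smoothAt_contractCov hA hB).diffAt he.diffAt (frame x i)
  simp only [inner_contractCov] at h1
  rw [mvfderiv_inner hA.diffAt (smoothAt_leviCivita hB he).diffAt, ext_self] at h1
  rw [secondCov, inner_sub_left, real_inner_comm (A x), real_inner_comm (A x)]
  linarith

end Forms

section Cross

variable {M : Type*} [TopologicalSpace M] [ChartedSpace (EuclideanSpace ℝ (Fin 3)) M]
  [IsManifold (𝓡 3) ∞ M] [RiemannianBundle (fun x : M => TangentSpace (𝓡 3) x)]

/-! ### The cross product -/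

/-- The determinant of three vectors of `ℝ³`. -/
def det3 (a b c : Fin 3 → ℝ) : ℝ :=
  a 0 * (b 1 * c 2 - b 2 * c 1) - a 1 * (b 0 * c 2 - b 2 * c 0) + a 2 * (b 0 * c 1 - b 1 * c 0)

theorem volForm_eq (o : ManifoldOrientation M) {x : M}
    {e : OrthonormalBasis (Fin 3) ℝ (TangentSpace (𝓡 3) x)}
    (he : e.toBasis.orientation = o.orient x) (a b c : TangentSpace (𝓡 3) x) :
    volForm o x a b c = det3 (fun i => inner ℝ (e i) a) (fun i => inner ℝ (e i) b)
      (fun i => inner ℝ (e i) c) := by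
  rw [volForm, Orientation.volumeForm_robust _ e he, Basis.det_apply, Matrix.det_fin_three]
  simp [Basis.toMatrix_apply, det3, e.repr_apply_apply]
  ring

theorem exists_oriented (o : ManifoldOrientation M) (x : M) :
    ∃ e : OrthonormalBasis (Fin 3) ℝ (TangentSpace (𝓡 3) x),
      e.toBasis.orientation = o.orient x :=
  ⟨(frame x).adjustToOrientation (o.orient x),
    OrthonormalBasis.orientation_adjustToOrientation _ _⟩

/-- The cross product, `⟨a × b, c⟩ = vol(a, b, c)`. -/
def cross (o : ManifoldOrientation M) (x : M) :
    TangentSpace (𝓡 3) x →ₗ[ℝ] TangentSpace (𝓡 3) x →ₗ[ℝ] TangentSpace (𝓡 3) x :=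
  have h := exists_oriented o x
  LinearMap.mk₂ ℝ (fun a b => ∑ k, volForm o x a b (frame x k) • frame x k)
    (fun a a' b => by
      obtain ⟨e, he⟩ := h
      simp only [← Finset.sum_add_distrib, ← add_smul, volForm_eq o he, det3, inner_add_right]
      exact Finset.sum_congr rfl fun k _ => by ring_nf)
    (fun r a b => by
      obtain ⟨e, he⟩ := h
      simp only [Finset.smul_sum, smul_smul, volForm_eq o he, det3, inner_smul_right]
      exact Finset.sum_congr rfl fun k _ => by ring_nf)
    (fun a b b' => by
      obtain ⟨e, he⟩ := h
      simp only [← Finset.sum_add_distrib, ← add_smul, volForm_eq o he, det3, inner_add_right]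
      exact Finset.sum_congr rfl fun k _ => by ring_nf)
    (fun r a b => by
      obtain ⟨e, he⟩ := h
      simp only [Finset.smul_sum, smul_smul, volForm_eq o he, det3, inner_smul_right]
      exact Finset.sum_congr rfl fun k _ => by ring_nf)

theorem inner_cross (o : ManifoldOrientation M) (x : M) (a b c : TangentSpace (𝓡 3) x) :
    (inner ℝ (cross o x a b) c : ℝ) = volForm o x a b c := by
  obtain ⟨e, he⟩ := exists_oriented o x
  let L : TangentSpace (𝓡 3) x →ₗ[ℝ] ℝ :=
    { toFun := fun c => volForm o x a b c
      map_add' := fun c c' => by simp only [volForm_eq o he, det3, inner_add_right]; ring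
      map_smul' := fun r c => by simp [volForm_eq o he, det3, inner_smul_right]; ring }
  change _ = L c
  conv_rhs => rw [← (frame x).sum_repr' c]
  simp only [map_sum, map_smul, smul_eq_mul]
  simp only [cross, LinearMap.mk₂_apply, sum_inner, inner_smul_left, RCLike.conj_to_real]
  exact Finset.sum_congr rfl fun k _ => mul_comm _ _

section

variable (o : ManifoldOrientation M) {x : M} (a b c d : TangentSpace (𝓡 3) x)

theorem inner_cross_eq {e : OrthonormalBasis (Fin 3) ℝ (TangentSpace (𝓡 3) x)}
    (he : e.toBasis.orientation = o.orient x) : (inner ℝ (cross o x a b) c : ℝ) =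
      det3 (fun i => inner ℝ (e i) a) (fun i => inner ℝ (e i) b) (fun i => inner ℝ (e i) c) := by
  rw [inner_cross, volForm_eq o he]

theorem inner_cross_rotate : (inner ℝ (cross o x a b) c : ℝ) = inner ℝ (cross o x b c) a := by
  obtain ⟨e, he⟩ := exists_oriented o x
  simp only [inner_cross_eq o _ _ _ he, det3]
  ring

theorem inner_cross_swap : (inner ℝ (cross o x a b) c : ℝ) = - inner ℝ (cross o x b a) c := by
  obtain ⟨e, he⟩ := exists_oriented o x
  simp only [inner_cross_eq o _ _ _ he, det3]
  ring

/-- Lagrange's identity. -/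
theorem inner_cross_cross : (inner ℝ (cross o x a b) (cross o x c d) : ℝ) =
    inner ℝ a c * inner ℝ b d - inner ℝ a d * inner ℝ b c := by
  obtain ⟨e, he⟩ := exists_oriented o x
  have h : ∀ i, (inner ℝ (e i) (cross o x c d) : ℝ) =
      det3 (fun i => inner ℝ (e i) c) (fun i => inner ℝ (e i) d)
        (fun j => if j = i then 1 else 0) := fun i => by
    rw [real_inner_comm, inner_cross_eq o _ _ _ he]
    simp only [orthonormal_iff_ite.1 e.orthonormal]
  have hi : ∀ a b : TangentSpace (𝓡 3) x, (inner ℝ a b : ℝ) =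
      ∑ i, inner ℝ (e i) a * inner ℝ (e i) b := fun a b => by
    rw [← e.sum_inner_mul_inner a b]
    exact Finset.sum_congr rfl fun i _ => by rw [real_inner_comm]
  rw [inner_cross_eq o _ _ _ he]
  simp only [h, hi a c, hi a d, hi b c, hi b d, Fin.sum_univ_three, det3]
  simp
  ring

theorem cross_cross : cross o x a (cross o x b c) =
    (inner ℝ a c : ℝ) • b - (inner ℝ a b : ℝ) • c := by
  refine ext_inner_right ℝ fun z => ?_
  rw [inner_cross_rotate, inner_cross_rotate, inner_cross_cross, inner_sub_left, inner_smul_left,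
    inner_smul_left, real_inner_comm b z, real_inner_comm c z]
  simp only [RCLike.conj_to_real]
  ring

/-- In an orthonormal basis, the sum over `i < j` of an alternating expression. -/
theorem sum_lt_eq (B : TangentSpace (𝓡 3) x →ₗ[ℝ] TangentSpace (𝓡 3) x →ₗ[ℝ] ℝ)
    (hB : ∀ v w, B v w = - B w v) (e : OrthonormalBasis (Fin 3) ℝ (TangentSpace (𝓡 3) x))
    (w : Fin 3 → TangentSpace (𝓡 3) x) :
    ∑ i, ∑ j ∈ Finset.Ioi i, ((inner ℝ (w i) (e j) : ℝ) - inner ℝ (w j) (e i)) * B (e i) (e j) =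
      ∑ i, B (e i) (w i) := by
  have h : ∀ i, B (e i) (w i) = ∑ j, (inner ℝ (w i) (e j) : ℝ) * B (e i) (e j) := by
    intro i
    conv_lhs => rw [← e.sum_repr' (w i)]
    simp only [map_sum, map_smul, smul_eq_mul, real_inner_comm]
  have h0 : ∀ v, B v v = 0 := fun v => by linarith [hB v v]
  have e0 : Finset.Ioi (0 : Fin 3) = {1, 2} := by decide
  have e1 : Finset.Ioi (1 : Fin 3) = {2} := by decide
  have e2 : Finset.Ioi (2 : Fin 3) = ∅ := by decide
  simp only [h, Fin.sum_univ_three, h0, e0, e1, e2, Finset.sum_singleton, Finset.sum_empty]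
  rw [Finset.sum_pair (by decide), hB (e 1) (e 0), hB (e 2) (e 0), hB (e 2) (e 1)]
  ring

end

/-! ### Positively oriented orthonormal frames -/

/-- A smooth orthonormal frame which is positively oriented near `x`. -/
structure IsOrientedFrameAt (o : ManifoldOrientation M) (E : Fin 3 → VecField 3 M) (x : M) : Prop
    extends IsFrameAt E x where
  oriented : ∀ᶠ y in 𝓝 x, ∀ h : Orthonormal ℝ (fun i => E i y),
    (basisOfOrthonormal h).toBasis.orientation = o.orient y

variable [IsContMDiffRiemannianBundle (𝓡 3) ∞ (EuclideanSpace ℝ (Fin 3))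
    (fun x : M => TangentSpace (𝓡 3) x)]

/-- The Gram-Schmidt process preserves the orientation of a frame. -/
theorem exists_isOrientedFrameAt (o : ManifoldOrientation M) (x : M) :
    ∃ E : Fin 3 → VecField 3 M, IsOrientedFrameAt o E x := by
  obtain ⟨U, hU, s, hs, hso⟩ := o.exists_frame x
  refine ⟨_, isFrameAt_gramSchmidtNormed hU hs, ?_⟩
  filter_upwards [hU] with y hy h
  rw [← hso y hy]
  have hli := hs.linearIndependent hy
  have hcard : finrank ℝ (TangentSpace (𝓡 3) y) = Fintype.card (Fin 3) := by
    rw [(finrankTangent y).out, Fintype.card_fin]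
  have hb : basisOfOrthonormal h =
      InnerProductSpace.gramSchmidtOrthonormalBasis hcard (fun j => s j y) := by
    refine DFunLike.coe_injective (funext fun i => ?_)
    rw [basisOfOrthonormal_apply, InnerProductSpace.gramSchmidtOrthonormalBasis_apply]
    exact h.ne_zero i
  rw [Basis.orientation_eq_iff_det_pos, hb]
  have hc : (⇑(hs.toBasisAt hy) : Fin 3 → TangentSpace (𝓡 3) y) = fun j => s j y := by
    funext j
    exact hs.toBasisAt_coe hy j
  rw [hc, InnerProductSpace.gramSchmidtOrthonormalBasis_det]
  refine Finset.prod_pos fun i _ => ?_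
  rw [← hb, basisOfOrthonormal_apply]
  have hg := InnerProductSpace.gramSchmidt_ne_zero i hli
  have hn : ‖InnerProductSpace.gramSchmidt ℝ (fun j => s j y) i‖ ≠ 0 := norm_ne_zero_iff.2 hg
  have h1 : (inner ℝ (InnerProductSpace.gramSchmidt ℝ (fun j => s j y) i) (s i y) : ℝ) =
      ‖InnerProductSpace.gramSchmidt ℝ (fun j => s j y) i‖ ^ 2 := by
    have := InnerProductSpace.gramSchmidt_def'' ℝ (fun j => s j y) i
    rw [this, inner_add_right, inner_sum, real_inner_self_eq_norm_sq, Finset.sum_eq_zero,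
      add_zero]
    intro j hj
    rw [inner_smul_right, InnerProductSpace.gramSchmidt_orthogonal ℝ _ (Finset.mem_Iio.1 hj).ne',
      mul_zero]
  rw [InnerProductSpace.gramSchmidtNormed, inner_smul_left, h1]
  simp only [RCLike.conj_to_real]
  have : 0 < ‖InnerProductSpace.gramSchmidt ℝ (fun j => s j y) i‖ := by positivity
  change 0 < ‖InnerProductSpace.gramSchmidt ℝ (fun j => s j y) i‖⁻¹ * _
  positivity

theorem IsOrientedFrameAt.inner_cross {o : ManifoldOrientation M} {E : Fin 3 → VecField 3 M}
    {x : M} (hE : IsOrientedFrameAt o E x) (A B C : VecField 3 M) : ∀ᶠ y in 𝓝 x,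
      (inner ℝ (cross o y (A y) (B y)) (C y) : ℝ) = det3 (fun i => inner ℝ (E i y) (A y))
        (fun i => inner ℝ (E i y) (B y)) (fun i => inner ℝ (E i y) (C y)) := by
  filter_upwards [hE.orthonormal, hE.oriented] with y h1 h2
  rw [inner_cross_eq o _ _ _ (h2 h1)]
  simp only [basisOfOrthonormal_apply]

theorem funSmoothAt_det3 {f g h : Fin 3 → M → ℝ} {x : M}
    (hf : ∀ i, FunSmoothAt (n := 3) (f i) x) (hg : ∀ i, FunSmoothAt (n := 3) (g i) x)
    (hh : ∀ i, FunSmoothAt (n := 3) (h i) x) :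
    FunSmoothAt (n := 3) (fun y => det3 (f · y) (g · y) (h · y)) x := by
  unfold det3
  exact (((hf 0).mul (((hg 1).mul (hh 2)).sub ((hg 2).mul (hh 1)))).sub
    ((hf 1).mul (((hg 0).mul (hh 2)).sub ((hg 2).mul (hh 0))))).add
    ((hf 2).mul (((hg 0).mul (hh 1)).sub ((hg 1).mul (hh 0))))

theorem mvfderiv_det3 {f g h : Fin 3 → M → ℝ} {x : M}
    (hf : ∀ i, MDifferentiableAt (𝓡 3) 𝓘(ℝ) (f i) x)
    (hg : ∀ i, MDifferentiableAt (𝓡 3) 𝓘(ℝ) (g i) x)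
    (hh : ∀ i, MDifferentiableAt (𝓡 3) 𝓘(ℝ) (h i) x) (v : TangentSpace (𝓡 3) x) :
    mvfderiv (𝓡 3) (fun y => det3 (f · y) (g · y) (h · y)) x v =
      det3 (fun i => mvfderiv (𝓡 3) (f i) x v) (g · x) (h · x) +
      det3 (f · x) (fun i => mvfderiv (𝓡 3) (g i) x v) (h · x) +
      det3 (f · x) (g · x) (fun i => mvfderiv (𝓡 3) (h i) x v) := by
  have hgh : ∀ j k, MDifferentiableAt (𝓡 3) 𝓘(ℝ) (fun y => g j y * h k y) x := fun j k =>
    (hg j).mul (hh k)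
  have hs : ∀ j k, MDifferentiableAt (𝓡 3) 𝓘(ℝ) (fun y => g j y * h k y - g k y * h j y) x :=
    fun j k => (hgh j k).sub (hgh k j)
  have hd : ∀ i j k, MDifferentiableAt (𝓡 3) 𝓘(ℝ)
      (fun y => f i y * (g j y * h k y - g k y * h j y)) x := fun i j k => (hf i).mul (hs j k)
  have hd2 : ∀ i j k i' j' k', MDifferentiableAt (𝓡 3) 𝓘(ℝ)
      (fun y => f i y * (g j y * h k y - g k y * h j y) -
        f i' y * (g j' y * h k' y - g k' y * h j' y)) x := fun i j k i' j' k' =>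
    (hd i j k).sub (hd i' j' k')
  have hm : ∀ i j k, mvfderiv (𝓡 3) (fun y => f i y * (g j y * h k y - g k y * h j y)) x v =
      f i x * ((g j x * mvfderiv (𝓡 3) (h k) x v + h k x * mvfderiv (𝓡 3) (g j) x v) -
        (g k x * mvfderiv (𝓡 3) (h j) x v + h j x * mvfderiv (𝓡 3) (g k) x v)) +
      (g j x * h k x - g k x * h j x) * mvfderiv (𝓡 3) (f i) x v := by
    intro i j k
    rw [mvfderiv_fun_mul (hf i) (hs j k), mvfderiv_fun_sub (hgh j k) (hgh k j),
      mvfderiv_fun_mul (hg j) (hh k), mvfderiv_fun_mul (hg k) (hh j)]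
    simp
  have e : mvfderiv (𝓡 3) (fun y => det3 (f · y) (g · y) (h · y)) x v =
      mvfderiv (𝓡 3) (fun y => f 0 y * (g 1 y * h 2 y - g 2 y * h 1 y) -
        f 1 y * (g 0 y * h 2 y - g 2 y * h 0 y) + f 2 y * (g 0 y * h 1 y - g 1 y * h 0 y)) x v :=
    rfl
  rw [e, mvfderiv_fun_add (hd2 0 1 2 1 0 2) (hd 2 0 1), mvfderiv_fun_sub (hd 0 1 2) (hd 1 0 2)]
  simp only [add_apply, sub_apply, hm, det3]
  ring

theorem smoothAt_cross (o : ManifoldOrientation M) {A B : VecField 3 M} {x : M}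
    (hA : SmoothAt A x) (hB : SmoothAt B x) : SmoothAt (fun y => cross o y (A y) (B y)) x := by
  obtain ⟨E, hE⟩ := exists_isOrientedFrameAt o x
  refine hE.smoothAt fun i => ContMDiffAt.congr_of_eventuallyEq
    (funSmoothAt_det3 (fun j => (hE.smooth j).inner hA) (fun j => (hE.smooth j).inner hB)
      (fun j => (hE.smooth j).inner (hE.smooth i))) ?_
  filter_upwards [hE.inner_cross A B (E i)] with y hy
  rw [real_inner_comm, hy]

/-- The volume form, hence the cross product, is parallel. -/
theorem leviCivita_cross (o : ManifoldOrientation M) {A B : VecField 3 M} {x : M}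
    (hA : SmoothAt A x) (hB : SmoothAt B x) (v : TangentSpace (𝓡 3) x) :
    leviCivita (fun y => cross o y (A y) (B y)) x v =
      cross o x (leviCivita A x v) (B x) + cross o x (A x) (leviCivita B x v) := by
  obtain ⟨E, hE⟩ := exists_isOrientedFrameAt o x
  refine ext_inner_right ℝ fun c => ?_
  have hC := smoothAt_ext c
  have h1 := mvfderiv_inner (smoothAt_cross o hA hB).diffAt hC.diffAt v
  have hi : ∀ {X : VecField 3 M} (_ : SmoothAt X x) (i : Fin 3),
      MDifferentiableAt (𝓡 3) 𝓘(ℝ) (fun y => (inner ℝ (E i y) (X y) : ℝ)) x :=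
    fun hX i => ((hE.smooth i).inner hX).diff
  have hx := hE.orthonormal.self_of_nhds
  have hp := hE.oriented.self_of_nhds hx
  have hd : ∀ {X : VecField 3 M} (_ : SmoothAt X x) (i : Fin 3),
      mvfderiv (𝓡 3) (fun y => (inner ℝ (E i y) (X y) : ℝ)) x v =
        ∑ j, inner ℝ (leviCivita (E i) x v) (E j x) * inner ℝ (E j x) (X x) +
        inner ℝ (E i x) (leviCivita X x v) := fun {X} hX i => by
    rw [mvfderiv_inner (hE.smooth i).diffAt hX.diffAt]
    congr 1
    have := (basisOfOrthonormal hx).sum_inner_mul_inner (leviCivita (E i) x v) (X x)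
    simpa only [basisOfOrthonormal_apply] using this.symm
  rw [mvfderiv_congr (hE.inner_cross A B (ext c)), mvfderiv_det3 (hi hA) (hi hB) (hi hC)] at h1
  simp only [hd hA, hd hB, hd hC] at h1
  rw [inner_add_left]
  simp only [inner_cross_eq o _ _ _ hp, basisOfOrthonormal_apply, ext_self] at h1 ⊢
  have sk : ∀ i j, (inner ℝ (leviCivita (E i) x v) (E j x) : ℝ) =
      - inner ℝ (leviCivita (E j) x v) (E i x) := fun i j => by
    rw [hE.inner_leviCivita_skew, real_inner_comm]
  have s0 : ∀ i, (inner ℝ (leviCivita (E i) x v) (E i x) : ℝ) = 0 := fun i => by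
    linarith [sk i i]
  simp only [Fin.sum_univ_three, det3, s0, sk 1 0, sk 2 0, sk 2 1] at h1 ⊢
  linear_combination -h1

/-! ### The curl -/

/-- The curl `∑ᵢ eᵢ × ∇_{eᵢ} A` of a vector field. -/
def curl (o : ManifoldOrientation M) (A : VecField 3 M) : VecField 3 M := fun x =>
  ∑ i, cross o x (frame x i) (leviCivita A x (frame x i))

/-- The bilinear map `(v, w) ↦ v × Tw`. -/
def crossBilin (o : ManifoldOrientation M) {x : M}
    (T : TangentSpace (𝓡 3) x →ₗ[ℝ] TangentSpace (𝓡 3) x) :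
    TangentSpace (𝓡 3) x →ₗ[ℝ] TangentSpace (𝓡 3) x →ₗ[ℝ] TangentSpace (𝓡 3) x :=
  LinearMap.mk₂ ℝ (fun v w => cross o x v (T w)) (by simp) (by simp) (by simp) (by simp)

theorem crossBilin_apply (o : ManifoldOrientation M) {x : M}
    (T : TangentSpace (𝓡 3) x →ₗ[ℝ] TangentSpace (𝓡 3) x) (v w : TangentSpace (𝓡 3) x) :
    crossBilin o T v w = cross o x v (T w) := rfl

theorem IsFrameAt.curl_eq (o : ManifoldOrientation M) {E : Fin 3 → VecField 3 M} {x : M}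
    (hE : IsFrameAt E x) (A : VecField 3 M) : ∀ᶠ y in 𝓝 x,
      curl o A y = ∑ i, cross o y (E i y) (leviCivita A y (E i y)) := by
  filter_upwards [hE.orthonormal] with y hy
  have := sum_bilin_eq (crossBilin o (leviCivita A y).toLinearMap) (frame y)
    (basisOfOrthonormal hy)
  rw [coe_basisOfOrthonormal] at this
  exact this

theorem smoothAt_curl (o : ManifoldOrientation M) {A : VecField 3 M} {x : M}
    (hA : SmoothAt A x) : SmoothAt (curl o A) x := by
  obtain ⟨E, hE⟩ := exists_isFrameAt (n := 3) x
  exact SmoothAt.congr (SmoothAt.sum fun i _ => smoothAt_cross o (hE.smooth i)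
    (smoothAt_leviCivita hA (hE.smooth i))) (hE.curl_eq o A)

theorem leviCivita_curl (o : ManifoldOrientation M) {A : VecField 3 M} {x : M}
    (hA : SmoothAt A x) (v : TangentSpace (𝓡 3) x) : leviCivita (curl o A) x v =
      ∑ i, cross o x (frame x i) (secondCov A x v (frame x i)) := by
  obtain ⟨E, hE⟩ := exists_isFrameAt (n := 3) x
  have hs := fun i => smoothAt_leviCivita hA (hE.smooth i)
  have hc := fun i => smoothAt_cross o (hE.smooth i) (hs i)
  have hx := hE.orthonormal.self_of_nhds
  have h1 := leviCivita_congr (SmoothAt.sum fun i (_ : i ∈ Finset.univ) => hc i).diffAt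
    (hE.curl_eq o A)
  have h2 : ∑ i, cross o x (frame x i) (secondCov A x v (frame x i)) =
      ∑ i, cross o x (E i x) (secondCov A x v (E i x)) := by
    have := sum_bilin_eq (crossBilin o (secondCovBilin hA v)) (frame x) (basisOfOrthonormal hx)
    rw [coe_basisOfOrthonormal] at this
    exact this
  have h3 := sum_bilin_skew (crossBilin o (leviCivita A x).toLinearMap) (basisOfOrthonormal hx)
    (fun i => leviCivita (E i) x v) (by
      simpa only [coe_basisOfOrthonormal] using hE.inner_leviCivita_skew v)
  rw [h1, h2, leviCivita_sum fun i _ => (hc i).diffAt, sum_apply, ← sub_eq_zero, ← h3,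
    ← Finset.sum_sub_distrib]
  refine Finset.sum_congr rfl fun i _ => ?_
  rw [leviCivita_cross o (hE.smooth i) (hs i), secondCov_eq hA (hE.smooth i).diffAt, map_sub]
  simp only [coe_basisOfOrthonormal, crossBilin_apply, ContinuousLinearMap.coe_coe]
  abel

theorem inner_curl (o : ManifoldOrientation M) (A : VecField 3 M) (x : M)
    (z : TangentSpace (𝓡 3) x) : (inner ℝ (curl o A x) z : ℝ) =
      ∑ i, inner ℝ (cross o x (frame x i) (leviCivita A x (frame x i))) z := by
  rw [curl, sum_inner]

theorem vorticity_eq (o : ManifoldOrientation M) {A : VecField 3 M} {x : M} (hA : DiffAt A x) :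
    vorticity o A x = flat (curl o A) x := by
  refine ContinuousLinearMap.ext fun z => ?_
  refine linearOfFrame_eq (innerSL ℝ (curl o A x)).toLinearMap (fun z => ?_) z
  change _ = inner ℝ (curl o A x) z
  rw [inner_curl]
  have := sum_lt_eq ((innerBilin (cross o x z)))
    (fun v w => by
      rw [innerBilin_apply, innerBilin_apply, inner_cross_rotate, inner_cross_swap,
        ← inner_cross_rotate, ← inner_cross_rotate]) (frame x)
    (fun i => leviCivita A x (frame x i))
  simp only [innerBilin_apply, inner_cross_rotate o z] at this
  rw [← this]
  simp only [extDerivOne_flat hA, inner_cross]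

theorem divergence_cross (o : ManifoldOrientation M) {A B : VecField 3 M} {x : M}
    (hA : SmoothAt A x) (hB : SmoothAt B x) :
    divergence (fun y => cross o y (A y) (B y)) x =
      inner ℝ (curl o A x) (B x) - inner ℝ (A x) (curl o B x) := by
  rw [real_inner_comm (curl o B x), inner_curl, inner_curl, divergence, ← Finset.sum_sub_distrib]
  refine Finset.sum_congr rfl fun i _ => ?_
  rw [leviCivita_cross o hA hB, inner_add_left, inner_cross_rotate o _ (B x),
    inner_cross_rotate o (B x), inner_cross_rotate o (A x),
    inner_cross_swap o (leviCivita B x (frame x i))]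
  ring

theorem curl_grad (o : ManifoldOrientation M) {f : M → ℝ} {x : M}
    (hf : FunSmoothAt (n := 3) f x) : curl o (grad (n := 3) f) x = 0 := by
  refine ext_inner_right ℝ fun z => ?_
  rw [inner_curl, inner_zero_left]
  have := sum_lt_eq ((innerBilin (cross o x z)))
    (fun v w => by
      rw [innerBilin_apply, innerBilin_apply, inner_cross_rotate, inner_cross_swap,
        ← inner_cross_rotate, ← inner_cross_rotate]) (frame x)
    (fun i => leviCivita (grad (n := 3) f) x (frame x i))
  simp only [innerBilin_apply, inner_cross_rotate o z] at this
  rw [← this]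
  refine Finset.sum_eq_zero fun i _ => Finset.sum_eq_zero fun j _ => ?_
  rw [inner_leviCivita_grad_comm hf, sub_self, zero_mul]

/-- For a divergence-free vector field, `□ = curl curl`. -/
theorem curl_curl (o : ManifoldOrientation M) {A : VecField 3 M} (hA : ∀ x, SmoothAt A x)
    (hdiv : ∀ x, divergence A x = 0) (x : M) : curl o (curl o A) x = hodgeLaplacian A x := by
  refine ext_inner_right ℝ fun z => ?_
  rw [inner_hodgeLaplacian hA hdiv, curl]
  simp only [leviCivita_curl o (hA x), map_sum, cross_cross, sum_inner, inner_sub_left,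
    inner_smul_left, RCLike.conj_to_real, Finset.sum_sub_distrib]
  congr 1
  · refine Finset.sum_congr rfl fun i _ => ?_
    conv_rhs => rw [← secondCovBilin_apply (hA x), ← (frame x).sum_repr' z]
    simp only [map_sum, map_smul, sum_inner, inner_smul_left, RCLike.conj_to_real,
      secondCovBilin_apply]
    refine Finset.sum_congr rfl fun j _ => ?_
    rw [mul_comm, real_inner_comm (frame x i)]
  · refine Finset.sum_congr rfl fun i _ => ?_
    simp only [orthonormal_iff_ite.1 (frame x).orthonormal]
    simp

/-- `⟨∇_a A, b⟩ - ⟨∇_b A, a⟩ = ⟨curl A, a × b⟩`. -/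
theorem inner_curl_cross (o : ManifoldOrientation M) (A : VecField 3 M) (x : M)
    (a b : TangentSpace (𝓡 3) x) : (inner ℝ (curl o A x) (cross o x a b) : ℝ) =
      inner ℝ (leviCivita A x a) b - inner ℝ (leviCivita A x b) a := by
  rw [inner_curl]
  simp only [inner_cross_cross, Finset.sum_sub_distrib]
  have h : ∀ a b : TangentSpace (𝓡 3) x, ∑ i, (inner ℝ (frame x i) a : ℝ) *
      inner ℝ (leviCivita A x (frame x i)) b = inner ℝ (leviCivita A x a) b := fun a b => by
    conv_rhs => rw [← (frame x).sum_repr' a]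
    simp only [map_sum, map_smul, sum_inner, inner_smul_left, RCLike.conj_to_real]
  rw [h, h]

theorem starOne_flat (o : ManifoldOrientation M) (A : VecField 3 M) (x : M)
    (v w : TangentSpace (𝓡 3) x) :
    starOne o (flat A) x v w = inner ℝ (cross o x (A x) v) w := by
  refine bilinearOfFrame_eq (innerBilin (cross o x (A x))) (fun v w => ?_) v w
  rw [innerBilin_apply, inner_cross, sharp_flat]

theorem innerTwo_extDerivOne_starOne (o : ManifoldOrientation M) {A : VecField 3 M} {x : M}
    (hA : DiffAt A x) : innerTwo (extDerivOne (flat A)) (starOne o (flat A)) x =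
      inner ℝ (curl o A x) (A x) := by
  rw [inner_curl]
  have := sum_lt_eq ((innerBilin (cross o x (A x))))
    (fun v w => by
      rw [innerBilin_apply, innerBilin_apply, inner_cross_rotate, inner_cross_swap,
        ← inner_cross_rotate, ← inner_cross_rotate]) (frame x)
    (fun i => leviCivita A x (frame x i))
  simp only [innerBilin_apply] at this
  simp only [← inner_cross_rotate o (A x)]
  rw [← this]
  simp only [innerTwo, extDerivOne_flat hA, starOne_flat]

theorem covPairing_flat {A B : VecField 3 M} {x : M} (hA : DiffAt A x) :
    covPairing (flat A) B x =
      ∑ i, inner ℝ (leviCivita A x (frame x i)) (leviCivita B x (frame x i)) := by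
  simp only [covPairing, covOneForm_flat hA]

end Cross

section Drift

variable {M : Type*} [TopologicalSpace M] [ChartedSpace (EuclideanSpace ℝ (Fin 3)) M]
  [IsManifold (𝓡 3) ∞ M] [RiemannianBundle (fun x : M => TangentSpace (𝓡 3) x)]
  [IsContMDiffRiemannianBundle (𝓡 3) ∞ (EuclideanSpace ℝ (Fin 3))
    (fun x : M => TangentSpace (𝓡 3) x)]

/-! ### The intrinsic Ricci tensor of a metric connection with torsion -/

theorem driftConnection_apply (v Y : VecField 3 M) (x : M) (w : TangentSpace (𝓡 3) x) :
    driftConnection v Y x w = leviCivita Y x w - (inner ℝ (Y x) (v x) : ℝ) • w +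
      (inner ℝ w (Y x) : ℝ) • v x := by
  have h : driftConnection v Y x w = leviCivita Y x w +
    (-(2 / (((3 : ℕ) : ℝ) - 1))) • driftTensor (v x) (Y x) w := rfl
  rw [h, driftTensor_apply]
  norm_num
  abel

theorem torsion_driftConnection (v : VecField 3 M) (x : M) (a b : TangentSpace (𝓡 3) x) :
    (driftConnection v).torsion x a b = (inner ℝ a (v x) : ℝ) • b - (inner ℝ b (v x) : ℝ) • a := by
  rw [CovariantDerivative.torsion_apply_eq_extend]
  change driftConnection v (ext b) x (ext a x) - driftConnection v (ext a) x (ext b x) -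
    VectorField.mlieBracket (𝓡 3) (ext a) (ext b) x = _
  rw [driftConnection_apply, driftConnection_apply,
    ← leviCivita_sub_leviCivita (diffAt_ext a) (diffAt_ext b), ext_self, ext_self,
    real_inner_comm b a]
  abel

theorem driftConnection_driftConnection {v Y Z : VecField 3 M} {x : M} (hv : SmoothAt v x)
    (hY : SmoothAt Y x) (hZ : SmoothAt Z x) (a : TangentSpace (𝓡 3) x) :
    driftConnection v (fun y => driftConnection v Z y (Y y)) x a =
      leviCivita (fun y => leviCivita Z y (Y y)) x a -
      ((inner ℝ (Z x) (v x) : ℝ) • leviCivita Y x a +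
        (inner ℝ (leviCivita Z x a) (v x) + inner ℝ (Z x) (leviCivita v x a) : ℝ) • Y x) +
      ((inner ℝ (Y x) (Z x) : ℝ) • leviCivita v x a +
        (inner ℝ (leviCivita Y x a) (Z x) + inner ℝ (Y x) (leviCivita Z x a) : ℝ) • v x) -
      (inner ℝ (leviCivita Z x (Y x) - (inner ℝ (Z x) (v x) : ℝ) • Y x +
        (inner ℝ (Y x) (Z x) : ℝ) • v x) (v x) : ℝ) • a +
      (inner ℝ a (leviCivita Z x (Y x) - (inner ℝ (Z x) (v x) : ℝ) • Y x +
        (inner ℝ (Y x) (Z x) : ℝ) • v x) : ℝ) • v x := by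
  have h1 := smoothAt_leviCivita hZ hY
  have h2 := hY.smul (hZ.inner hv)
  have h3 := hv.smul (hY.inner hZ)
  rw [driftConnection_apply]
  simp only [driftConnection_apply]
  rw [leviCivita_add (h1.sub h2).diffAt h3.diffAt, leviCivita_sub h1.diffAt h2.diffAt, add_apply,
    sub_apply, leviCivita_smul (hZ.inner hv).diff hY.diffAt,
    leviCivita_smul (hY.inner hZ).diff hv.diffAt, mvfderiv_inner hZ.diffAt hv.diffAt,
    mvfderiv_inner hY.diffAt hZ.diffAt]

/-- The terms of the trace defining the Ricci tensor of `∇^v`. -/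
theorem inner_curvature_driftConnection {v : VecField 3 M} {x : M} (hv : SmoothAt v x)
    (a e z : TangentSpace (𝓡 3) x) (he : (inner ℝ e e : ℝ) = 1) :
    (inner ℝ (curvature (driftConnection v) (ext a) (ext e) (ext e) x) z : ℝ) =
      inner ℝ (riemann x a e e) z -
      (inner ℝ e (leviCivita v x a) * inner ℝ e z - inner ℝ (leviCivita v x a) z) +
      (inner ℝ (leviCivita v x e) e * inner ℝ a z - inner ℝ e a * inner ℝ (leviCivita v x e) z) +
      ((inner ℝ e (v x) * inner ℝ e (v x) - inner ℝ (v x) (v x)) * inner ℝ a z -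
        (inner ℝ e (v x) * inner ℝ e a - inner ℝ a (v x)) * inner ℝ (v x) z) -
      (inner ℝ e (v x) * inner ℝ a (v x) - inner ℝ e a * inner ℝ (v x) (v x)) *
        inner ℝ e z := by
  have ha := smoothAt_ext a
  have hE := smoothAt_ext e
  rw [riemann, curvature, curvature, driftConnection_driftConnection hv hE hE,
    driftConnection_driftConnection hv ha hE, driftConnection_apply,
    ← leviCivita_sub_leviCivita ha.diffAt hE.diffAt]
  simp only [ext_self, inner_add_left, inner_sub_left, inner_smul_left, inner_add_right,
    inner_sub_right, inner_smul_right, RCLike.conj_to_real]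
  have sym : ∀ p q : TangentSpace (𝓡 3) x, (inner ℝ p q : ℝ) = inner ℝ q p := fun p q =>
    real_inner_comm q p
  rw [sym a e] at *
  simp only [real_inner_comm] at he ⊢
  rw [he]
  ring

/-- The terms of the trace defining the divergence of the torsion of `∇^v`. -/
theorem inner_covTorsion_driftConnection {v : VecField 3 M} {x : M} (hv : SmoothAt v x)
    (a e z : TangentSpace (𝓡 3) x) (he : (inner ℝ e e : ℝ) = 1) :
    (inner ℝ (covTorsion (driftConnection v) x e a e) z : ℝ) =
      -((inner ℝ (leviCivita v x e) e - inner ℝ (v x) (v x) +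
          inner ℝ e (v x) * inner ℝ e (v x)) * inner ℝ a z -
        (inner ℝ (leviCivita v x e) a - inner ℝ (v x) (v x) * inner ℝ e a +
          inner ℝ e (v x) * inner ℝ a (v x)) * inner ℝ e z) := by
  have ha := smoothAt_ext a
  have hE := smoothAt_ext e
  have h1 := hE.smul (ha.inner hv)
  have h2 := ha.smul (hE.inner hv)
  rw [covTorsion]
  simp only [torsion_driftConnection]
  rw [driftConnection_apply, driftConnection_apply, driftConnection_apply,
    leviCivita_sub h1.diffAt h2.diffAt, sub_apply, leviCivita_smul (ha.inner hv).diff hE.diffAt,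
    leviCivita_smul (hE.inner hv).diff ha.diffAt, mvfderiv_inner ha.diffAt hv.diffAt,
    mvfderiv_inner hE.diffAt hv.diffAt]
  simp only [ext_self, inner_add_left, inner_sub_left, inner_smul_left,
    inner_sub_right, inner_smul_right, RCLike.conj_to_real]
  simp only [real_inner_comm] at he ⊢
  rw [he]
  ring

/-- In dimension three the intrinsic Ricci tensor of `∇^v` is
`Ric(a) + ∇_a v + (∇v)^T a + 2⟨a, v⟩v`. -/
theorem inner_intrinsicRicci_driftConnection {v : VecField 3 M} {x : M} (hv : SmoothAt v x)
    (a z : TangentSpace (𝓡 3) x) :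
    (inner ℝ (intrinsicRicci (driftConnection v) x a) z : ℝ) = inner ℝ (ricci leviCivita x a) z +
      inner ℝ (leviCivita v x a) z + inner ℝ (leviCivita v x z) a +
      2 * (inner ℝ a (v x) * inner ℝ (v x) z) := by
  have hone : ∀ i, (inner ℝ (frame (n := 3) x i) (frame (n := 3) x i) : ℝ) = 1 := fun i => by
    rw [real_inner_self_eq_norm_sq, (frame x).norm_eq_one]
    norm_num
  have P : ∀ p q : TangentSpace (𝓡 3) x, ∑ i, (inner ℝ (frame x i) p : ℝ) *
      inner ℝ (frame x i) q = inner ℝ p q := fun p q => by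
    rw [← (frame x).sum_inner_mul_inner p q]
    exact Finset.sum_congr rfl fun i _ => by rw [real_inner_comm]
  have Q : ∀ p q : TangentSpace (𝓡 3) x, ∑ i, (inner ℝ (frame x i) p : ℝ) *
      inner ℝ (leviCivita v x (frame x i)) q = inner ℝ (leviCivita v x p) q := fun p q => by
    conv_rhs => rw [← (frame x).sum_repr' p]
    simp only [map_sum, map_smul, sum_inner, inner_smul_left, RCLike.conj_to_real]
  rw [intrinsicRicci, inner_add_left, ricci, sum_inner, sum_inner, ricci_eq, sum_inner]
  simp only [inner_curvature_driftConnection hv a _ z (hone _),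
    inner_covTorsion_driftConnection hv a _ z (hone _)]
  have p1 := P (leviCivita v x a) z
  have p2 := P (v x) (v x)
  have p3 := P (v x) a
  have p4 := P (v x) z
  have p5 := P a z
  have q1 := Q a z
  have q2 := Q z a
  rw [real_inner_comm a (v x)] at p3
  simp only [Fin.sum_univ_three] at *
  linear_combination -p1 - q1 + (inner ℝ a z) * p2 - (inner ℝ (v x) z) * p3
    - (inner ℝ a (v x)) * p4 + (inner ℝ (v x) (v x)) * p5 - (inner ℝ a z) * p2 + q2
    - (inner ℝ (v x) (v x)) * p5 + (inner ℝ a (v x)) * p4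

theorem inner_velocityRicci {ν : ℝ} {u : VecField 3 M} {x : M} (hν : ν ≠ 0) (hu : SmoothAt u x)
    (z : TangentSpace (𝓡 3) x) :
    (inner ℝ (velocityRicci ν u x (u x)) z : ℝ) = inner ℝ (ricci leviCivita x (u x)) z -
      1 / (2 * ν) * (inner ℝ (leviCivita u x (u x)) z + inner ℝ (leviCivita u x z) (u x)) +
      1 / (2 * ν ^ 2) * (‖u x‖ ^ 2 * inner ℝ (u x) z) := by
  have hv : SmoothAt ((-(1 / (2 * ν))) • u) x := hu.const_smul _
  rw [velocityRicci, inner_intrinsicRicci_driftConnection hv]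
  have h := leviCivita_const_smul (-(1 / (2 * ν))) hu.diffAt
  change leviCivita ((-(1 / (2 * ν))) • u) x = _ at h
  rw [h, ← real_inner_self_eq_norm_sq]
  simp only [Pi.smul_apply, smul_apply, inner_smul_left, inner_smul_right, RCLike.conj_to_real]
  field_simp
  ring

end Drift

/-! ### Complete Riemannian manifolds -/

section HopfRinow

/-- A Riemannian manifold is a length space: between two points at distance less than `r + s` there
is a point at distance at most `r` from the first and less than `s` from the second. -/
theorem exists_dist_le_dist_lt (n : ℕ) {M : Type*} [MetricSpace M]
    [ChartedSpace (EuclideanSpace ℝ (Fin n)) M]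
    [RiemannianBundle (fun x : M => TangentSpace (𝓡 n) x)] [IsRiemannianManifold (𝓡 n) M]
    {x y : M} {r s : ℝ} (hr : 0 ≤ r) (hs : 0 < s)
    (h : dist x y < r + s) : ∃ z, dist x z ≤ r ∧ dist z y < s := by
  rcases le_or_gt (dist x y) r with hxy | hxy
  · exact ⟨y, hxy, by simpa using hs⟩
  have h' : riemannianEDist (𝓡 n) x y < ENNReal.ofReal (r + s) := by
    rw [← IsRiemannianManifold.out x y, edist_dist]
    exact (ENNReal.ofReal_lt_ofReal_iff (by linarith)).2 h
  obtain ⟨γ, h0, h1, hγ, hl⟩ := exists_lt_of_riemannianEDist_lt h'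
  have hc : ContinuousOn (fun τ => dist x (γ τ)) (Icc 0 1) :=
    (continuous_const.dist continuous_id).comp_continuousOn hγ.continuousOn
  obtain ⟨τ, hτ, hτr⟩ := intermediate_value_Icc zero_le_one hc
    (show r ∈ Icc (dist x (γ 0)) (dist x (γ 1)) by rw [h0, h1]; exact ⟨by simpa using hr, hxy.le⟩)
  refine ⟨γ τ, hτr.le, ?_⟩
  have e1 : edist x (γ τ) ≤ pathELength (𝓡 n) γ 0 τ := by
    rw [IsRiemannianManifold.out (I := 𝓡 n) x]
    exact riemannianEDist_le_pathELength (hγ.mono (Icc_subset_Icc_right hτ.2)) h0 rfl hτ.1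
  have e2 : edist (γ τ) y ≤ pathELength (𝓡 n) γ τ 1 := by
    rw [IsRiemannianManifold.out (I := 𝓡 n) _ y]
    exact riemannianEDist_le_pathELength (hγ.mono (Icc_subset_Icc_left hτ.1)) rfl h1 hτ.2
  have e3 := (add_le_add e1 e2).trans_lt ((pathELength_add hτ.1 hτ.2).trans_lt hl)
  rw [edist_dist, edist_dist, ← ENNReal.ofReal_add dist_nonneg dist_nonneg,
    ENNReal.ofReal_lt_ofReal_iff (by linarith)] at e3
  have : dist x (γ τ) = r := hτr
  linarith

/-- The Hopf–Rinow theorem: the closed balls of a complete Riemannian manifold are compact. The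
radii of the compact balls around a point form an open set, because a slightly larger ball lies in
a thickening of the ball, and a closed one, because a ball is totally bounded if it lies in
arbitrarily small thickenings of compact balls. -/
theorem properSpace_of_isRiemannianManifold (n : ℕ) {M : Type*} [MetricSpace M]
    [ChartedSpace (EuclideanSpace ℝ (Fin n)) M]
    [RiemannianBundle (fun x : M => TangentSpace (𝓡 n) x)] [IsRiemannianManifold (𝓡 n) M]
    [CompleteSpace M] : ProperSpace M := by
  have : LocallyCompactSpace M := ChartedSpace.locallyCompactSpace (EuclideanSpace ℝ (Fin n)) M
  refine ⟨fun x => ?_⟩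
  by_contra! hcon
  obtain ⟨r₁, hr₁⟩ := hcon
  let S : Set ℝ := {r | ¬ IsCompact (Metric.closedBall x r)}
  have hmono : ∀ r ∈ S, ∀ s, r ≤ s → s ∈ S := fun r hr s hrs hc =>
    hr (hc.of_isClosed_subset Metric.isClosed_closedBall (Metric.closedBall_subset_closedBall hrs))
  have hbdd : BddBelow S := ⟨0, fun r hr => by
    by_contra! h
    exact hr (by rw [Metric.closedBall_eq_empty.2 h]; exact isCompact_empty)⟩
  have hne : S.Nonempty := ⟨r₁, hr₁⟩
  have hR0 : 0 ≤ sInf S := le_csInf hne fun r hr => by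
    by_contra! h
    exact hr (by rw [Metric.closedBall_eq_empty.2 h]; exact isCompact_empty)
  have hlt : ∀ r < sInf S, IsCompact (Metric.closedBall x r) := fun r hr => by
    by_contra h
    exact absurd (csInf_le hbdd h) (not_le.2 hr)
  set R := sInf S
  have hball : IsCompact (Metric.closedBall x R) := by
    refine TotallyBounded.isCompact_of_isClosed ?_ Metric.isClosed_closedBall
    rw [Metric.totallyBounded_iff]
    intro ε hε
    rcases hR0.eq_or_lt with h0 | h0
    · refine ⟨{x}, finite_singleton x, ?_⟩
      rw [← h0, Metric.closedBall_zero]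
      simpa using hε
    set r := max (R - ε / 4) 0
    have hrR : r < R := max_lt (by linarith) h0
    obtain ⟨t, ht, hcov⟩ := Metric.totallyBounded_iff.1 (hlt r hrR).totallyBounded (ε / 2)
      (by positivity)
    refine ⟨t, ht, fun y hy => ?_⟩
    have hry : R - ε / 4 ≤ r := le_max_left _ _
    obtain ⟨z, hz, hzy⟩ := exists_dist_le_dist_lt n (x := x) (y := y) (r := r) (s := ε / 2)
      (le_max_right _ _) (by positivity) (by
        rw [dist_comm]
        have : dist y x ≤ R := hy
        linarith)
    obtain ⟨w, hw, hzw⟩ := mem_iUnion₂.1 (hcov (show z ∈ Metric.closedBall x r by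
      rw [Metric.mem_closedBall, dist_comm]; exact hz))
    refine mem_iUnion₂.2 ⟨w, hw, ?_⟩
    rw [Metric.mem_ball] at hzw ⊢
    have := dist_triangle_left y w z
    linarith
  obtain ⟨δ, hδ, hδc⟩ := hball.exists_isCompact_cthickening
  have hout : R + δ / 2 ∉ S := fun hS => hS <| hδc.of_isClosed_subset Metric.isClosed_closedBall
    fun y hy => by
      obtain ⟨z, hz, hzy⟩ := exists_dist_le_dist_lt n (x := x) (y := y) (r := R) (s := δ)
        hR0 hδ (by
          rw [dist_comm]
          have : dist y x ≤ R + δ / 2 := hy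
          linarith)
      refine Metric.mem_cthickening_of_dist_le y z δ _ ?_ (by rw [dist_comm]; exact hzy.le)
      rw [Metric.mem_closedBall, dist_comm]
      exact hz
  obtain ⟨r, hr, hrlt⟩ := exists_lt_of_csInf_lt hne (show sInf S < R + δ / 2 by
    change R < _
    linarith)
  exact hout (hmono r hr _ hrlt.le)

/-- A cutoff function: equal to one on the ball of radius `k + 1` around `x`, zero outside the ball
of radius `2 (k + 1)`, and with Lipschitz constant `1 / (k + 1)`. -/
def cutoff {M : Type*} [MetricSpace M] (x : M) (k : ℕ) (y : M) : ℝ :=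
  max 0 (min 1 (2 - dist y x / (k + 1)))

theorem cutoff_mem {M : Type*} [MetricSpace M] (x : M) (k : ℕ) (y : M) :
    cutoff x k y ∈ Icc (0 : ℝ) 1 := ⟨le_max_left _ _, max_le zero_le_one (min_le_left _ _)⟩

theorem lipschitzWith_cutoff {M : Type*} [MetricSpace M] (x : M) (k : ℕ) :
    LipschitzWith (1 / (k + 1)) (cutoff x k) := by
  have h1 : LipschitzWith (1 / (k + 1)) fun y : M => 2 - dist y x / (k + 1) := by
    refine LipschitzWith.of_dist_le_mul fun y z => ?_
    rw [Real.dist_eq]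
    have h := abs_dist_sub_le z y x
    have e : 2 - dist y x / ((k : ℝ) + 1) - (2 - dist z x / (k + 1)) =
      (dist z x - dist y x) / (k + 1) := by ring
    have hk : (0 : ℝ) < k + 1 := by positivity
    rw [e, abs_div, abs_of_pos hk, dist_comm y z]
    push_cast
    rw [div_mul_eq_mul_div, one_mul]
    gcongr
  exact (h1.const_min 1).const_max 0

theorem hasCompactSupport_cutoff {M : Type*} [MetricSpace M] [ProperSpace M] (x : M) (k : ℕ) :
    HasCompactSupport (cutoff x k) := by
  refine HasCompactSupport.of_support_subset_isCompact
    (isCompact_closedBall x (2 * (k + 1))) fun y hy => ?_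
  by_contra h
  refine hy ?_
  rw [Metric.mem_closedBall, not_le] at h
  have : (2 : ℝ) ≤ dist y x / (k + 1) := by
    rw [le_div_iff₀ (by positivity)]
    exact h.le
  exact max_eq_left ((min_le_right _ _).trans (by linarith))

theorem tendsto_cutoff {M : Type*} [MetricSpace M] (x y : M) :
    Tendsto (fun k => cutoff x k y) atTop (𝓝 1) := by
  refine tendsto_const_nhds.congr' ?_
  obtain ⟨N, hN⟩ := exists_nat_ge (dist y x)
  filter_upwards [eventually_ge_atTop N] with k hk
  have hk' : (N : ℝ) ≤ k := by exact_mod_cast hk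
  have : dist y x / ((k : ℝ) + 1) ≤ 1 := by
    rw [div_le_one (by positivity)]
    linarith
  rw [cutoff, min_eq_left (by linarith), max_eq_right zero_le_one]

end HopfRinow

/-! ### Coordinate vector fields and the density of the Riemannian measure -/

section Chart

variable {n : ℕ} {M : Type*} [TopologicalSpace M] [ChartedSpace (EuclideanSpace ℝ (Fin n)) M]
  [IsManifold (𝓡 n) ∞ M]

/-- The differential of the inverse of the chart around `x₀`, as a linear map into the tangent space
at the point `y` of the chart domain. It is given by the trivialization of the tangent bundle. -/
def coordMap (x₀ y : M) : EuclideanSpace ℝ (Fin n) →L[ℝ] TangentSpace (𝓡 n) y :=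
  (trivializationAt (EuclideanSpace ℝ (Fin n)) (TangentSpace (𝓡 n)) x₀).symmL ℝ y

theorem mem_source_iff {x₀ y : M} : y ∈ (extChartAt (𝓡 n) x₀).source ↔
    y ∈ (chartAt (EuclideanSpace ℝ (Fin n)) x₀).source := by
  rw [extChartAt_source]

/-- The differential at `y` of the chart around `x₀`. -/
def chartDeriv (x₀ y : M) : TangentSpace (𝓡 n) y →L[ℝ] EuclideanSpace ℝ (Fin n) :=
  (trivializationAt (EuclideanSpace ℝ (Fin n)) (TangentSpace (𝓡 n)) x₀).continuousLinearMapAt ℝ y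

theorem mfderiv_extChartAt {x₀ y : M} (hy : y ∈ (extChartAt (𝓡 n) x₀).source) :
    mfderiv (𝓡 n) 𝓘(ℝ, EuclideanSpace ℝ (Fin n)) (extChartAt (𝓡 n) x₀) y = chartDeriv x₀ y :=
  (TangentBundle.continuousLinearMapAt_trivializationAt (mem_source_iff.1 hy)).symm

theorem chartDeriv_coordMap {x₀ y : M} (hy : y ∈ (extChartAt (𝓡 n) x₀).source)
    (v : EuclideanSpace ℝ (Fin n)) : chartDeriv x₀ y (coordMap x₀ y v) = v :=
  Trivialization.continuousLinearMapAt_symmL _ (by simpa using hy) v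

theorem coordMap_chartDeriv {x₀ y : M} (hy : y ∈ (extChartAt (𝓡 n) x₀).source)
    (w : TangentSpace (𝓡 n) y) : coordMap x₀ y (chartDeriv x₀ y w) = w :=
  Trivialization.symmL_continuousLinearMapAt _ (by simpa using hy) w

theorem mfderiv_extChartAt_symm {x₀ : M} {z : EuclideanSpace ℝ (Fin n)}
    (hz : z ∈ (extChartAt (𝓡 n) x₀).target) (v : EuclideanSpace ℝ (Fin n)) :
    mfderiv 𝓘(ℝ, EuclideanSpace ℝ (Fin n)) (𝓡 n) (extChartAt (𝓡 n) x₀).symm z v =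
      coordMap x₀ ((extChartAt (𝓡 n) x₀).symm z) v := by
  have hs := (extChartAt (𝓡 n) x₀).map_target hz
  rw [coordMap, TangentBundle.symmL_trivializationAt (mem_source_iff.1 hs)]
  rw [ModelWithCorners.range_eq_univ, mfderivWithin_univ]
  have key : ∀ w, w = z → (mfderiv 𝓘(ℝ, EuclideanSpace ℝ (Fin n)) (𝓡 n)
      (extChartAt (𝓡 n) x₀).symm z v : EuclideanSpace ℝ (Fin n)) =
      (mfderiv 𝓘(ℝ, EuclideanSpace ℝ (Fin n)) (𝓡 n) (extChartAt (𝓡 n) x₀).symm w v :) := by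
    rintro w rfl
    rfl
  exact key _ ((extChartAt (𝓡 n) x₀).right_inv hz)

theorem coordMap_eq_sum (x₀ y : M) (v : EuclideanSpace ℝ (Fin n)) : coordMap x₀ y v =
    ∑ i, v i • coordMap x₀ y (EuclideanSpace.single i (1 : ℝ)) := by
  simp only [← map_smul, ← map_sum]
  congr 1
  conv_lhs => rw [← (EuclideanSpace.basisFun (Fin n) ℝ).sum_repr v]
  simp

theorem smoothAt_coordMap {x₀ y : M} (hy : y ∈ (extChartAt (𝓡 n) x₀).source)
    (v : EuclideanSpace ℝ (Fin n)) : SmoothAt (fun y => coordMap x₀ y v) y := by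
  have hb : y ∈ (trivializationAt (EuclideanSpace ℝ (Fin n))
      (TangentSpace (𝓡 n) (M := M)) x₀).baseSet := by
    simpa using hy
  have h1 : ∀ i, SmoothAt
      (fun y => coordMap (n := n) x₀ y (EuclideanSpace.single i (1 : ℝ))) y := by
    intro i
    have := contMDiffAt_localFrame_of_mem (I := 𝓡 n) ∞
      (trivializationAt (EuclideanSpace ℝ (Fin n)) (TangentSpace (𝓡 n)) x₀)
      (EuclideanSpace.basisFun (Fin n) ℝ).toBasis i hb
    refine SmoothAt.congr this ?_
    filter_upwards [(Trivialization.open_baseSet _).mem_nhds hb] with w hw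
    rw [Trivialization.localFrame_apply_of_mem_baseSet _ _ hw]
    simp only [coordMap, Trivialization.basisAt, Basis.map_apply, OrthonormalBasis.coe_toBasis,
      EuclideanSpace.basisFun_apply]
    exact Trivialization.symmL_apply _ hw _
  simp only [coordMap_eq_sum x₀ _ v]
  exact SmoothAt.sum fun i _ => (h1 i).const_smul (v i)

theorem eventually_mem_source {x₀ y : M} (hy : y ∈ (extChartAt (𝓡 n) x₀).source) :
    ∀ᶠ w in 𝓝 y, w ∈ (extChartAt (𝓡 n) x₀).source :=
  (isOpen_extChartAt_source x₀).mem_nhds hy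

/-- The `i`-th component of a vector field in the chart around `x₀`. -/
def coordComp (x₀ : M) (X : VecField n M) (i : Fin n) (y : M) : ℝ :=
  chartDeriv x₀ y (X y) i

theorem eq_sum_coordComp {x₀ y : M} (hy : y ∈ (extChartAt (𝓡 n) x₀).source) (X : VecField n M) :
    X y = ∑ i, coordComp x₀ X i y • coordMap x₀ y (EuclideanSpace.single i (1 : ℝ)) := by
  conv_lhs => rw [← coordMap_chartDeriv hy (X y), coordMap_eq_sum]
  rfl

theorem funSmoothAt_coord {x₀ y : M} (hy : y ∈ (extChartAt (𝓡 n) x₀).source) (i : Fin n) :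
    FunSmoothAt (n := n) (fun w => extChartAt (𝓡 n) x₀ w i) y := by
  have h1 : ContMDiffAt (𝓡 n) 𝓘(ℝ, EuclideanSpace ℝ (Fin n)) ∞ (extChartAt (𝓡 n) x₀) y :=
    contMDiffAt_extChartAt' (mem_source_iff.1 hy)
  exact ((EuclideanSpace.proj i :
    EuclideanSpace ℝ (Fin n) →L[ℝ] ℝ).contDiff.contMDiff.contMDiffAt).comp y h1

theorem mvfderiv_coord {x₀ y : M} (hy : y ∈ (extChartAt (𝓡 n) x₀).source) (i : Fin n)
    (w : TangentSpace (𝓡 n) y) : mvfderiv (𝓡 n) (fun w => extChartAt (𝓡 n) x₀ w i) y w =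
      chartDeriv x₀ y w i := by
  rw [← mfderiv_extChartAt hy]
  have h1 : MDifferentiableAt (𝓡 n) 𝓘(ℝ, EuclideanSpace ℝ (Fin n)) (extChartAt (𝓡 n) x₀) y :=
    mdifferentiableAt_extChartAt (mem_source_iff.1 hy)
  have h2 := ((EuclideanSpace.proj i : EuclideanSpace ℝ (Fin n) →L[ℝ] ℝ).hasMFDerivAt
    (x := extChartAt (𝓡 n) x₀ y)).comp y h1.hasMFDerivAt
  have h3 : mfderiv (𝓡 n) 𝓘(ℝ, ℝ) (fun w => extChartAt (𝓡 n) x₀ w i) y = _ := h2.mfderiv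
  simp only [mvfderiv, h3]
  rfl

variable [RiemannianBundle (fun x : M => TangentSpace (𝓡 n) x)]
  [IsContMDiffRiemannianBundle (𝓡 n) ∞ (EuclideanSpace ℝ (Fin n))
    (fun x : M => TangentSpace (𝓡 n) x)]

theorem funSmoothAt_coordComp {x₀ y : M} (hy : y ∈ (extChartAt (𝓡 n) x₀).source)
    {X : VecField n M} (hX : SmoothAt X y) (i : Fin n) :
    FunSmoothAt (n := n) (coordComp x₀ X i) y :=
  ContMDiffAt.congr_of_eventuallyEq (contMDiffAt_mvfderiv (funSmoothAt_coord hy i) hX) <| by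
    filter_upwards [eventually_mem_source hy] with w hw
    rw [mvfderiv_coord hw]
    rfl

/-- The coordinate vector fields of a chart commute. -/
theorem leviCivita_coordMap_comm {x₀ y : M} (hy : y ∈ (extChartAt (𝓡 n) x₀).source)
    (v w : EuclideanSpace ℝ (Fin n)) :
    leviCivita (fun y => coordMap x₀ y w) y (coordMap x₀ y v) =
      leviCivita (fun y => coordMap x₀ y v) y (coordMap x₀ y w) := by
  have hv := smoothAt_coordMap hy v
  have hw := smoothAt_coordMap hy w
  rw [← sub_eq_zero, leviCivita_sub_leviCivita hv.diffAt hw.diffAt]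
  set b := VectorField.mlieBracket (𝓡 n) (fun y => coordMap x₀ y v) (fun y => coordMap x₀ y w) y
  have hconst : ∀ (u : EuclideanSpace ℝ (Fin n)) (i : Fin n), (fun p => mvfderiv (𝓡 n)
      (fun w => extChartAt (𝓡 n) x₀ w i) p (coordMap x₀ p u)) =ᶠ[𝓝 y] fun _ => u i := fun u i => by
    filter_upwards [eventually_mem_source hy] with p hp
    rw [mvfderiv_coord hp, chartDeriv_coordMap hp]
  have h0 : chartDeriv x₀ y b = 0 := by
    ext i
    rw [← mvfderiv_coord hy, mvfderiv_mlieBracket (funSmoothAt_coord hy i) hv hw,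
      mvfderiv_congr (hconst w i), mvfderiv_congr (hconst v i), mvfderiv_const, mvfderiv_const]
    simp
  rw [← coordMap_chartDeriv hy b, h0, map_zero]

/-- The square root of the Gram determinant of the coordinate vector fields, as a function on the
manifold. -/
def coordDensity (x₀ y : M) : ℝ := √(Matrix.det (Matrix.of fun i j : Fin n =>
  (inner ℝ (coordMap (n := n) x₀ y (EuclideanSpace.single i (1 : ℝ)))
    (coordMap (n := n) x₀ y (EuclideanSpace.single j (1 : ℝ))) : ℝ)))

theorem chartDensity_eq {x₀ : M} {z : EuclideanSpace ℝ (Fin n)}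
    (hz : z ∈ (extChartAt (𝓡 n) x₀).target) :
    chartDensity x₀ z = coordDensity (n := n) x₀ ((extChartAt (𝓡 n) x₀).symm z) := by
  simp only [chartDensity, coordDensity, mfderiv_extChartAt_symm hz]

theorem continuousAt_coordDensity {x₀ y : M} (hy : y ∈ (extChartAt (𝓡 n) x₀).source) :
    ContinuousAt (coordDensity (n := n) x₀) y := by
  refine Real.continuous_sqrt.continuousAt.comp ?_
  refine ContinuousAt.comp (f := fun y => Matrix.of fun i j : Fin n =>
    (inner ℝ (coordMap (n := n) x₀ y (EuclideanSpace.single i (1 : ℝ)))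
      (coordMap x₀ y (EuclideanSpace.single j (1 : ℝ))) : ℝ)) (g := Matrix.det)
    (Continuous.matrix_det continuous_id).continuousAt ?_
  refine continuousAt_pi.2 fun i => continuousAt_pi.2 fun j => ?_
  exact ((smoothAt_coordMap hy _).inner (smoothAt_coordMap hy _)).continuousAt

theorem continuousOn_chartDensity (x₀ : M) :
    ContinuousOn (chartDensity (n := n) x₀) (extChartAt (𝓡 n) x₀).target := by
  have h : ContinuousOn (fun z => coordDensity (n := n) x₀ ((extChartAt (𝓡 n) x₀).symm z))
      (extChartAt (𝓡 n) x₀).target := by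
    intro z hz
    exact (ContinuousAt.comp (continuousAt_coordDensity ((extChartAt (𝓡 n) x₀).map_target hz))
      (continuousAt_extChartAt_symm'' hz)).continuousWithinAt
  exact h.congr fun z hz => chartDensity_eq hz

/-- The Gram determinants in two charts differ by the Jacobian of the transition map. -/
theorem coordDensity_eq_det_mul {x₀ x₁ y : M} (L : EuclideanSpace ℝ (Fin n) →L[ℝ]
    EuclideanSpace ℝ (Fin n)) (hL : ∀ v, coordMap x₁ y v = coordMap x₀ y (L v)) :
    coordDensity (n := n) x₁ y = |L.det| * coordDensity (n := n) x₀ y := by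
  let A : Matrix (Fin n) (Fin n) ℝ := LinearMap.toMatrix
    (EuclideanSpace.basisFun (Fin n) ℝ).toBasis (EuclideanSpace.basisFun (Fin n) ℝ).toBasis
    L.toLinearMap
  have hA : ∀ i j, A i j = L (EuclideanSpace.single j (1 : ℝ)) i := fun i j => by
    simp [A, LinearMap.toMatrix_apply]
  let G : Matrix (Fin n) (Fin n) ℝ := Matrix.of fun i j : Fin n =>
    (inner ℝ (coordMap (n := n) x₀ y (EuclideanSpace.single i (1 : ℝ)))
      (coordMap x₀ y (EuclideanSpace.single j (1 : ℝ))) : ℝ)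
  have hG : (Matrix.of fun i j : Fin n =>
      (inner ℝ (coordMap (n := n) x₁ y (EuclideanSpace.single i (1 : ℝ)))
      (coordMap x₁ y (EuclideanSpace.single j (1 : ℝ))) : ℝ)) = A.transpose * G * A := by
    ext i j
    simp only [Matrix.of_apply, Matrix.mul_apply, hL, Matrix.transpose_apply, hA]
    rw [coordMap_eq_sum x₀ y (L (EuclideanSpace.single i 1)),
      coordMap_eq_sum x₀ y (L (EuclideanSpace.single j 1)), inner_sum]
    refine Finset.sum_congr rfl fun k _ => ?_
    rw [sum_inner, Finset.sum_mul]
    refine Finset.sum_congr rfl fun l _ => ?_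
    rw [inner_smul_left, inner_smul_right, RCLike.conj_to_real]
    simp only [G, Matrix.of_apply]
    ring
  have hdet : L.det = A.det := by
    rw [ContinuousLinearMap.det, LinearMap.det_toMatrix]
  rw [coordDensity, hG, Matrix.det_mul, Matrix.det_mul, Matrix.det_transpose, hdet, coordDensity,
    show A.det * G.det * A.det = A.det ^ 2 * G.det by ring, Real.sqrt_mul (sq_nonneg _),
    Real.sqrt_sq_eq_abs]

end Chart

/-! ### The Riemannian measure in a chart -/

section Measure

variable {n : ℕ} {M : Type*} [TopologicalSpace M] [ChartedSpace (EuclideanSpace ℝ (Fin n)) M]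
  [IsManifold (𝓡 n) ∞ M] [RiemannianBundle (fun x : M => TangentSpace (𝓡 n) x)]
  [IsContMDiffRiemannianBundle (𝓡 n) ∞ (EuclideanSpace ℝ (Fin n))
    (fun x : M => TangentSpace (𝓡 n) x)] [MeasurableSpace M] [BorelSpace M]

theorem chartDensity_nonneg (x₀ : M) (z : EuclideanSpace ℝ (Fin n)) : 0 ≤ chartDensity x₀ z :=
  Real.sqrt_nonneg _

theorem measurableSet_target (x₀ : M) : MeasurableSet (extChartAt (𝓡 n) x₀).target :=
  (isOpen_extChartAt_target x₀).measurableSet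

theorem measurableSet_source (x₀ : M) : MeasurableSet (extChartAt (𝓡 n) x₀).source :=
  (isOpen_extChartAt_source x₀).measurableSet

theorem aemeasurable_chartDensity (x₀ : M) :
    AEMeasurable (fun z : EuclideanSpace ℝ (Fin n) => ENNReal.ofReal (chartDensity x₀ z))
      (volume.restrict (extChartAt (𝓡 n) x₀).target) :=
  ((continuousOn_chartDensity x₀).aemeasurable (measurableSet_target x₀)).ennreal_ofReal

theorem aemeasurable_extChartAt_symm (x₀ : M) :
    AEMeasurable (extChartAt (𝓡 n) x₀).symm
      ((volume.restrict (extChartAt (𝓡 n) x₀).target).withDensity fun z =>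
        ENNReal.ofReal (chartDensity x₀ z)) :=
  ((continuousOn_extChartAt_symm x₀).aemeasurable (measurableSet_target x₀)).mono_ac
    (withDensity_absolutelyContinuous _ _)

theorem measurableSet_target_inter_preimage (x₀ : M) {A : Set M} (hA : MeasurableSet A) :
    MeasurableSet ((extChartAt (𝓡 n) x₀).target ∩ (extChartAt (𝓡 n) x₀).symm ⁻¹' A) := by
  have h := (continuousOn_iff_continuous_domRestrict.1 (continuousOn_extChartAt_symm (I := 𝓡 n) x₀))
  have h2 := (measurableSet_target (n := n) x₀).subtype_image (h.measurable hA)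
  convert h2 using 1
  ext z
  simp [and_comm]

theorem chartMeasure_apply (x₀ : M) {A : Set M} (hA : MeasurableSet A) :
    chartMeasure (n := n) x₀ A =
      ∫⁻ z in (extChartAt (𝓡 n) x₀).target ∩ (extChartAt (𝓡 n) x₀).symm ⁻¹' A,
        ENNReal.ofReal (chartDensity x₀ z) := by
  rw [chartMeasure, Measure.map_apply_of_aemeasurable (aemeasurable_extChartAt_symm x₀) hA,
    withDensity_apply', Measure.restrict_restrict' (measurableSet_target x₀), inter_comm]

/-- Two chart measures agree on the overlap of the charts, by the change of variables formula. By
symmetry it is enough to prove an inequality. -/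
theorem chartMeasure_apply_le (x₀ x₁ : M) {A : Set M} (hA : MeasurableSet A)
    (hs : A ⊆ (extChartAt (𝓡 n) x₀).source) :
    chartMeasure (n := n) x₁ A ≤ chartMeasure (n := n) x₀ A := by
  rw [chartMeasure_apply x₁ hA, chartMeasure_apply x₀ hA]
  set S := (extChartAt (𝓡 n) x₁).target ∩ (extChartAt (𝓡 n) x₁).symm ⁻¹' A
  have hS : MeasurableSet S := measurableSet_target_inter_preimage x₁ hA
  let τ : EuclideanSpace ℝ (Fin n) → EuclideanSpace ℝ (Fin n) := fun z =>
    extChartAt (𝓡 n) x₀ ((extChartAt (𝓡 n) x₁).symm z)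
  let L : EuclideanSpace ℝ (Fin n) → EuclideanSpace ℝ (Fin n) →L[ℝ] EuclideanSpace ℝ (Fin n) :=
    fun z => (chartDeriv x₀ ((extChartAt (𝓡 n) x₁).symm z)).comp
      (coordMap x₁ ((extChartAt (𝓡 n) x₁).symm z))
  have hτ : ∀ z ∈ S, HasFDerivWithinAt τ (L z) S z := by
    intro z hz
    have hs0 := hs hz.2
    have h1 : HasMFDerivAt (𝓡 n) 𝓘(ℝ, EuclideanSpace ℝ (Fin n)) (extChartAt (𝓡 n) x₀)
        ((extChartAt (𝓡 n) x₁).symm z) _ :=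
      (mdifferentiableAt_extChartAt (mem_source_iff.1 hs0)).hasMFDerivAt
    have h2 : HasMFDerivAt 𝓘(ℝ, EuclideanSpace ℝ (Fin n)) (𝓡 n) (extChartAt (𝓡 n) x₁).symm z _ :=
      ((contMDiffOn_extChartAt_symm (n := ∞) x₁).contMDiffAt
        ((isOpen_extChartAt_target x₁).mem_nhds hz.1)).mdifferentiableAt (by simp) |>.hasMFDerivAt
    have h3 := (h1.comp z h2).hasFDerivAt.hasFDerivWithinAt (s := S)
    refine h3.congr_fderiv (ContinuousLinearMap.ext fun v => ?_)
    have e1 := congrFun (congrArg DFunLike.coe (mfderiv_extChartAt hs0))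
      (mfderiv 𝓘(ℝ, EuclideanSpace ℝ (Fin n)) (𝓡 n) (extChartAt (𝓡 n) x₁).symm z v)
    exact e1.trans (congrArg (chartDeriv x₀ _) (mfderiv_extChartAt_symm hz.1 v))
  have hinj : InjOn τ S := by
    intro z hz w hw h
    exact (extChartAt (𝓡 n) x₁).symm.injOn hz.1 hw.1
      ((extChartAt (𝓡 n) x₀).injOn (hs hz.2) (hs hw.2) h)
  have himage : τ '' S ⊆ (extChartAt (𝓡 n) x₀).target ∩ (extChartAt (𝓡 n) x₀).symm ⁻¹' A := by
    rintro _ ⟨z, hz, rfl⟩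
    refine ⟨(extChartAt (𝓡 n) x₀).map_source (hs hz.2), ?_⟩
    change (extChartAt (𝓡 n) x₀).symm (extChartAt (𝓡 n) x₀ ((extChartAt (𝓡 n) x₁).symm z)) ∈ A
    rw [(extChartAt (𝓡 n) x₀).left_inv (hs hz.2)]
    exact hz.2
  refine le_trans (le_of_eq ?_) (lintegral_mono_set himage)
  rw [lintegral_image_eq_lintegral_abs_det_fderiv_mul volume hS hτ hinj]
  refine setLIntegral_congr_fun hS fun z hz => ?_
  have hs0 := hs hz.2
  have hsz : (extChartAt (𝓡 n) x₀).symm (τ z) = (extChartAt (𝓡 n) x₁).symm z :=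
    (extChartAt (𝓡 n) x₀).left_inv hs0
  rw [← ENNReal.ofReal_mul (abs_nonneg _), chartDensity_eq hz.1,
    chartDensity_eq ((extChartAt (𝓡 n) x₀).map_source hs0), hsz,
    coordDensity_eq_det_mul (L z) fun v => (coordMap_chartDeriv hs0 _).symm]

theorem chartMeasure_restrict_source (x₀ : M) :
    (chartMeasure (n := n) x₀).restrict (extChartAt (𝓡 n) x₀).source =
      chartMeasure (n := n) x₀ := by
  refine Measure.restrict_eq_self_of_ae_mem ?_
  rw [ae_iff, show {a | a ∉ (extChartAt (𝓡 n) x₀).source} = (extChartAt (𝓡 n) x₀).sourceᶜ from rfl,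
    chartMeasure_apply x₀ (measurableSet_source x₀).compl]
  have : (extChartAt (𝓡 n) x₀).target ∩
      (extChartAt (𝓡 n) x₀).symm ⁻¹' (extChartAt (𝓡 n) x₀).sourceᶜ = ∅ := by
    ext z
    simp only [mem_inter_iff, mem_preimage, mem_compl_iff, mem_empty_iff_false, iff_false, not_and,
      not_not]
    exact fun hz => (extChartAt (𝓡 n) x₀).map_target hz
  rw [this]
  simp

/-- The supremum defining the Riemannian measure restricts to the chart measure on the domain of
each chart, because the measure `chartMeasure x₀ + (riemannianMeasure n M).restrict sᶜ` on `M` is an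
upper bound, where `s` is this domain. -/
theorem riemannianMeasure_restrict_source (x₀ : M) :
    (riemannianMeasure n M).restrict (extChartAt (𝓡 n) x₀).source = chartMeasure (n := n) x₀ := by
  set s := (extChartAt (𝓡 n) x₀).source
  have hs : MeasurableSet s := measurableSet_source x₀
  refine le_antisymm ?_ ?_
  · have h1 : riemannianMeasure n M ≤
        chartMeasure (n := n) x₀ + (riemannianMeasure n M).restrict sᶜ := by
      refine iSup_le fun x₁ => ?_
      rw [← Measure.restrict_add_restrict_compl (μ := chartMeasure (n := n) x₁) hs]
      refine add_le_add (Measure.le_intro fun A hA _ => ?_)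
        (Measure.restrict_mono le_rfl (le_iSup (fun x₀ : M => chartMeasure (n := n) x₀) x₁))
      rw [Measure.restrict_apply hA]
      exact (chartMeasure_apply_le x₀ x₁ (hA.inter hs) inter_subset_right).trans
        (measure_mono inter_subset_left)
    refine (Measure.restrict_mono le_rfl h1).trans (le_of_eq ?_)
    rw [Measure.restrict_add, Measure.restrict_restrict hs, inter_compl_self,
      Measure.restrict_empty, add_zero]
    exact chartMeasure_restrict_source x₀
  · conv_lhs => rw [← chartMeasure_restrict_source x₀]
    exact Measure.restrict_mono le_rfl (le_iSup (fun x₀ : M => chartMeasure (n := n) x₀) x₀)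

instance isLocallyFiniteMeasure_riemannianMeasure :
    IsLocallyFiniteMeasure (riemannianMeasure n M) := by
  refine ⟨fun x => ?_⟩
  obtain ⟨r, hr, hrt⟩ := Metric.nhds_basis_closedBall.mem_iff.1
    ((isOpen_extChartAt_target (I := 𝓡 n) x).mem_nhds (mem_extChartAt_target x))
  set e := extChartAt (𝓡 n) x
  have hU : e.source ∩ e ⁻¹' Metric.ball (e x) r ∈ 𝓝 x :=
    inter_mem (extChartAt_source_mem_nhds x)
      ((continuousAt_extChartAt x).preimage_mem_nhds (Metric.ball_mem_nhds _ hr))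
  have hUo : IsOpen (e.source ∩ e ⁻¹' Metric.ball (e x) r) :=
    (continuousOn_extChartAt x).isOpen_inter_preimage (isOpen_extChartAt_source x)
      Metric.isOpen_ball
  refine ⟨_, hU, ?_⟩
  rw [← inter_eq_self_of_subset_left (inter_subset_left (s := e.source)
    (t := e ⁻¹' Metric.ball (e x) r)), ← Measure.restrict_apply hUo.measurableSet,
    riemannianMeasure_restrict_source, chartMeasure_apply x hUo.measurableSet]
  have hsub : e.target ∩ e.symm ⁻¹' (e.source ∩ e ⁻¹' Metric.ball (e x) r) ⊆
      Metric.closedBall (e x) r := by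
    rintro z ⟨hz, -, hz2⟩
    rw [mem_preimage, e.right_inv hz] at hz2
    exact Metric.ball_subset_closedBall hz2
  refine (lintegral_mono_set hsub).trans_lt ?_
  have hK := isCompact_closedBall (e x) r
  obtain ⟨C, hC⟩ := (hK.image_of_continuousOn
    ((continuousOn_chartDensity (n := n) x).mono hrt)).bddAbove
  refine (setLIntegral_mono' (g := fun _ => ENNReal.ofReal C) hK.measurableSet fun z hz =>
    ENNReal.ofReal_le_ofReal (hC (mem_image_of_mem _ hz))).trans_lt ?_
  rw [setLIntegral_const]
  exact ENNReal.mul_lt_top ENNReal.ofReal_lt_top hK.measure_lt_top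

/-- The integral of a function which vanishes outside the domain of a chart. -/
theorem integral_eq_integral_target (x₀ : M) {h : M → ℝ}
    (hm : AEStronglyMeasurable h (riemannianMeasure n M))
    (h0 : ∀ y ∉ (extChartAt (𝓡 n) x₀).source, h y = 0) :
    ∫ y, h y ∂(riemannianMeasure n M) = ∫ z in (extChartAt (𝓡 n) x₀).target,
      chartDensity x₀ z * h ((extChartAt (𝓡 n) x₀).symm z) := by
  rw [← setIntegral_eq_integral_of_forall_compl_eq_zero (s := (extChartAt (𝓡 n) x₀).source) h0,
    riemannianMeasure_restrict_source]
  have hm' : AEStronglyMeasurable h (chartMeasure (n := n) x₀) := by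
    rw [← riemannianMeasure_restrict_source]
    exact hm.restrict
  rw [chartMeasure] at hm' ⊢
  rw [integral_map (aemeasurable_extChartAt_symm x₀) hm',
    integral_withDensity_eq_integral_toReal_smul₀ (aemeasurable_chartDensity x₀)
      (Eventually.of_forall fun _ => ENNReal.ofReal_lt_top)]
  simp only [ENNReal.toReal_ofReal (chartDensity_nonneg x₀ _), smul_eq_mul]

end Measure

/-! ### The Riemannian distance in a chart -/

section ChartLipschitz

variable {n : ℕ} {M : Type*} [MetricSpace M] [ChartedSpace (EuclideanSpace ℝ (Fin n)) M]
  [IsManifold (𝓡 n) ∞ M] [RiemannianBundle (fun x : M => TangentSpace (𝓡 n) x)]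
  [IsContMDiffRiemannianBundle (𝓡 n) ∞ (EuclideanSpace ℝ (Fin n))
    (fun x : M => TangentSpace (𝓡 n) x)] [IsRiemannianManifold (𝓡 n) M]

/-- The distance of two points is at most the length of the path which is a segment in a chart. -/
theorem dist_extChartAt_symm_le {x₀ : M} {z w : EuclideanSpace ℝ (Fin n)} {c : ℝ} (hc : 0 ≤ c)
    (hseg : segment ℝ z w ⊆ (extChartAt (𝓡 n) x₀).target)
    (hbound : ∀ q ∈ segment ℝ z w,
      ‖coordMap x₀ ((extChartAt (𝓡 n) x₀).symm q) (w - z)‖ ≤ c) :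
    dist ((extChartAt (𝓡 n) x₀).symm z) ((extChartAt (𝓡 n) x₀).symm w) ≤ c := by
  set e := extChartAt (𝓡 n) x₀
  let η : ℝ →ᴬ[ℝ] EuclideanSpace ℝ (Fin n) := ContinuousAffineMap.lineMap z w
  have hη : ∀ t ∈ Icc (0 : ℝ) 1, η t ∈ segment ℝ z w := fun t ht => by
    rw [segment_eq_image_lineMap]
    exact ⟨t, ht, rfl⟩
  have hηd : ∀ t : ℝ, HasDerivAt η (w - z) t := fun t => by
    exact AffineMap.hasDerivAt_lineMap (a := z) (b := w) (x := t)
  have he : ∀ q ∈ e.target, ContMDiffAt (𝓡 n) (𝓡 n) 1 e.symm q := fun q hq =>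
    ((contMDiffOn_extChartAt_symm (n := ∞) x₀).contMDiffAt
      ((isOpen_extChartAt_target x₀).mem_nhds hq)).of_le (by simp)
  have hγ : ContMDiffOn 𝓘(ℝ, ℝ) (𝓡 n) 1 (e.symm ∘ η) (Icc 0 1) := fun t ht =>
    ((he _ (hseg (hη t ht))).comp t (contMDiffAt_iff_contDiffAt.2 η.contDiff.contDiffAt)
      ).contMDiffWithinAt
  have h1 : edist (e.symm z) (e.symm w) ≤ pathELength (𝓡 n) (e.symm ∘ η) 0 1 := by
    rw [IsRiemannianManifold.out (I := 𝓡 n) (e.symm z)]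
    exact riemannianEDist_le_pathELength hγ (by simp [η, ContinuousAffineMap.coe_lineMap_eq])
      (by simp [η, ContinuousAffineMap.coe_lineMap_eq]) zero_le_one
  have h2 : pathELength (𝓡 n) (e.symm ∘ η) 0 1 ≤ ENNReal.ofReal c := by
    rw [pathELength_eq_lintegral_mfderiv_Icc]
    refine (setLIntegral_mono' (g := fun _ => ENNReal.ofReal c) measurableSet_Icc
      fun t ht => ?_).trans (by simp)
    have hd := ((he _ (hseg (hη t ht))).mdifferentiableAt (by simp)).hasMFDerivAt.comp t
      (hηd t).hasFDerivAt.hasMFDerivAt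
    rw [hd.mfderiv, ← ofReal_norm]
    refine ENNReal.ofReal_le_ofReal ?_
    refine le_trans (le_of_eq ?_) (hbound _ (hη t ht))
    rw [← mfderiv_extChartAt_symm (hseg (hη t ht))]
    change ‖mfderiv (𝓡 n) (𝓡 n) e.symm (η t) ((1 : ℝ) • (w - z))‖ = _
    rw [one_smul]
  have h3 := h1.trans h2
  rw [edist_dist, ENNReal.ofReal_le_ofReal_iff hc] at h3
  exact h3

/-- The inverse chart is Lipschitz on a small ball. -/
theorem exists_lipschitzOnWith_extChartAt_symm (x₀ : M) : ∃ r > 0, ∃ C,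
    Metric.ball (extChartAt (𝓡 n) x₀ x₀) r ⊆ (extChartAt (𝓡 n) x₀).target ∧
    LipschitzOnWith C (extChartAt (𝓡 n) x₀).symm (Metric.ball (extChartAt (𝓡 n) x₀ x₀) r) := by
  have : IsContinuousRiemannianBundle (EuclideanSpace ℝ (Fin n))
      (fun x : M => TangentSpace (𝓡 n) x) := by
    obtain ⟨g, hg, h⟩ := IsContMDiffRiemannianBundle.exists_contMDiff (IB := 𝓡 n) (n := ∞)
      (F := EuclideanSpace ℝ (Fin n)) (E := fun x : M => TangentSpace (𝓡 n) x)
    exact ⟨g, hg.continuous, h⟩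
  obtain ⟨C, hC, hev⟩ := eventually_norm_symmL_trivializationAt_lt (EuclideanSpace ℝ (Fin n))
    (fun x : M => TangentSpace (𝓡 n) x) x₀
  have hlim : Tendsto (extChartAt (𝓡 n) x₀).symm (𝓝 (extChartAt (𝓡 n) x₀ x₀)) (𝓝 x₀) := by
    simpa only [ContinuousAt, extChartAt_to_inv] using continuousAt_extChartAt_symm (I := 𝓡 n) x₀
  have hev' : ∀ᶠ q in 𝓝 (extChartAt (𝓡 n) x₀ x₀),
      ‖coordMap (n := n) x₀ ((extChartAt (𝓡 n) x₀).symm q)‖ < C := hlim.eventually hev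
  obtain ⟨r, hr, hball⟩ := Metric.nhds_basis_ball.mem_iff.1
    (inter_mem ((isOpen_extChartAt_target (I := 𝓡 n) x₀).mem_nhds (mem_extChartAt_target x₀)) hev')
  refine ⟨r, hr, C.toNNReal, fun z hz => (hball hz).1,
    LipschitzOnWith.of_dist_le_mul fun z hz w hw => ?_⟩
  have hseg := (convex_ball _ r).segment_subset hz hw
  refine dist_extChartAt_symm_le (by positivity) (fun q hq => (hball (hseg hq)).1) fun q hq => ?_
  rw [Real.coe_toNNReal C hC.le, dist_eq_norm, norm_sub_rev z w]
  exact ContinuousLinearMap.le_of_opNorm_le _ (hball (hseg hq)).2.le (w - z)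

theorem continuousAt_norm_coordMap {x₀ : M} {z : EuclideanSpace ℝ (Fin n)}
    (hz : z ∈ (extChartAt (𝓡 n) x₀).target) (v : EuclideanSpace ℝ (Fin n)) :
    ContinuousAt (fun q => ‖coordMap x₀ ((extChartAt (𝓡 n) x₀).symm q) v‖) z := by
  have h1 := smoothAt_coordMap ((extChartAt (𝓡 n) x₀).map_target hz) v
  have h2 : ContinuousAt (fun y : M => ‖coordMap x₀ y v‖) ((extChartAt (𝓡 n) x₀).symm z) := by
    simp only [norm_eq_sqrt_real_inner]
    exact Real.continuous_sqrt.continuousAt.comp (h1.inner h1).continuousAt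
  exact ContinuousAt.comp (g := fun y : M => ‖coordMap x₀ y v‖) h2
    (continuousAt_extChartAt_symm'' hz)

/-- A Lipschitz function with constant `K` has differential of norm at most `K`, where its
expression in a chart is differentiable. -/
theorem abs_fderiv_le_of_lipschitz {x₀ : M} {φ : M → ℝ} {K : NNReal} (hφ : LipschitzWith K φ)
    {g : EuclideanSpace ℝ (Fin n) → ℝ} {z : EuclideanSpace ℝ (Fin n)}
    (hz : z ∈ (extChartAt (𝓡 n) x₀).target)
    (hg : ∀ᶠ w in 𝓝 z, g w = φ ((extChartAt (𝓡 n) x₀).symm w))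
    (hd : DifferentiableAt ℝ g z) (v : EuclideanSpace ℝ (Fin n)) :
    |fderiv ℝ g z v| ≤ K * ‖coordMap x₀ ((extChartAt (𝓡 n) x₀).symm z) v‖ := by
  -- compare difference quotients along the segment from `z` in direction `v`, whose length is at
  -- most `s (c + δ)` by continuity of the metric
  refine le_of_forall_pos_le_add fun ε hε => ?_
  set c := ‖coordMap x₀ ((extChartAt (𝓡 n) x₀).symm z) v‖
  obtain ⟨δ, hδ, hKδ⟩ : ∃ δ > 0, (K : ℝ) * (c + δ) ≤ K * c + ε := by
    refine ⟨ε / (K + 1), by positivity, ?_⟩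
    have : (K : ℝ) * (ε / (K + 1)) ≤ ε := by
      rw [mul_div_assoc', div_le_iff₀ (by positivity)]
      nlinarith
    linarith
  refine le_trans ?_ hKδ
  have hev := hg.and ((eventually_mem_set.2
    ((isOpen_extChartAt_target (I := 𝓡 n) x₀).mem_nhds hz)).and
    ((continuousAt_norm_coordMap hz v).eventually_lt_const (show c < c + δ by linarith)))
  obtain ⟨r, hr, hball⟩ := Metric.nhds_basis_ball.mem_iff.1 hev
  have hlim : Tendsto (fun s : ℝ => |s⁻¹ • (g (z + s • v) - g z)|) (𝓝[>] 0)
      (𝓝 |fderiv ℝ g z v|) :=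
    ((hd.hasFDerivAt.hasLineDerivAt v).tendsto_slope_zero_right).abs
  refine le_of_tendsto hlim ?_
  have hnear : ∀ᶠ s : ℝ in 𝓝[>] 0, z + s • v ∈ Metric.ball z r := by
    have : ContinuousAt (fun s : ℝ => z + s • v) 0 := by fun_prop
    refine (this.tendsto.mono_left nhdsWithin_le_nhds).eventually ?_
    rw [zero_smul, add_zero]
    exact Metric.ball_mem_nhds z hr
  filter_upwards [hnear, self_mem_nhdsWithin] with s hs hs0
  have hs0' : 0 < s := hs0
  have hseg := (convex_ball z r).segment_subset (Metric.mem_ball_self hr) hs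
  have hdist : dist ((extChartAt (𝓡 n) x₀).symm z) ((extChartAt (𝓡 n) x₀).symm (z + s • v)) ≤
      s * (c + δ) := by
    refine dist_extChartAt_symm_le (by positivity) (fun q hq => (hball (hseg hq)).2.1)
      fun q hq => ?_
    rw [add_sub_cancel_left, map_smul, norm_smul, Real.norm_of_nonneg hs0'.le]
    exact mul_le_mul_of_nonneg_left (hball (hseg hq)).2.2.le hs0'.le
  rw [(hball hs).1, (hball (Metric.mem_ball_self hr)).1, smul_eq_mul, abs_mul,
    abs_of_pos (inv_pos.2 hs0'), inv_mul_le_iff₀ hs0']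
  have h5 := hφ.dist_le_mul ((extChartAt (𝓡 n) x₀).symm (z + s • v))
    ((extChartAt (𝓡 n) x₀).symm z)
  rw [Real.dist_eq, dist_comm] at h5
  refine h5.trans ((mul_le_mul_of_nonneg_left hdist K.2).trans (le_of_eq ?_))
  exact mul_left_comm _ _ _

end ChartLipschitz

/-! ### The divergence in a chart -/

section Divergence

variable {n : ℕ} {M : Type*} [TopologicalSpace M] [ChartedSpace (EuclideanSpace ℝ (Fin n)) M]
  [IsManifold (𝓡 n) ∞ M] [RiemannianBundle (fun x : M => TangentSpace (𝓡 n) x)]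
  [IsContMDiffRiemannianBundle (𝓡 n) ∞ (EuclideanSpace ℝ (Fin n))
    (fun x : M => TangentSpace (𝓡 n) x)]

theorem divergence_smul {f : M → ℝ} {X : VecField n M} {x : M}
    (hf : MDifferentiableAt (𝓡 n) 𝓘(ℝ) f x) (hX : DiffAt X x) :
    divergence (fun y => f y • X y) x = f x * divergence X x + mvfderiv (𝓡 n) f x (X x) := by
  simp only [divergence, leviCivita_smul hf hX, inner_add_left, inner_smul_left,
    RCLike.conj_to_real, Finset.sum_add_distrib, Finset.mul_sum]
  congr 1
  conv_rhs => rw [← (frame x).sum_repr' (X x)]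
  simp only [map_sum, map_smul, smul_eq_mul]
  exact Finset.sum_congr rfl fun i _ => by rw [mul_comm, real_inner_comm]

theorem divergence_sum {ι : Type*} {s : Finset ι} {X : ι → VecField n M} {x : M}
    (hX : ∀ i ∈ s, DiffAt (X i) x) :
    divergence (fun y => ∑ i ∈ s, X i y) x = ∑ i ∈ s, divergence (X i) x := by
  simp only [divergence, leviCivita_sum hX]
  rw [Finset.sum_comm]
  refine Finset.sum_congr rfl fun k _ => ?_
  rw [← sum_inner]
  congr 1
  simp

theorem divergence_congr {X Y : VecField n M} {x : M} (hX : DiffAt X x)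
    (h : ∀ᶠ y in 𝓝 x, Y y = X y) : divergence Y x = divergence X x := by
  simp only [divergence, leviCivita_congr hX h]

theorem hasFDerivAt_comp_extChartAt_symm {x₀ : M} {z : EuclideanSpace ℝ (Fin n)}
    (hz : z ∈ (extChartAt (𝓡 n) x₀).target) {h : M → ℝ}
    (hh : MDifferentiableAt (𝓡 n) 𝓘(ℝ) h ((extChartAt (𝓡 n) x₀).symm z)) :
    HasFDerivAt (h ∘ (extChartAt (𝓡 n) x₀).symm) ((mvfderiv (𝓡 n) h
      ((extChartAt (𝓡 n) x₀).symm z)).comp (coordMap x₀ ((extChartAt (𝓡 n) x₀).symm z))) z := by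
  have h2 : HasMFDerivAt 𝓘(ℝ, EuclideanSpace ℝ (Fin n)) (𝓡 n) (extChartAt (𝓡 n) x₀).symm z _ :=
    ((contMDiffOn_extChartAt_symm (n := ∞) x₀).contMDiffAt
      ((isOpen_extChartAt_target x₀).mem_nhds hz)).mdifferentiableAt (by simp) |>.hasMFDerivAt
  have h3 := (hh.hasMFDerivAt.comp z h2).hasFDerivAt
  refine h3.congr_fderiv (ContinuousLinearMap.ext fun v => ?_)
  exact congrArg (mvfderiv (𝓡 n) h ((extChartAt (𝓡 n) x₀).symm z)) (mfderiv_extChartAt_symm hz v)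

end Divergence

section DimThree

variable {M : Type*} [TopologicalSpace M] [ChartedSpace (EuclideanSpace ℝ (Fin 3)) M]
  [IsManifold (𝓡 3) ∞ M] [RiemannianBundle (fun x : M => TangentSpace (𝓡 3) x)]

/-- An endomorphism acts on the volume form as a derivation, by its trace. -/
theorem sum_inner_cross (o : ManifoldOrientation M) {x : M}
    (A : TangentSpace (𝓡 3) x →L[ℝ] TangentSpace (𝓡 3) x) (a b c : TangentSpace (𝓡 3) x) :
    (inner ℝ (cross o x (A a) b) c : ℝ) + inner ℝ (cross o x a (A b)) c +
      inner ℝ (cross o x a b) (A c) =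
      (∑ i, inner ℝ (A (frame (n := 3) x i)) (frame (n := 3) x i)) * inner ℝ (cross o x a b) c := by
  obtain ⟨e, he⟩ := exists_oriented o x
  have htr := sum_bilin_eq (innerBilin A.toLinearMap) (frame x) e
  have htr' : ∑ i, (inner ℝ (A (frame (n := 3) x i)) (frame (n := 3) x i) : ℝ) =
      ∑ i, inner ℝ (e i) (A (e i)) := by
    refine Eq.trans htr (Finset.sum_congr rfl fun i _ => ?_)
    exact real_inner_comm (e i) (A (e i))
  have hA : ∀ i w, (inner ℝ (e i) (A w) : ℝ) =
      ∑ j, inner ℝ (e j) w * inner ℝ (e i) (A (e j)) := fun i w => by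
    conv_lhs => rw [← e.sum_repr' w]
    simp only [map_sum, map_smul, inner_sum, inner_smul_right]
  rw [htr']
  simp only [inner_cross_eq o _ _ _ he, det3, hA _ a, hA _ b, hA _ c, Fin.sum_univ_three]
  ring

/-- The signed volume of the parallelepiped spanned by the coordinate vector fields. -/
def coordVolume (o : ManifoldOrientation M) (x₀ y : M) : ℝ :=
  inner ℝ (cross o y (coordMap (n := 3) x₀ y (EuclideanSpace.single 0 1))
    (coordMap (n := 3) x₀ y (EuclideanSpace.single 1 1)))
      (coordMap (n := 3) x₀ y (EuclideanSpace.single 2 1))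

theorem coordDensity_eq_abs_coordVolume (o : ManifoldOrientation M) (x₀ y : M) :
    coordDensity (n := 3) x₀ y = |coordVolume o x₀ y| := by
  obtain ⟨e, he⟩ := exists_oriented o y
  rw [coordDensity, coordVolume, ← Real.sqrt_sq_eq_abs, inner_cross_eq o _ _ _ he]
  congr 1
  have h : ∀ v w : TangentSpace (𝓡 3) y, (inner ℝ v w : ℝ) =
      ∑ k, inner ℝ (e k) v * inner ℝ (e k) w := fun v w => by
    rw [← e.sum_inner_mul_inner v w]
    exact Finset.sum_congr rfl fun k _ => by rw [real_inner_comm]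
  rw [Matrix.det_fin_three]
  simp only [Matrix.of_apply]
  set a := coordMap (n := 3) x₀ y (EuclideanSpace.single 0 1)
  set b := coordMap (n := 3) x₀ y (EuclideanSpace.single 1 1)
  set c := coordMap (n := 3) x₀ y (EuclideanSpace.single 2 1)
  rw [h a a, h a b, h a c, h b a, h b b, h b c, h c a, h c b, h c c]
  simp only [det3, Fin.sum_univ_three]
  ring

theorem coordVolume_ne_zero (o : ManifoldOrientation M) {x₀ y : M}
    (hy : y ∈ (extChartAt (𝓡 3) x₀).source) : coordVolume o x₀ y ≠ 0 := by
  intro h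
  rw [coordVolume] at h
  set a := coordMap (n := 3) x₀ y (EuclideanSpace.single 0 1) with ha
  set b := coordMap (n := 3) x₀ y (EuclideanSpace.single 1 1) with hb
  set c := coordMap (n := 3) x₀ y (EuclideanSpace.single 2 1) with hc
  have haa : (inner ℝ (cross o y a b) a : ℝ) = 0 := by
    have := inner_cross_swap o a a b
    rw [inner_cross_rotate o a b a, inner_cross_rotate o b a a]
    linarith
  have hbb : (inner ℝ (cross o y a b) b : ℝ) = 0 := by
    have := inner_cross_swap o b b a
    rw [inner_cross_rotate o a b b]
    linarith
  -- the coordinate vectors span, so a vector orthogonal to them vanishes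
  have h0 : cross o y a b = 0 := by
    have hs := coordMap_chartDeriv hy (cross o y a b)
    rw [coordMap_eq_sum, Fin.sum_univ_three] at hs
    rw [← ha, ← hb, ← hc] at hs
    rw [← inner_self_eq_zero (𝕜 := ℝ)]
    refine (congrArg (fun q => (inner ℝ (cross o y a b) q : ℝ)) hs).symm.trans ?_
    simp only [inner_add_right, inner_smul_right, h, haa, hbb, mul_zero, add_zero]
  have h1 := cross_cross o b a b
  rw [h0, map_zero] at h1
  have h2 := congrArg (chartDeriv x₀ y) h1
  rw [map_zero, map_sub, map_smul, map_smul, ha, hb, chartDeriv_coordMap hy,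
    chartDeriv_coordMap hy, ← hb] at h2
  have h3 := congrArg (fun v : EuclideanSpace ℝ (Fin 3) => v 0) h2
  have h4 : (inner ℝ b b : ℝ) = 0 := by simpa using h3.symm
  rw [inner_self_eq_zero] at h4
  have h5 := chartDeriv_coordMap hy (EuclideanSpace.single 1 1)
  rw [← hb, h4, map_zero] at h5
  have h6 := congrArg (fun v : EuclideanSpace ℝ (Fin 3) => v 1) h5
  simp at h6

variable [IsContMDiffRiemannianBundle (𝓡 3) ∞ (EuclideanSpace ℝ (Fin 3))
    (fun x : M => TangentSpace (𝓡 3) x)]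

theorem funSmoothAt_coordVolume (o : ManifoldOrientation M) {x₀ y : M}
    (hy : y ∈ (extChartAt (𝓡 3) x₀).source) : FunSmoothAt (n := 3) (coordVolume o x₀) y :=
  (smoothAt_cross o (smoothAt_coordMap hy _) (smoothAt_coordMap hy _)).inner
    (smoothAt_coordMap hy _)

/-- The derivative of the coordinate volume along a coordinate vector field: the coordinate vector
fields commute, so `∇_{∂ᵢ}∂ⱼ` is the image of `∂ⱼ` under `∇∂ᵢ`, whose trace is `div ∂ᵢ`. -/
theorem mvfderiv_coordVolume (o : ManifoldOrientation M) {x₀ y : M}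
    (hy : y ∈ (extChartAt (𝓡 3) x₀).source) (v : EuclideanSpace ℝ (Fin 3)) :
    mvfderiv (𝓡 3) (coordVolume o x₀) y (coordMap x₀ y v) =
      divergence (fun y => coordMap x₀ y v) y * coordVolume o x₀ y := by
  have hs := fun i : Fin 3 => smoothAt_coordMap hy (EuclideanSpace.single i (1 : ℝ))
  have h1 := mvfderiv_inner (smoothAt_cross o (hs 0) (hs 1)).diffAt (hs 2).diffAt
    (coordMap x₀ y v)
  refine Eq.trans h1 ?_
  rw [leviCivita_cross o (hs 0) (hs 1), inner_add_left, leviCivita_coordMap_comm hy,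
    leviCivita_coordMap_comm hy v (EuclideanSpace.single 1 1),
    leviCivita_coordMap_comm hy v (EuclideanSpace.single 2 1)]
  exact sum_inner_cross o (leviCivita (fun y => coordMap x₀ y v) y) _ _ _

/-- Near a point, `√g` is the coordinate volume up to a constant sign. -/
theorem eventually_coordDensity_eq (o : ManifoldOrientation M) {x₀ y : M}
    (hy : y ∈ (extChartAt (𝓡 3) x₀).source) : ∃ s : ℝ,
      coordDensity (n := 3) x₀ =ᶠ[𝓝 y] fun w => s * coordVolume o x₀ w := by
  have hc := (funSmoothAt_coordVolume o hy).continuousAt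
  rcases (coordVolume_ne_zero o hy).lt_or_gt with h | h
  · refine ⟨-1, ?_⟩
    filter_upwards [hc.eventually_lt_const h] with w hw
    rw [coordDensity_eq_abs_coordVolume o, abs_of_neg hw, neg_one_mul]
  · refine ⟨1, ?_⟩
    filter_upwards [hc.eventually_const_lt h] with w hw
    rw [coordDensity_eq_abs_coordVolume o, abs_of_pos hw, one_mul]

theorem funSmoothAt_coordDensity (o : ManifoldOrientation M) {x₀ y : M}
    (hy : y ∈ (extChartAt (𝓡 3) x₀).source) :
    FunSmoothAt (n := 3) (coordDensity (n := 3) x₀) y := by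
  obtain ⟨s, hs⟩ := eventually_coordDensity_eq o hy
  exact ContMDiffAt.congr_of_eventuallyEq
    (contMDiffAt_const.mul (funSmoothAt_coordVolume o hy)) hs

theorem mvfderiv_coordDensity (o : ManifoldOrientation M) {x₀ y : M}
    (hy : y ∈ (extChartAt (𝓡 3) x₀).source) (v : EuclideanSpace ℝ (Fin 3)) :
    mvfderiv (𝓡 3) (coordDensity (n := 3) x₀) y (coordMap x₀ y v) =
      divergence (fun y => coordMap x₀ y v) y * coordDensity (n := 3) x₀ y := by
  obtain ⟨s, hs⟩ := eventually_coordDensity_eq o hy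
  rw [mvfderiv_congr hs, mvfderiv_fun_mul mdifferentiableAt_const
    (funSmoothAt_coordVolume o hy).diff, mvfderiv_const, hs.eq_of_nhds]
  simp only [smul_apply, smul_zero, add_zero, smul_eq_mul, mvfderiv_coordVolume o hy]
  ring

/-- The divergence in a chart, `√g div X = ∑ᵢ ∂ᵢ(√g Xⁱ)`. -/
theorem coordDensity_mul_divergence (o : ManifoldOrientation M) {x₀ y : M}
    (hy : y ∈ (extChartAt (𝓡 3) x₀).source) {X : VecField 3 M} (hX : SmoothAt X y) :
    coordDensity (n := 3) x₀ y * divergence X y =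
      ∑ i, mvfderiv (𝓡 3) (fun w => coordDensity (n := 3) x₀ w * coordComp x₀ X i w) y
        (coordMap x₀ y (EuclideanSpace.single i 1)) := by
  have hs := fun i : Fin 3 => smoothAt_coordMap hy (EuclideanSpace.single i (1 : ℝ))
  have hc := funSmoothAt_coordComp hy hX
  have hd : DiffAt (fun w => ∑ i, coordComp x₀ X i w •
      coordMap x₀ w (EuclideanSpace.single i (1 : ℝ))) y :=
    DiffAt.sum fun i _ => DiffAt.smul (hc i).diff (hs i).diffAt
  rw [divergence_congr hd ((eventually_mem_source hy).mono fun w hw => eq_sum_coordComp hw X),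
    divergence_sum fun i _ => DiffAt.smul (hc i).diff (hs i).diffAt, Finset.mul_sum]
  refine Finset.sum_congr rfl fun i _ => ?_
  rw [divergence_smul (hc i).diff (hs i).diffAt,
    mvfderiv_fun_mul (funSmoothAt_coordDensity o hy).diff (hc i).diff]
  simp only [add_apply, smul_apply, smul_eq_mul, mvfderiv_coordDensity o hy]
  ring

end DimThree

/-! ### Functions supported in a chart -/

section PullChart

variable {n : ℕ} {M : Type*} [TopologicalSpace M] [T2Space M]
  [ChartedSpace (EuclideanSpace ℝ (Fin n)) M]

/-- The expression of a function in the chart around `x₀`, extended by zero. -/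
def pullChart (n : ℕ) {M : Type*} [TopologicalSpace M] [ChartedSpace (EuclideanSpace ℝ (Fin n)) M]
    (x₀ : M) (F : M → ℝ) : EuclideanSpace ℝ (Fin n) → ℝ :=
  (extChartAt (𝓡 n) x₀).target.indicator (F ∘ (extChartAt (𝓡 n) x₀).symm)

variable {x₀ : M} {F : M → ℝ} {S : Set M} {z : EuclideanSpace ℝ (Fin n)}

theorem pullChart_of_mem (hz : z ∈ (extChartAt (𝓡 n) x₀).target) :
    pullChart n x₀ F z = F ((extChartAt (𝓡 n) x₀).symm z) := indicator_of_mem hz _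

theorem pullChart_eventuallyEq (hz : z ∈ (extChartAt (𝓡 n) x₀).target) :
    pullChart n x₀ F =ᶠ[𝓝 z] F ∘ (extChartAt (𝓡 n) x₀).symm := by
  filter_upwards [(isOpen_extChartAt_target x₀).mem_nhds hz] with w hw using pullChart_of_mem hw

theorem pullChart_eq_zero (h0 : ∀ y ∉ S, F y = 0)
    (hz : z ∉ extChartAt (𝓡 n) x₀ '' S) : pullChart n x₀ F z = 0 := by
  by_cases hzt : z ∈ (extChartAt (𝓡 n) x₀).target
  · rw [pullChart_of_mem hzt]
    exact h0 _ fun h => hz ⟨_, h, (extChartAt (𝓡 n) x₀).right_inv hzt⟩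
  · exact indicator_of_notMem hzt _

theorem isCompact_image_extChartAt (hS : IsCompact S) (hsub : S ⊆ (extChartAt (𝓡 n) x₀).source) :
    IsCompact (extChartAt (𝓡 n) x₀ '' S) :=
  hS.image_of_continuousOn ((continuousOn_extChartAt x₀).mono hsub)

theorem pullChart_eventuallyEq_zero (hS : IsCompact S)
    (hsub : S ⊆ (extChartAt (𝓡 n) x₀).source) (h0 : ∀ y ∉ S, F y = 0)
    (hz : z ∉ extChartAt (𝓡 n) x₀ '' S) : pullChart n x₀ F =ᶠ[𝓝 z] 0 := by
  filter_upwards [(isCompact_image_extChartAt hS hsub).isClosed.isOpen_compl.mem_nhds hz] with w hw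
    using pullChart_eq_zero h0 hw

theorem hasCompactSupport_pullChart (hS : IsCompact S)
    (hsub : S ⊆ (extChartAt (𝓡 n) x₀).source) (h0 : ∀ y ∉ S, F y = 0) :
    HasCompactSupport (pullChart n x₀ F) :=
  HasCompactSupport.intro (isCompact_image_extChartAt hS hsub) fun _ hz => pullChart_eq_zero h0 hz

theorem continuous_pullChart (hS : IsCompact S) (hsub : S ⊆ (extChartAt (𝓡 n) x₀).source)
    (h0 : ∀ y ∉ S, F y = 0) (hF : ∀ y ∈ (extChartAt (𝓡 n) x₀).source, ContinuousAt F y) :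
    Continuous (pullChart n x₀ F) := by
  rw [continuous_iff_continuousAt]
  intro z
  by_cases hz : z ∈ (extChartAt (𝓡 n) x₀).target
  · exact (ContinuousAt.comp (hF _ ((extChartAt (𝓡 n) x₀).map_target hz))
      (continuousAt_extChartAt_symm'' hz)).congr (pullChart_eventuallyEq hz).symm
  · refine continuousAt_const.congr (pullChart_eventuallyEq_zero hS hsub h0 ?_).symm
    rintro ⟨y, hy, rfl⟩
    exact hz ((extChartAt (𝓡 n) x₀).map_source (hsub hy))

theorem contDiff_pullChart [IsManifold (𝓡 n) ∞ M] (hS : IsCompact S)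
    (hsub : S ⊆ (extChartAt (𝓡 n) x₀).source) (h0 : ∀ y ∉ S, F y = 0)
    (hF : ∀ y ∈ (extChartAt (𝓡 n) x₀).source, FunSmoothAt (n := n) F y) :
    ContDiff ℝ ∞ (pullChart n x₀ F) := by
  rw [contDiff_iff_contDiffAt]
  intro z
  by_cases hz : z ∈ (extChartAt (𝓡 n) x₀).target
  · have h1 : ContMDiffAt (𝓡 n) (𝓡 n) ∞ (extChartAt (𝓡 n) x₀).symm z :=
      (contMDiffOn_extChartAt_symm x₀).contMDiffAt ((isOpen_extChartAt_target x₀).mem_nhds hz)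
    exact (contMDiffAt_iff_contDiffAt.1 (ContMDiffAt.comp z
      (hF _ ((extChartAt (𝓡 n) x₀).map_target hz)) h1)).congr_of_eventuallyEq
        (pullChart_eventuallyEq hz)
  · refine contDiffAt_const.congr_of_eventuallyEq (pullChart_eventuallyEq_zero hS hsub h0 ?_)
    rintro ⟨y, hy, rfl⟩
    exact hz ((extChartAt (𝓡 n) x₀).map_source (hsub hy))

end PullChart

/-! ### Integration by parts against a Lipschitz function -/

section LocalInequality

variable {M : Type*} [MetricSpace M] [ChartedSpace (EuclideanSpace ℝ (Fin 3)) M]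
  [IsManifold (𝓡 3) ∞ M] [RiemannianBundle (fun x : M => TangentSpace (𝓡 3) x)]
  [IsContMDiffRiemannianBundle (𝓡 3) ∞ (EuclideanSpace ℝ (Fin 3))
    (fun x : M => TangentSpace (𝓡 3) x)]

theorem divergence_eq_zero {X : VecField 3 M} {S : Set M} (hS : IsCompact S)
    (h0 : ∀ y ∉ S, X y = 0) {y : M} (hX : DiffAt X y) (hy : y ∉ S) : divergence X y = 0 := by
  have h1 : ∀ᶠ w in 𝓝 y, X w = (0 : ℝ) • X w := by
    filter_upwards [hS.isClosed.isOpen_compl.mem_nhds hy] with w hw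
    rw [h0 w hw, smul_zero]
  rw [divergence_congr (DiffAt.smul (f := fun _ => 0) mdifferentiableAt_const hX) h1,
    divergence_smul (f := fun _ => 0) mdifferentiableAt_const hX, mvfderiv_const]
  simp

variable [IsRiemannianManifold (𝓡 3) M] [MeasurableSpace M] [BorelSpace M]

theorem SmoothAt.continuousAt_norm {X : VecField 3 M} {y : M} (hX : SmoothAt X y) :
    ContinuousAt (fun y => ‖X y‖) y := by
  simp only [norm_eq_sqrt_real_inner]
  exact Real.continuous_sqrt.continuousAt.comp (hX.inner hX).continuousAt

/-- Integration by parts in a chart against a Lipschitz function, which is differentiable almost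
everywhere by Rademacher's theorem. -/
theorem abs_integral_mul_divergence_le_of_chart [SecondCountableTopology M]
    (o : ManifoldOrientation M) {x₀ : M} {r : ℝ} {C : NNReal}
    (hLip : LipschitzOnWith C (extChartAt (𝓡 3) x₀).symm (Metric.ball (extChartAt (𝓡 3) x₀ x₀) r))
    {X : VecField 3 M} (hX : ∀ y, SmoothAt X y) {S : Set M} (hS : IsCompact S)
    (hsub : S ⊆ (extChartAt (𝓡 3) x₀).source)
    (hsub' : ∀ y ∈ S, extChartAt (𝓡 3) x₀ y ∈ Metric.ball (extChartAt (𝓡 3) x₀ x₀) r)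
    (h0 : ∀ y ∉ S, X y = 0) {φ : M → ℝ} {K : NNReal} (hφ : LipschitzWith K φ) :
    |∫ y, φ y * divergence X y ∂(riemannianMeasure 3 M)| ≤
      K * ∫ y, ‖X y‖ ∂(riemannianMeasure 3 M) := by
  set e := extChartAt (𝓡 3) x₀
  have hcontdiv : Continuous (divergence X) := continuous_iff_continuousAt.2 fun y =>
    (funSmoothAt_divergence (hX y)).continuousAt
  have hdiv0 : ∀ y ∉ S, divergence X y = 0 := fun y hy => divergence_eq_zero hS h0 (hX y).diffAt hy
  have hcontX : Continuous fun y => ‖X y‖ := continuous_iff_continuousAt.2 fun y =>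
    (hX y).continuousAt_norm
  -- `φ` is Lipschitz in the chart only near the support of `X`, so it is extended to a Lipschitz
  -- function `g` on the whole space
  obtain ⟨g, hg, hgφ⟩ := (hφ.comp_lipschitzOnWith hLip).extend_real
  let E : Fin 3 → EuclideanSpace ℝ (Fin 3) := fun i => EuclideanSpace.single i 1
  let G : Fin 3 → EuclideanSpace ℝ (Fin 3) → ℝ := fun i =>
    pullChart 3 x₀ fun w => coordDensity (n := 3) x₀ w * coordComp x₀ X i w
  have hG0 : ∀ i, ∀ y ∉ S, coordDensity (n := 3) x₀ y * coordComp x₀ X i y = 0 := fun i y hy => by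
    simp [coordComp, h0 y hy]
  have hGs : ∀ i, ∀ y ∈ e.source, FunSmoothAt (n := 3)
      (fun w => coordDensity (n := 3) x₀ w * coordComp x₀ X i w) y := fun i y hy =>
    (funSmoothAt_coordDensity o hy).mul (funSmoothAt_coordComp hy (hX y) i)
  have hGsm : ∀ i, ContDiff ℝ ∞ (G i) := fun i => contDiff_pullChart hS hsub (hG0 i) (hGs i)
  have hGc : ∀ i, HasCompactSupport (G i) := fun i => hasCompactSupport_pullChart hS hsub (hG0 i)
  have hGlip : ∀ i, ∃ D, LipschitzWith D (G i) := fun i =>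
    (hGsm i).lipschitzWith_of_hasCompactSupport (hGc i) (by simp)
  let H : EuclideanSpace ℝ (Fin 3) → ℝ :=
    pullChart 3 x₀ fun w => coordDensity (n := 3) x₀ w * ‖X w‖
  have hH0 : ∀ y ∉ S, coordDensity (n := 3) x₀ y * ‖X y‖ = 0 := fun y hy => by simp [h0 y hy]
  have hHcont : Continuous H := continuous_pullChart hS hsub hH0 fun y hy =>
    (continuousAt_coordDensity hy).mul (hX y).continuousAt_norm
  have hHint : Integrable H :=
    hHcont.integrable_of_hasCompactSupport (hasCompactSupport_pullChart hS hsub hH0)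
  have hHnn : ∀ z, 0 ≤ H z := fun z => indicator_nonneg
    (fun w _ => mul_nonneg (Real.sqrt_nonneg _) (norm_nonneg _)) z
  have hHeq : ∫ z, H z = ∫ y, ‖X y‖ ∂(riemannianMeasure 3 M) := by
    rw [integral_eq_integral_target x₀ hcontX.aestronglyMeasurable fun y hy => by
      rw [h0 y fun h => hy (hsub h), norm_zero]]
    refine (integral_indicator (measurableSet_target x₀)).trans ?_
    refine setIntegral_congr_fun (measurableSet_target x₀) fun z hz => ?_
    simp only [Function.comp, chartDensity_eq hz]
  -- the divergence in the chart
  have hsum : ∀ z ∈ e.target, coordDensity (n := 3) x₀ (e.symm z) * divergence X (e.symm z) =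
      ∑ i, lineDeriv ℝ (G i) z (E i) := by
    intro z hz
    rw [coordDensity_mul_divergence o (e.map_target hz) (hX _)]
    refine Finset.sum_congr rfl fun i _ => ?_
    have h1 := (hasFDerivAt_comp_extChartAt_symm hz
      (hGs i _ (e.map_target hz)).diff).congr_of_eventuallyEq (pullChart_eventuallyEq hz)
    exact (h1.hasLineDerivAt (E i)).lineDeriv.symm
  have hmain : ∫ y, φ y * divergence X y ∂(riemannianMeasure 3 M) =
      ∫ z, ∑ i, lineDeriv ℝ (G i) z (E i) * g z := by
    rw [integral_eq_integral_target (n := 3) (h := fun y => φ y * divergence X y) x₀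
      (hφ.continuous.mul hcontdiv).aestronglyMeasurable fun y hy => by
        rw [hdiv0 y fun h => hy (hsub h), mul_zero]]
    refine Eq.trans ?_ (setIntegral_eq_integral_of_forall_compl_eq_zero (s := e.target) ?_)
    · refine setIntegral_congr_fun (measurableSet_target x₀) fun z hz => ?_
      have h1 := hsum z hz
      change chartDensity x₀ z * (φ (e.symm z) * divergence X (e.symm z)) = _
      rw [chartDensity_eq hz, ← Finset.sum_mul, ← h1]
      by_cases hzS : e.symm z ∈ S
      · have h2 := hsub' _ hzS
        rw [e.right_inv hz] at h2
        rw [← hgφ h2, Function.comp]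
        ring
      · rw [hdiv0 _ hzS]
        ring
    · intro z hz
      refine Finset.sum_eq_zero fun i _ => ?_
      have h1 : G i =ᶠ[𝓝 z] 0 := pullChart_eventuallyEq_zero hS hsub (hG0 i) (by
        rintro ⟨y, hy, rfl⟩
        exact hz (e.map_source (hsub hy)))
      rw [h1.lineDeriv_eq]
      simp [lineDeriv]
  have hint1 : ∀ i, Integrable fun z => lineDeriv ℝ (G i) z (E i) * g z := fun i => by
    have h1 : (fun z => lineDeriv ℝ (G i) z (E i)) = fun z => fderiv ℝ (G i) z (E i) :=
      funext fun z => ((hGsm i).differentiable (by simp) z).lineDeriv_eq_fderiv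
    have h2 : Continuous fun z => fderiv ℝ (G i) z (E i) :=
      ((hGsm i).continuous_fderiv (by simp)).clm_apply continuous_const
    rw [← h1] at h2
    refine (h2.mul hg.continuous).integrable_of_hasCompactSupport
      (HasCompactSupport.mul_right ?_)
    rw [h1]
    exact (hGc i).fderiv_apply ℝ _
  have hint2 : ∀ i, Integrable fun z => lineDeriv ℝ g z (-E i) * G i z := fun i => by
    obtain ⟨D, hD⟩ := hGlip i
    exact ((hGsm i).continuous.integrable_of_hasCompactSupport (hGc i)).bdd_mul
      (aestronglyMeasurable_lineDeriv hg.continuous volume)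
      (Eventually.of_forall fun z => norm_lineDeriv_le_of_lipschitz ℝ hg)
  have hparts : ∫ z, ∑ i, lineDeriv ℝ (G i) z (E i) * g z =
      ∫ z, ∑ i, lineDeriv ℝ g z (-E i) * G i z := by
    rw [integral_finsetSum _ fun i _ => hint1 i, integral_finsetSum _ fun i _ => hint2 i]
    refine Finset.sum_congr rfl fun i _ => ?_
    obtain ⟨D, hD⟩ := hGlip i
    rw [hg.integral_lineDeriv_mul_eq hD (hGc i), neg_neg]
  rw [hmain, hparts, ← hHeq, ← integral_const_mul, ← Real.norm_eq_abs]
  refine norm_integral_le_of_norm_le (hHint.const_mul _) ?_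
  filter_upwards [hg.ae_differentiableAt (μ := volume)] with z hzd
  by_cases hzS : z ∈ e '' S
  · obtain ⟨y, hy, rfl⟩ := hzS
    have hy' := hsub hy
    have hz := e.map_source hy'
    have hGv : ∀ i, G i (e y) = coordDensity (n := 3) x₀ y * coordComp x₀ X i y := fun i => by
      rw [show G i (e y) = _ from pullChart_of_mem hz, e.left_inv hy']
    have hHv : H (e y) = coordDensity (n := 3) x₀ y * ‖X y‖ := by
      rw [show H (e y) = _ from pullChart_of_mem hz, e.left_inv hy']
    have h2 : ∑ i, lineDeriv ℝ g (e y) (-E i) * G i (e y) =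
        -(coordDensity (n := 3) x₀ y * fderiv ℝ g (e y) (chartDeriv x₀ y (X y))) := by
      have h3 : chartDeriv x₀ y (X y) = ∑ i, coordComp x₀ X i y • E i := by
        conv_lhs => rw [← (EuclideanSpace.basisFun (Fin 3) ℝ).sum_repr (chartDeriv x₀ y (X y))]
        simp [coordComp, E]
      rw [h3, map_sum, Finset.mul_sum, ← Finset.sum_neg_distrib]
      refine Finset.sum_congr rfl fun i _ => ?_
      rw [hzd.lineDeriv_eq_fderiv, hGv, map_neg, map_smul, smul_eq_mul]
      ring
    have h4 := abs_fderiv_le_of_lipschitz hφ hz (g := g) (z := e y) (by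
      filter_upwards [Metric.isOpen_ball.mem_nhds (hsub' y hy)] with w hw using (hgφ hw).symm)
      hzd (chartDeriv x₀ y (X y))
    rw [e.left_inv hy', coordMap_chartDeriv hy'] at h4
    rw [h2, norm_neg, norm_mul,
      show ‖coordDensity (n := 3) x₀ y‖ = _ from Real.norm_of_nonneg (Real.sqrt_nonneg _), hHv,
      Real.norm_eq_abs]
    calc coordDensity (n := 3) x₀ y * |fderiv ℝ g (e y) (chartDeriv x₀ y (X y))|
        ≤ coordDensity (n := 3) x₀ y * (K * ‖X y‖) :=
          mul_le_mul_of_nonneg_left h4 (Real.sqrt_nonneg _)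
      _ = K * (coordDensity (n := 3) x₀ y * ‖X y‖) := mul_left_comm _ _ _
  · have h2 : ∑ i, lineDeriv ℝ g z (-E i) * G i z = 0 := Finset.sum_eq_zero fun i _ => by
      rw [show G i z = 0 from pullChart_eq_zero (hG0 i) hzS, mul_zero]
    rw [h2, norm_zero]
    exact mul_nonneg K.2 (hHnn z)

end LocalInequality

/-! ### Gaffney's theorem -/

section Gaffney

variable {M : Type*} [MetricSpace M] [SecondCountableTopology M]
  [ChartedSpace (EuclideanSpace ℝ (Fin 3)) M]
  [IsManifold (𝓡 3) ∞ M] [RiemannianBundle (fun x : M => TangentSpace (𝓡 3) x)]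
  [IsContMDiffRiemannianBundle (𝓡 3) ∞ (EuclideanSpace ℝ (Fin 3))
    (fun x : M => TangentSpace (𝓡 3) x)]
  [IsRiemannianManifold (𝓡 3) M] [MeasurableSpace M] [BorelSpace M]

theorem continuous_norm_of_smooth {X : VecField 3 M} (hX : ∀ y, SmoothAt X y) :
    Continuous fun y => ‖X y‖ :=
  continuous_iff_continuousAt.2 fun y => (hX y).continuousAt_norm

theorem continuous_divergence {X : VecField 3 M} (hX : ∀ y, SmoothAt X y) :
    Continuous (divergence X) :=
  continuous_iff_continuousAt.2 fun y => (funSmoothAt_divergence (hX y)).continuousAt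

/-- Integration by parts against a compactly supported Lipschitz function, by a partition of
unity. -/
theorem abs_integral_mul_divergence_le (o : ManifoldOrientation M)
    {X : VecField 3 M} (hX : ∀ y, SmoothAt X y)
    (hint : Integrable (fun y => ‖X y‖) (riemannianMeasure 3 M)) {φ : M → ℝ} {K : NNReal}
    (hφ : LipschitzWith K φ) (hc : HasCompactSupport φ) :
    |∫ y, φ y * divergence X y ∂(riemannianMeasure 3 M)| ≤
      K * ∫ y, ‖X y‖ ∂(riemannianMeasure 3 M) := by
  classical
  have : LocallyCompactSpace M := ChartedSpace.locallyCompactSpace (EuclideanSpace ℝ (Fin 3)) M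
  choose r hr C hball hLip using fun x₀ : M => exists_lipschitzOnWith_extChartAt_symm (n := 3) x₀
  let U : M → Set M := fun x => (extChartAt (𝓡 3) x).source ∩
    extChartAt (𝓡 3) x ⁻¹' Metric.ball (extChartAt (𝓡 3) x x) (r x / 2)
  have hUo : ∀ x, IsOpen (U x) := fun x =>
    (continuousOn_extChartAt x).isOpen_inter_preimage (isOpen_extChartAt_source x)
      Metric.isOpen_ball
  obtain ⟨ρ, hρ⟩ := SmoothPartitionOfUnity.exists_isSubordinate (𝓡 3) isClosed_univ U hUo
    (fun x _ => mem_iUnion_of_mem x ⟨mem_extChartAt_source x,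
      Metric.mem_ball_self (half_pos (hr x))⟩)
  have hScomp : ∀ i, IsCompact (tsupport (ρ i)) := fun i => by
    have hsub : Metric.closedBall (extChartAt (𝓡 3) i i) (r i / 2) ⊆ (extChartAt (𝓡 3) i).target :=
      (Metric.closedBall_subset_ball (half_lt_self (hr i))).trans (hball i)
    refine ((isCompact_closedBall (extChartAt (𝓡 3) i i) (r i / 2)).image_of_continuousOn
      ((continuousOn_extChartAt_symm i).mono hsub)).of_isClosed_subset (isClosed_tsupport _)
      fun y hy => ?_
    obtain ⟨h1, h2⟩ := hρ i hy
    exact ⟨_, Metric.ball_subset_closedBall h2, (extChartAt (𝓡 3) i).left_inv h1⟩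
  have hρs : ∀ i y, FunSmoothAt (n := 3) (ρ i) y := fun i y => (ρ i).contMDiff.contMDiffAt
  have hY : ∀ i y, SmoothAt (fun w => ρ i w • X w) y := fun i y => SmoothAt.smul (hρs i y) (hX y)
  have hfin := ρ.locallyFinite'.finite_nonempty_inter_compact hc
  let F : Finset M := hfin.toFinset
  have hF : ∀ w, φ w ≠ 0 → ∑ i ∈ F, ρ i w = 1 := fun w hw => by
    refine ρ.sum_finsupport' w (mem_univ w) fun i hi => ?_
    rw [Finite.mem_toFinset]
    exact ⟨w, (ρ.mem_finsupport w).1 hi, subset_tsupport _ hw⟩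
  have hpt : ∀ y, φ y * divergence X y =
      ∑ i ∈ F, φ y * divergence (fun w => ρ i w • X w) y := fun y => by
    by_cases hy : φ y = 0
    · simp [hy]
    rw [← Finset.mul_sum, ← divergence_sum fun i _ => (hY i y).diffAt]
    congr 1
    refine divergence_congr (SmoothAt.sum fun i _ => hY i y).diffAt ?_
    filter_upwards [(hφ.continuous.isOpen_preimage _ isOpen_ne).mem_nhds hy] with w hw
    rw [← Finset.sum_smul, hF w hw, one_smul]
  have hI1 : ∀ i, Integrable (fun y => φ y * divergence (fun w => ρ i w • X w) y)
      (riemannianMeasure 3 M) := fun i =>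
    (hφ.continuous.mul (continuous_divergence (hY i))).integrable_of_hasCompactSupport hc.mul_right
  have hnorm : ∀ i y, ‖ρ i y • X y‖ = ρ i y * ‖X y‖ := fun i y => by
    rw [norm_smul, Real.norm_of_nonneg (ρ.nonneg i y)]
  have hI2 : ∀ i, Integrable (fun y => ‖ρ i y • X y‖) (riemannianMeasure 3 M) := fun i => by
    refine (continuous_norm_of_smooth (hY i)).integrable_of_hasCompactSupport
      (HasCompactSupport.intro (hScomp i) fun y hy => ?_)
    rw [hnorm, image_eq_zero_of_notMem_tsupport hy, zero_mul]
  simp only [hpt]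
  rw [integral_finsetSum _ fun i _ => hI1 i]
  calc |∑ i ∈ F, ∫ y, φ y * divergence (fun w => ρ i w • X w) y ∂(riemannianMeasure 3 M)|
      ≤ ∑ i ∈ F, |∫ y, φ y * divergence (fun w => ρ i w • X w) y ∂(riemannianMeasure 3 M)| :=
        Finset.abs_sum_le_sum_abs _ _
    _ ≤ ∑ i ∈ F, K * ∫ y, ‖ρ i y • X y‖ ∂(riemannianMeasure 3 M) := by
        refine Finset.sum_le_sum fun i _ => ?_
        refine abs_integral_mul_divergence_le_of_chart o (hLip i) (hY i) (hScomp i)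
          (fun y hy => (hρ i hy).1) (fun y hy => ?_) (fun y hy => ?_) hφ
        · exact Metric.ball_subset_ball (half_le_self (hr i).le) (hρ i hy).2
        · simp only [image_eq_zero_of_notMem_tsupport hy, zero_smul]
    _ = K * ∫ y, ∑ i ∈ F, ‖ρ i y • X y‖ ∂(riemannianMeasure 3 M) := by
        rw [integral_finsetSum _ fun i _ => hI2 i, Finset.mul_sum]
    _ ≤ K * ∫ y, ‖X y‖ ∂(riemannianMeasure 3 M) := by
        refine mul_le_mul_of_nonneg_left (integral_mono (integrable_finsetSum _ fun i _ => hI2 i)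
          hint fun y => ?_) K.2
        simp only [hnorm, ← Finset.sum_mul]
        refine mul_le_of_le_one_left (norm_nonneg _) ?_
        have h1 : ∑ᶠ i, ρ i y = 1 := ρ.sum_eq_one (mem_univ y)
        rw [finsum_eq_sum_of_support_subset (s := ρ.finsupport y ∪ F) _ (by
          rw [Finset.coe_union, SmoothPartitionOfUnity.coe_finsupport]
          exact subset_union_left)] at h1
        rw [← h1]
        exact Finset.sum_le_sum_of_subset_of_nonneg Finset.subset_union_right
          fun i _ _ => ρ.nonneg i y

/-- Gaffney's theorem: on a complete Riemannian manifold the divergence of an integrable vector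
field with integrable divergence has integral zero. -/
theorem integral_divergence_eq_zero [CompleteSpace M] (o : ManifoldOrientation M)
    {X : VecField 3 M} (hX : ∀ y, SmoothAt X y)
    (hint : Integrable (fun y => ‖X y‖) (riemannianMeasure 3 M))
    (hdiv : Integrable (divergence X) (riemannianMeasure 3 M)) :
    ∫ y, divergence X y ∂(riemannianMeasure 3 M) = 0 := by
  have : ProperSpace M := properSpace_of_isRiemannianManifold 3
  rcases isEmpty_or_nonempty M with hM | ⟨⟨x₀⟩⟩
  · rw [Measure.eq_zero_of_isEmpty (riemannianMeasure 3 M), integral_zero_measure]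
  have h1 : Tendsto (fun k => ∫ y, cutoff x₀ k y * divergence X y ∂(riemannianMeasure 3 M)) atTop
      (𝓝 (∫ y, divergence X y ∂(riemannianMeasure 3 M))) := by
    refine tendsto_integral_of_dominated_convergence (fun y => ‖divergence X y‖) (fun k => ?_)
      hdiv.norm (fun k => Eventually.of_forall fun y => ?_) (Eventually.of_forall fun y => ?_)
    · exact ((lipschitzWith_cutoff x₀ k).continuous.mul
        (continuous_divergence hX)).aestronglyMeasurable
    · obtain ⟨h0, h1⟩ := cutoff_mem x₀ k y
      rw [norm_mul, Real.norm_of_nonneg h0]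
      exact mul_le_of_le_one_left (norm_nonneg _) h1
    · simpa using (tendsto_cutoff x₀ y).mul_const (divergence X y)
  have h2 : Tendsto (fun k => ∫ y, cutoff x₀ k y * divergence X y ∂(riemannianMeasure 3 M)) atTop
      (𝓝 0) := by
    refine squeeze_zero_norm (fun k => (abs_integral_mul_divergence_le o hX hint
      (lipschitzWith_cutoff x₀ k) (hasCompactSupport_cutoff x₀ k))) ?_
    have := (tendsto_one_div_add_atTop_nhds_zero_nat (𝕜 := ℝ)).mul_const
      (∫ y, ‖X y‖ ∂(riemannianMeasure 3 M))
    simpa using this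
  exact tendsto_nhds_unique h1 h2

end Gaffney

/-! ### Pointwise bounds -/

section Bounds

variable {M : Type*} [TopologicalSpace M] [ChartedSpace (EuclideanSpace ℝ (Fin 3)) M]
  [IsManifold (𝓡 3) ∞ M] [RiemannianBundle (fun x : M => TangentSpace (𝓡 3) x)]
  [IsContMDiffRiemannianBundle (𝓡 3) ∞ (EuclideanSpace ℝ (Fin 3))
    (fun x : M => TangentSpace (𝓡 3) x)]

theorem norm_cross_le (o : ManifoldOrientation M) {x : M} (a b : TangentSpace (𝓡 3) x) :
    ‖cross o x a b‖ ≤ ‖a‖ * ‖b‖ := by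
  refine abs_le_of_sq_le_sq' ?_ (by positivity) |>.2
  rw [← real_inner_self_eq_norm_sq, inner_cross_cross, real_inner_self_eq_norm_sq,
    real_inner_self_eq_norm_sq, real_inner_comm a b]
  nlinarith [sq_nonneg (inner ℝ a b : ℝ)]

theorem sq_sum_norm_leviCivita_le (A : VecField 3 M) (x : M) :
    (∑ i, ‖leviCivita A x (frame x i)‖) ^ 2 ≤ 3 * normSqCov A x := by
  simpa [normSqCov] using sq_sum_le_card_mul_sum_sq (s := Finset.univ)
    (f := fun i => ‖leviCivita A x (frame x i)‖)

theorem sq_sum_norm_secondCov_le (A : VecField 3 M) (x : M) (i : Fin 3) :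
    (∑ j, ‖secondCov A x (frame x i) (frame x j)‖) ^ 2 ≤
      3 * ∑ j, ‖secondCov A x (frame x i) (frame x j)‖ ^ 2 := by
  simpa using sq_sum_le_card_mul_sum_sq (s := Finset.univ)
    (f := fun j => ‖secondCov A x (frame x i) (frame x j)‖)

theorem sq_sum_sum_norm_secondCov_le (A : VecField 3 M) (x : M) :
    (∑ i, ∑ j, ‖secondCov A x (frame x i) (frame x j)‖) ^ 2 ≤ 9 * normSqSecondCov A x := by
  have h := sq_sum_le_card_mul_sum_sq (s := Finset.univ)
    (f := fun i : Fin 3 => ∑ j, ‖secondCov A x (frame x i) (frame x j)‖)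
  refine h.trans ?_
  have := Finset.sum_le_sum fun i (_ : i ∈ (Finset.univ : Finset (Fin 3))) =>
    sq_sum_norm_secondCov_le A x i
  rw [← Finset.mul_sum] at this
  simp only [Finset.card_univ, Fintype.card_fin, normSqSecondCov]
  push_cast
  linarith

theorem norm_frame (x : M) (i : Fin 3) : ‖frame (n := 3) x i‖ = 1 := (frame x).orthonormal.1 i

theorem norm_curl_le (o : ManifoldOrientation M) (A : VecField 3 M) (x : M) :
    ‖curl o A x‖ ≤ ∑ i, ‖leviCivita A x (frame x i)‖ :=
  (norm_sum_le _ _).trans (Finset.sum_le_sum fun i _ => (norm_cross_le o _ _).trans_eq (by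
    rw [norm_frame, one_mul]))

theorem sq_norm_curl_le (o : ManifoldOrientation M) (A : VecField 3 M) (x : M) :
    ‖curl o A x‖ ^ 2 ≤ 3 * normSqCov A x :=
  (pow_le_pow_left₀ (norm_nonneg _) (norm_curl_le o A x) 2).trans (sq_sum_norm_leviCivita_le A x)

theorem norm_leviCivita_curl_le (o : ManifoldOrientation M) {A : VecField 3 M} {x : M}
    (hA : SmoothAt A x) (i : Fin 3) : ‖leviCivita (curl o A) x (frame x i)‖ ≤
      ∑ j, ‖secondCov A x (frame x i) (frame x j)‖ := by
  rw [leviCivita_curl o hA]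
  exact (norm_sum_le _ _).trans (Finset.sum_le_sum fun j _ => (norm_cross_le o _ _).trans_eq (by
    rw [norm_frame, one_mul]))

theorem normSqCov_curl_le (o : ManifoldOrientation M) {A : VecField 3 M} {x : M}
    (hA : SmoothAt A x) : normSqCov (curl o A) x ≤ 3 * normSqSecondCov A x := by
  rw [normSqCov, normSqSecondCov, Finset.mul_sum]
  exact Finset.sum_le_sum fun i _ => (pow_le_pow_left₀ (norm_nonneg _)
    (norm_leviCivita_curl_le o hA i) 2).trans (sq_sum_norm_secondCov_le A x i)

theorem sq_norm_sum_secondCov_le (A : VecField 3 M) (x : M) :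
    ‖∑ i, secondCov A x (frame x i) (frame x i)‖ ^ 2 ≤ 9 * normSqSecondCov A x := by
  refine (pow_le_pow_left₀ (norm_nonneg _) ((norm_sum_le _ _).trans (Finset.sum_le_sum
    fun i _ => ?_)) 2).trans (sq_sum_sum_norm_secondCov_le A x)
  exact Finset.single_le_sum (f := fun j => ‖secondCov A x (frame x i) (frame x j)‖)
    (fun _ _ => norm_nonneg _) (Finset.mem_univ i)

theorem norm_leviCivita_apply_le (A : VecField 3 M) (x : M) (v : TangentSpace (𝓡 3) x) :
    ‖leviCivita A x v‖ ≤ ‖v‖ * ∑ i, ‖leviCivita A x (frame x i)‖ := by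
  conv_lhs => rw [← (frame x).sum_repr' v]
  rw [map_sum, Finset.mul_sum]
  refine (norm_sum_le _ _).trans (Finset.sum_le_sum fun i _ => ?_)
  rw [map_smul, norm_smul]
  refine mul_le_mul_of_nonneg_right ((norm_inner_le_norm _ _).trans_eq ?_) (norm_nonneg _)
  rw [norm_frame, one_mul]

theorem norm_contractCov_le (A B : VecField 3 M) (x : M) :
    ‖contractCov A B x‖ ≤ ‖A x‖ * ∑ i, ‖leviCivita B x (frame x i)‖ := by
  conv_lhs => rw [← (frame x).sum_repr' (contractCov A B x)]
  rw [Finset.mul_sum]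
  refine (norm_sum_le _ _).trans (Finset.sum_le_sum fun i _ => ?_)
  rw [norm_smul, norm_frame, mul_one, real_inner_comm, inner_contractCov]
  exact norm_inner_le_norm _ _

theorem normSqCov_nonneg (A : VecField 3 M) (x : M) : 0 ≤ normSqCov A x :=
  Finset.sum_nonneg fun _ _ => sq_nonneg _

theorem normSqSecondCov_nonneg (A : VecField 3 M) (x : M) : 0 ≤ normSqSecondCov A x :=
  Finset.sum_nonneg fun _ _ => Finset.sum_nonneg fun _ _ => sq_nonneg _

/-- The bilinear map `(v, w) ↦ ⟨∇_v A, ∇_w B⟩`. -/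
def innerCovBilin (A B : VecField 3 M) (x : M) :
    TangentSpace (𝓡 3) x →ₗ[ℝ] TangentSpace (𝓡 3) x →ₗ[ℝ] ℝ :=
  LinearMap.mk₂ ℝ (fun v w => inner ℝ (leviCivita A x v) (leviCivita B x w))
    (by simp [inner_add_left]) (by simp [inner_smul_left]) (by simp [inner_add_right])
    (by simp [inner_smul_right])

theorem funSmoothAt_sum_inner_leviCivita {A B : VecField 3 M} {x : M} (hA : SmoothAt A x)
    (hB : SmoothAt B x) : FunSmoothAt (n := 3) (fun y =>
      ∑ i, (inner ℝ (leviCivita A y (frame y i)) (leviCivita B y (frame y i)) : ℝ)) x := by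
  obtain ⟨E, hE⟩ := exists_isFrameAt (n := 3) x
  have h : FunSmoothAt (n := 3) (fun y =>
      ∑ i, (inner ℝ (leviCivita A y (E i y)) (leviCivita B y (E i y)) : ℝ)) x := by
    refine ContMDiffAt.sum fun i _ => ?_
    exact (smoothAt_leviCivita hA (hE.smooth i)).inner (smoothAt_leviCivita hB (hE.smooth i))
  refine h.congr_of_eventuallyEq ?_
  filter_upwards [hE.orthonormal] with y hy
  have := sum_bilin_eq (innerCovBilin A B y) (frame y) (basisOfOrthonormal hy)
  simpa only [basisOfOrthonormal_apply, innerCovBilin, LinearMap.mk₂_apply] using this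

theorem curl_sub (o : ManifoldOrientation M) {A B : VecField 3 M} {x : M}
    (hA : DiffAt A x) (hB : DiffAt B x) :
    curl o (fun y => A y - B y) x = curl o A x - curl o B x := by
  simp only [curl, leviCivita_sub hA hB, sub_apply, map_sub, Finset.sum_sub_distrib]

theorem curl_const_smul (o : ManifoldOrientation M) (c : ℝ) {A : VecField 3 M} {x : M}
    (hA : DiffAt A x) : curl o (fun y => c • A y) x = c • curl o A x := by
  simp only [curl, leviCivita_const_smul c hA, smul_apply, map_smul, Finset.smul_sum]

/-- The convection term `∇_A A` of a vector field `A` pairs with its curl like half the gradient of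
`|A|²`, since the difference is `⟨curl A, curl A × A⟩ = 0`. -/
theorem inner_leviCivita_self_curl (o : ManifoldOrientation M) (A : VecField 3 M) (x : M) :
    (inner ℝ (leviCivita A x (curl o A x)) (A x) : ℝ) =
      inner ℝ (leviCivita A x (A x)) (curl o A x) := by
  have h := inner_curl_cross o A x (curl o A x) (A x)
  have h0 := inner_cross_swap o (curl o A x) (curl o A x) (A x)
  rw [real_inner_comm, inner_cross_rotate, inner_cross_rotate] at h
  linarith

theorem grad_inner_self {A : VecField 3 M} {x : M} (hA : DiffAt A x) :
    grad (n := 3) (fun y => (inner ℝ (A y) (A y) : ℝ)) x = (2 : ℝ) • contractCov A A x := by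
  refine ext_inner_right ℝ fun z => ?_
  rw [inner_grad, mvfderiv_inner hA hA, inner_smul_left, inner_contractCov,
    real_inner_comm (A x) (leviCivita A x z)]
  simp
  ring

end Bounds

/-! ### Square integrable vector fields with square integrable curl -/

section SquareIntegrable

variable {M : Type*} [MetricSpace M] [SecondCountableTopology M]
  [ChartedSpace (EuclideanSpace ℝ (Fin 3)) M]
  [IsManifold (𝓡 3) ∞ M] [RiemannianBundle (fun x : M => TangentSpace (𝓡 3) x)]
  [IsContMDiffRiemannianBundle (𝓡 3) ∞ (EuclideanSpace ℝ (Fin 3))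
    (fun x : M => TangentSpace (𝓡 3) x)]
  [IsRiemannianManifold (𝓡 3) M] [MeasurableSpace M] [BorelSpace M]

/-- Domination by a function with finite integral, which need not be measurable. -/
theorem integrable_of_abs_le {f g : M → ℝ} {C : ℝ} (hf : Continuous f)
    (hg : ∫⁻ x, ENNReal.ofReal (g x) ∂(riemannianMeasure 3 M) < ⊤) (hC : 0 ≤ C)
    (h : ∀ x, |f x| ≤ C * g x) : Integrable f (riemannianMeasure 3 M) := by
  refine ⟨hf.aestronglyMeasurable, ?_⟩
  refine lt_of_le_of_lt (b := ∫⁻ x, ENNReal.ofReal C * ENNReal.ofReal (g x)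
    ∂(riemannianMeasure 3 M)) (lintegral_mono fun x => ?_) ?_
  · rw [← ENNReal.ofReal_mul hC, ← ofReal_norm, Real.norm_eq_abs]
    exact ENNReal.ofReal_le_ofReal (h x)
  · rw [lintegral_const_mul' _ _ ENNReal.ofReal_ne_top]
    exact ENNReal.mul_lt_top ENNReal.ofReal_lt_top hg

/-- Smooth square integrable vector fields. -/
structure IsSmoothL2 (X : VecField 3 M) : Prop where
  smooth : ∀ x, SmoothAt X x
  memLp : MemLp (fun x => ‖X x‖) 2 (riemannianMeasure 3 M)

theorem isSmoothL2_of_le {X : VecField 3 M} (hX : ∀ x, SmoothAt X x) {g : M → ℝ} {C : ℝ}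
    (hg : ∫⁻ x, ENNReal.ofReal (g x) ∂(riemannianMeasure 3 M) < ⊤) (hC : 0 ≤ C)
    (h : ∀ x, ‖X x‖ ^ 2 ≤ C * g x) : IsSmoothL2 X where
  smooth := hX
  memLp := by
    have hc := continuous_norm_of_smooth hX
    rw [memLp_two_iff_integrable_sq hc.aestronglyMeasurable]
    exact integrable_of_abs_le (hc.pow 2) hg hC fun x => by
      rw [abs_of_nonneg (by positivity)]
      exact h x

theorem integral_sq_norm_le_of_le {X : VecField 3 M} (hX : ∀ x, SmoothAt X x) {g : M → ℝ} {C : ℝ}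
    (hg : ∫⁻ x, ENNReal.ofReal (g x) ∂(riemannianMeasure 3 M) < ⊤) (hC : 0 ≤ C)
    (h : ∀ x, ‖X x‖ ^ 2 ≤ C * g x) : ∫ x, ‖X x‖ ^ 2 ∂(riemannianMeasure 3 M) ≤
      C * (∫⁻ x, ENNReal.ofReal (g x) ∂(riemannianMeasure 3 M)).toReal := by
  conv_rhs => rw [← ENNReal.toReal_ofReal hC]
  rw [integral_eq_lintegral_of_nonneg_ae (Eventually.of_forall fun x => sq_nonneg _)
    ((continuous_norm_of_smooth hX).pow 2).aestronglyMeasurable, ← ENNReal.toReal_mul,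
    ← lintegral_const_mul' _ _ ENNReal.ofReal_ne_top]
  refine ENNReal.toReal_mono ?_ (lintegral_mono fun x => ?_)
  · rw [lintegral_const_mul' _ _ ENNReal.ofReal_ne_top]
    exact (ENNReal.mul_lt_top ENNReal.ofReal_lt_top hg).ne
  · rw [← ENNReal.ofReal_mul hC]
    exact ENNReal.ofReal_le_ofReal (h x)

namespace IsSmoothL2

theorem of_norm_le {X Y : VecField 3 M} (hX : ∀ x, SmoothAt X x) (hY : IsSmoothL2 Y) (C : ℝ)
    (h : ∀ x, ‖X x‖ ≤ C * ‖Y x‖) : IsSmoothL2 X where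
  smooth := hX
  memLp := MemLp.of_le_mul hY.memLp (continuous_norm_of_smooth hX).aestronglyMeasurable
    (Eventually.of_forall fun x => by simpa using h x)

theorem sub {X Y : VecField 3 M} (hX : IsSmoothL2 X) (hY : IsSmoothL2 Y) :
    IsSmoothL2 (fun x => X x - Y x) where
  smooth x := (hX.smooth x).sub (hY.smooth x)
  memLp := by
    refine (hX.memLp.add hY.memLp).of_le
      (continuous_norm_of_smooth fun x => (hX.smooth x).sub (hY.smooth x)).aestronglyMeasurable
      (Eventually.of_forall fun x => ?_)
    simp only [Pi.add_apply, norm_norm]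
    rw [Real.norm_of_nonneg (by positivity)]
    exact norm_sub_le _ _

theorem const_smul (c : ℝ) {X : VecField 3 M} (hX : IsSmoothL2 X) :
    IsSmoothL2 (fun x => c • X x) :=
  of_norm_le (fun x => (hX.smooth x).const_smul c) hX ‖c‖ fun _ => norm_smul_le _ _

theorem integrable_norm_mul {X Y : VecField 3 M} (hX : IsSmoothL2 X) (hY : IsSmoothL2 Y) :
    Integrable (fun x => ‖X x‖ * ‖Y x‖) (riemannianMeasure 3 M) :=
  hX.memLp.integrable_mul hY.memLp

theorem integrable_inner {X Y : VecField 3 M} (hX : IsSmoothL2 X) (hY : IsSmoothL2 Y) :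
    Integrable (fun x => (inner ℝ (X x) (Y x) : ℝ)) (riemannianMeasure 3 M) := by
  refine (hX.integrable_norm_mul hY).mono' (continuous_iff_continuousAt.2 fun x =>
    ((hX.smooth x).inner (hY.smooth x)).continuousAt).aestronglyMeasurable
    (Eventually.of_forall fun x => norm_inner_le_norm _ _)

theorem abs_integral_inner_le {X Y : VecField 3 M} (hX : IsSmoothL2 X) (hY : IsSmoothL2 Y) :
    |∫ x, (inner ℝ (X x) (Y x) : ℝ) ∂(riemannianMeasure 3 M)| ≤
      √(∫ x, ‖X x‖ ^ 2 ∂(riemannianMeasure 3 M)) * √(∫ x, ‖Y x‖ ^ 2 ∂(riemannianMeasure 3 M)) := by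
  have h1 : |∫ x, (inner ℝ (X x) (Y x) : ℝ) ∂(riemannianMeasure 3 M)| ≤
      ∫ x, ‖X x‖ * ‖Y x‖ ∂(riemannianMeasure 3 M) :=
    norm_integral_le_of_norm_le (f := fun x => (inner ℝ (X x) (Y x) : ℝ))
      (hX.integrable_norm_mul hY) (Eventually.of_forall fun x => norm_inner_le_norm _ _)
  have h2 := integral_mul_le_Lp_mul_Lq_of_nonneg (μ := riemannianMeasure 3 M)
    (f := fun x => ‖X x‖) (g := fun x => ‖Y x‖) Real.HolderConjugate.two_two
    (Eventually.of_forall fun x => norm_nonneg _) (Eventually.of_forall fun x => norm_nonneg _)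
    (by simpa using hX.memLp) (by simpa using hY.memLp)
  simp only [Real.rpow_two, ← Real.sqrt_eq_rpow] at h2
  exact h1.trans h2

end IsSmoothL2

/-- Smooth square integrable vector fields with square integrable curl. -/
structure IsCurlL2 (o : ManifoldOrientation M) (X : VecField 3 M) : Prop where
  field : IsSmoothL2 X
  curl : IsSmoothL2 (curl o X)

/-- The pairing `∫ ⟨curl X, Y⟩`; the helicity of `X` is the value at `(X, X)`. -/
def curlPairing (o : ManifoldOrientation M) (X Y : VecField 3 M) : ℝ :=
  ∫ x, (inner ℝ (curl o X x) (Y x) : ℝ) ∂(riemannianMeasure 3 M)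

namespace IsCurlL2

variable {o : ManifoldOrientation M}

theorem sub {X Y : VecField 3 M} (hX : IsCurlL2 o X) (hY : IsCurlL2 o Y) :
    IsCurlL2 o (fun x => X x - Y x) where
  field := hX.field.sub hY.field
  curl := by
    have : HelicityNS.curl o (fun x => X x - Y x) =
        fun x => HelicityNS.curl o X x - HelicityNS.curl o Y x :=
      funext fun x => curl_sub o (hX.field.smooth x).diffAt (hY.field.smooth x).diffAt
    rw [this]
    exact hX.curl.sub hY.curl

theorem const_smul (c : ℝ) {X : VecField 3 M} (hX : IsCurlL2 o X) :
    IsCurlL2 o (fun x => c • X x) where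
  field := hX.field.const_smul c
  curl := by
    have : HelicityNS.curl o (fun x => c • X x) = fun x => c • HelicityNS.curl o X x :=
      funext fun x => curl_const_smul o c (hX.field.smooth x).diffAt
    rw [this]
    exact hX.curl.const_smul c

theorem of_grad {f : M → ℝ} (hf : ∀ x, FunSmoothAt (n := 3) f x)
    (h : IsSmoothL2 (grad (n := 3) f)) : IsCurlL2 o (grad (n := 3) f) where
  field := h
  curl := by
    have : HelicityNS.curl o (grad (n := 3) f) = fun x => (0 : ℝ) • grad (n := 3) f x :=
      funext fun x => by rw [curl_grad o (hf x), zero_smul]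
    rw [this]
    exact h.const_smul 0

theorem of_sobolevSqOne {X : VecField 3 M} (hX : ∀ x, SmoothAt X x) (h : sobolevSqOne X < ⊤) :
    IsCurlL2 o X where
  field := isSmoothL2_of_le hX h zero_le_one fun x => by
    linarith [normSqCov_nonneg X x]
  curl := isSmoothL2_of_le (fun x => smoothAt_curl o (hX x)) h zero_le_three fun x => by
    linarith [sq_norm_curl_le o X x, sq_nonneg ‖X x‖]

end IsCurlL2

theorem integral_sq_norm_le {X : VecField 3 M} (hX : ∀ x, SmoothAt X x) (h : sobolevSqOne X < ⊤) :
    ∫ x, ‖X x‖ ^ 2 ∂(riemannianMeasure 3 M) ≤ (sobolevSqOne X).toReal := by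
  rw [← one_mul (sobolevSqOne X).toReal]
  exact integral_sq_norm_le_of_le hX h zero_le_one fun x => by linarith [normSqCov_nonneg X x]

theorem integral_sq_norm_curl_le (o : ManifoldOrientation M) {X : VecField 3 M}
    (hX : ∀ x, SmoothAt X x) (h : sobolevSqOne X < ⊤) :
    ∫ x, ‖curl o X x‖ ^ 2 ∂(riemannianMeasure 3 M) ≤ 3 * (sobolevSqOne X).toReal :=
  integral_sq_norm_le_of_le (fun x => smoothAt_curl o (hX x)) h zero_le_three fun x => by
    linarith [sq_norm_curl_le o X x, sq_nonneg ‖X x‖]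

section Pairing

variable {o : ManifoldOrientation M} {X Y Z : VecField 3 M}

theorem curlPairing_sub_left (hX : IsCurlL2 o X) (hY : IsCurlL2 o Y) (hZ : IsCurlL2 o Z) :
    curlPairing o (fun x => X x - Y x) Z = curlPairing o X Z - curlPairing o Y Z := by
  simp only [curlPairing]
  rw [← integral_sub (hX.curl.integrable_inner hZ.field) (hY.curl.integrable_inner hZ.field)]
  refine integral_congr_ae (Eventually.of_forall fun x => ?_)
  simp only
  rw [curl_sub o (hX.field.smooth x).diffAt (hY.field.smooth x).diffAt, inner_sub_left]

theorem curlPairing_const_smul_left (c : ℝ) (hX : IsCurlL2 o X) :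
    curlPairing o (fun x => c • X x) Z = c * curlPairing o X Z := by
  simp only [curlPairing]
  rw [← integral_const_mul]
  refine integral_congr_ae (Eventually.of_forall fun x => ?_)
  simp only
  rw [curl_const_smul o c (hX.field.smooth x).diffAt, inner_smul_left]
  rfl

theorem curlPairing_sub_right (hX : IsCurlL2 o X) (hY : IsCurlL2 o Y) (hZ : IsCurlL2 o Z) :
    curlPairing o X (fun x => Y x - Z x) = curlPairing o X Y - curlPairing o X Z := by
  simp only [curlPairing, inner_sub_right]
  exact integral_sub (hX.curl.integrable_inner hY.field) (hX.curl.integrable_inner hZ.field)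

theorem curlPairing_const_smul_right (c : ℝ) :
    curlPairing o X (fun x => c • Y x) = c * curlPairing o X Y := by
  simp only [curlPairing, inner_smul_right]
  exact integral_const_mul _ _

/-- The curl is symmetric: `⟨curl X, Y⟩ - ⟨X, curl Y⟩` is the divergence of `X × Y`. -/
theorem curlPairing_comm [CompleteSpace M] (hX : IsCurlL2 o X) (hY : IsCurlL2 o Y) :
    curlPairing o X Y = curlPairing o Y X := by
  have hs : ∀ x, SmoothAt (fun y => cross o y (X y) (Y y)) x := fun x =>
    smoothAt_cross o (hX.field.smooth x) (hY.field.smooth x)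
  have hd : divergence (fun y => cross o y (X y) (Y y)) =
      fun x => (inner ℝ (curl o X x) (Y x) : ℝ) - inner ℝ (curl o Y x) (X x) := funext fun x => by
    rw [divergence_cross o (hX.field.smooth x) (hY.field.smooth x),
      real_inner_comm (curl o Y x) (X x)]
  have h1 := hX.curl.integrable_inner hY.field
  have h2 := hY.curl.integrable_inner hX.field
  have h := integral_divergence_eq_zero o hs ((hX.field.integrable_norm_mul hY.field).mono'
    (continuous_norm_of_smooth hs).aestronglyMeasurable (Eventually.of_forall fun x => by
      simpa using norm_cross_le o (X x) (Y x))) (by rw [hd]; exact h1.sub h2)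
  rw [hd, integral_sub h1 h2, sub_eq_zero] at h
  exact h

/-- Gradients are orthogonal to curls, because `curl grad = 0`. -/
theorem curlPairing_grad [CompleteSpace M] {f : M → ℝ} (hX : IsCurlL2 o X)
    (hf : ∀ x, FunSmoothAt (n := 3) f x) (h : IsSmoothL2 (grad (n := 3) f)) :
    curlPairing o X (grad (n := 3) f) = 0 := by
  rw [curlPairing_comm hX (.of_grad hf h), curlPairing]
  simp only [fun x => curl_grad o (hf x), inner_zero_left, integral_zero]

theorem abs_curlPairing_le (hX : IsCurlL2 o X) (hY : IsCurlL2 o Y) :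
    |curlPairing o X Y| ≤ √(∫ x, ‖curl o X x‖ ^ 2 ∂(riemannianMeasure 3 M)) *
      √(∫ x, ‖Y x‖ ^ 2 ∂(riemannianMeasure 3 M)) :=
  hX.curl.abs_integral_inner_le hY.field

end Pairing

end SquareIntegrable

/-! ### The evolution of the helicity -/

section Helicity

variable {M : Type*} [MetricSpace M] [SecondCountableTopology M]
  [ChartedSpace (EuclideanSpace ℝ (Fin 3)) M]
  [IsManifold (𝓡 3) ∞ M] [RiemannianBundle (fun x : M => TangentSpace (𝓡 3) x)]
  [IsContMDiffRiemannianBundle (𝓡 3) ∞ (EuclideanSpace ℝ (Fin 3))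
    (fun x : M => TangentSpace (𝓡 3) x)]
  [IsRiemannianManifold (𝓡 3) M] [MeasurableSpace M] [BorelSpace M]

theorem sobolevSqOne_le_sobolevSqTwo (X : VecField 3 M) : sobolevSqOne X ≤ sobolevSqTwo X :=
  lintegral_mono fun x => ENNReal.ofReal_le_ofReal (le_add_of_nonneg_right
    (normSqSecondCov_nonneg X x))

theorem isSmoothL2_curl_curl (o : ManifoldOrientation M) {X : VecField 3 M}
    (hX : ∀ x, SmoothAt X x) (h : sobolevSqTwo X < ⊤) : IsSmoothL2 (curl o (curl o X)) :=
  isSmoothL2_of_le (fun x => smoothAt_curl o (smoothAt_curl o (hX x))) h (by norm_num : (0 : ℝ) ≤ 9)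
    fun x => by
      linarith [sq_norm_curl_le o (curl o X) x, normSqCov_curl_le o (hX x), sq_nonneg ‖X x‖,
        normSqCov_nonneg X x]

/-- The helicity `∫ ⟨curl v, v⟩` is a continuous symmetric quadratic form on `H¹`, so it is
differentiable along a curve which is differentiable in `H¹`. -/
theorem hasDerivAt_curlPairing [CompleteSpace M] (o : ManifoldOrientation M)
    {v : ℝ → VecField 3 M} {w : VecField 3 M} {t : ℝ} (hw : ∀ x, SmoothAt w x)
    (hvs : ∀ᶠ s in 𝓝 t, ∀ x, SmoothAt (v s) x) (hvf : ∀ᶠ s in 𝓝 t, sobolevSqOne (v s) < ⊤)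
    (hlim : Tendsto (fun h : ℝ => sobolevSqOne (h⁻¹ • (v (t + h) - v t) - w)) (𝓝[≠] 0) (𝓝 0)) :
    IsCurlL2 o w ∧
      HasDerivAt (fun s => curlPairing o (v s) (v s)) (2 * curlPairing o (v t) w) t := by
  -- the difference quotient and its distance from the derivative
  let d : ℝ → VecField 3 M := fun h x => h⁻¹ • (v (t + h) x - v t x)
  let r : ℝ → VecField 3 M := fun h x => d h x - w x
  have hv0 : IsCurlL2 o (v t) := .of_sobolevSqOne hvs.self_of_nhds hvf.self_of_nhds
  have htend : Tendsto (fun h : ℝ => t + h) (𝓝[≠] 0) (𝓝 t) := by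
    have : Tendsto (fun h : ℝ => t + h) (𝓝 0) (𝓝 (t + 0)) := tendsto_const_nhds.add tendsto_id
    rw [add_zero] at this
    exact this.mono_left nhdsWithin_le_nhds
  have hvh : ∀ᶠ h in 𝓝[≠] (0 : ℝ), IsCurlL2 o (v (t + h)) := by
    filter_upwards [htend.eventually hvs, htend.eventually hvf] with h h1 h2
      using .of_sobolevSqOne h1 h2
  have hd : ∀ᶠ h in 𝓝[≠] (0 : ℝ), IsCurlL2 o (d h) := by
    filter_upwards [hvh] with h h1 using (h1.sub hv0).const_smul _
  have hrf : ∀ᶠ h in 𝓝[≠] (0 : ℝ), sobolevSqOne (r h) < ⊤ :=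
    (hlim.eventually (gt_mem_nhds zero_lt_one)).mono fun h hh => hh.trans ENNReal.one_lt_top
  have hrs : ∀ᶠ h in 𝓝[≠] (0 : ℝ), ∀ x, SmoothAt (r h) x := by
    filter_upwards [hd] with h hh x using (hh.field.smooth x).sub (hw x)
  have hr : ∀ᶠ h in 𝓝[≠] (0 : ℝ), IsCurlL2 o (r h) := by
    filter_upwards [hrf, hrs] with h h1 h2 using .of_sobolevSqOne h2 h1
  have hwL : IsCurlL2 o w := by
    obtain ⟨h, h1, h2⟩ := (hd.and hr).exists
    have : w = fun x => d h x - r h x := funext fun x => (sub_sub_cancel _ _).symm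
    rw [this]
    exact h1.sub h2
  refine ⟨hwL, ?_⟩
  have hN : Tendsto (fun h => (sobolevSqOne (r h)).toReal) (𝓝[≠] 0) (𝓝 0) :=
    (ENNReal.tendsto_toReal ENNReal.zero_ne_top).comp hlim
  have hbound : ∀ a : VecField 3 M, IsCurlL2 o a →
      Tendsto (fun h => curlPairing o a (r h)) (𝓝[≠] 0) (𝓝 0) := fun a ha => by
    refine squeeze_zero_norm' (a := fun h => √(∫ x, ‖curl o a x‖ ^ 2 ∂(riemannianMeasure 3 M)) *
      √((sobolevSqOne (r h)).toReal)) ?_ ?_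
    · filter_upwards [hr, hrs, hrf] with h h1 h2 h3
      exact (abs_curlPairing_le ha h1).trans (mul_le_mul_of_nonneg_left
        (Real.sqrt_le_sqrt (integral_sq_norm_le h2 h3)) (Real.sqrt_nonneg _))
    · simpa using (hN.sqrt).const_mul √(∫ x, ‖curl o a x‖ ^ 2 ∂(riemannianMeasure 3 M))
  have hrr : Tendsto (fun h => curlPairing o (r h) (r h)) (𝓝[≠] 0) (𝓝 0) := by
    refine squeeze_zero_norm' (a := fun h => √(3 * (sobolevSqOne (r h)).toReal) *
      √((sobolevSqOne (r h)).toReal)) ?_ ?_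
    · filter_upwards [hr, hrs, hrf] with h h1 h2 h3
      exact (abs_curlPairing_le h1 h1).trans (mul_le_mul
        (Real.sqrt_le_sqrt (integral_sq_norm_curl_le o h2 h3))
        (Real.sqrt_le_sqrt (integral_sq_norm_le h2 h3)) (Real.sqrt_nonneg _) (Real.sqrt_nonneg _))
    · simpa using (hN.const_mul 3).sqrt.mul hN.sqrt
  rw [hasDerivAt_iff_tendsto_slope_zero]
  have hid : Tendsto (fun h : ℝ => h) (𝓝[≠] 0) (𝓝 0) := tendsto_id.mono_left nhdsWithin_le_nhds
  -- with `v_{t+h} = v_t + h d_h` and `d_h = w + r_h`, the difference quotient of the helicity is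
  -- `2 Q(v_t, d_h) + h Q(d_h, d_h)` for the symmetric form `Q`
  have hmain : Tendsto (fun h : ℝ => 2 * (curlPairing o (v t) w + curlPairing o (v t) (r h)) +
      h * (curlPairing o w w + 2 * curlPairing o w (r h) + curlPairing o (r h) (r h)))
      (𝓝[≠] 0) (𝓝 (2 * curlPairing o (v t) w)) := by
    have h1 := ((hbound _ hv0).const_add (curlPairing o (v t) w)).const_mul 2
    have h2 := hid.mul ((((hbound _ hwL).const_mul 2).const_add (curlPairing o w w)).add hrr)
    simpa using h1.add h2
  refine hmain.congr' ?_
  filter_upwards [hvh, hd, hr, self_mem_nhdsWithin] with h h1 h2 h3 h0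
  have h0' : h ≠ 0 := h0
  have e1 : curlPairing o (v t) (r h) = curlPairing o (v t) (d h) - curlPairing o (v t) w :=
    curlPairing_sub_right hv0 h2 hwL
  have e2 : curlPairing o w (r h) = curlPairing o w (d h) - curlPairing o w w :=
    curlPairing_sub_right hwL h2 hwL
  have e3 : curlPairing o (r h) (r h) = curlPairing o (d h) (d h) - curlPairing o (d h) w -
      (curlPairing o w (d h) - curlPairing o w w) := by
    rw [curlPairing_sub_left h2 hwL h3, curlPairing_sub_right h2 h2 hwL, e2]
  have e4 : curlPairing o (v t) (d h) =
      h⁻¹ * (curlPairing o (v t) (v (t + h)) - curlPairing o (v t) (v t)) := by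
    rw [curlPairing_const_smul_right, curlPairing_sub_right hv0 h1 hv0]
  have e5 : curlPairing o (d h) (d h) = h⁻¹ * (h⁻¹ * (curlPairing o (v (t + h)) (v (t + h)) -
      curlPairing o (v (t + h)) (v t) - (curlPairing o (v t) (v (t + h)) -
        curlPairing o (v t) (v t)))) := by
    rw [curlPairing_const_smul_left _ (h1.sub hv0), curlPairing_const_smul_right,
      curlPairing_sub_left h1 hv0 (h1.sub hv0), curlPairing_sub_right h1 h1 hv0,
      curlPairing_sub_right hv0 h1 hv0]
  rw [e3, e2, e1, curlPairing_comm h2 hwL, e5, e4, curlPairing_comm h1 hv0, smul_eq_mul]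
  field_simp
  ring

theorem smoothAt_velocity {ν : ℝ} {J : Set ℝ} (hJ : IsOpen J) {u : ℝ → VecField 3 M}
    {p : ℝ → M → ℝ} (hsol : IsSmoothSolution ν J u p) {t : ℝ} (ht : t ∈ J) (x : M) :
    SmoothAt (u t) x := by
  have h := hsol.smooth_velocity.contMDiffAt (x := (t, x))
    ((hJ.prod isOpen_univ).mem_nhds ⟨ht, mem_univ x⟩)
  have h1 : ContMDiffAt (𝓡 3) (𝓘(ℝ, ℝ).prod (𝓡 3)) ∞ (fun y : M => (t, y)) x :=
    contMDiffAt_const.prodMk contMDiffAt_id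
  exact h.comp x h1

/-- The integrated Bochner formula `∫ ⟨curl B, □B⟩ = ∫ (∇ curl B, ∇B) + ∫ ⟨curl B, Ric B⟩`. It comes
from integrating `div ⟨A, ∇B⟩ = ⟨∇A, ∇B⟩ + ⟨A, tr ∇²B⟩` for `A = curl B`. -/
theorem integral_inner_curl_curl_eq [CompleteSpace M] (o : ManifoldOrientation M)
    {B : VecField 3 M} (hB : ∀ x, SmoothAt B x) (hdiv : ∀ x, divergence B x = 0)
    (h : sobolevSqTwo B < ⊤) :
    Integrable (fun x => covPairing (flat (curl o B)) B x) (riemannianMeasure 3 M) ∧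
    Integrable (fun x => (inner ℝ (ricci leviCivita x (B x)) (curl o B x) : ℝ))
      (riemannianMeasure 3 M) ∧
    ∫ x, (inner ℝ (curl o (curl o B) x) (curl o B x) : ℝ) ∂(riemannianMeasure 3 M) =
      (∫ x, covPairing (flat (curl o B)) B x ∂(riemannianMeasure 3 M)) +
        ∫ x, (inner ℝ (ricci leviCivita x (B x)) (curl o B x) : ℝ) ∂(riemannianMeasure 3 M) := by
  have hc : ∀ x, SmoothAt (curl o B) x := fun x => smoothAt_curl o (hB x)
  have h1 : IsCurlL2 o B := .of_sobolevSqOne hB ((sobolevSqOne_le_sobolevSqTwo B).trans_lt h)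
  let P : M → ℝ := fun x => ∑ i,
    (inner ℝ (leviCivita (curl o B) x (frame x i)) (leviCivita B x (frame x i)) : ℝ)
  let L : M → ℝ := fun x => inner ℝ (∑ i, secondCov B x (frame x i) (frame x i)) (curl o B x)
  have hdivX : divergence (contractCov (curl o B) B) = fun x => P x + L x := funext fun x => by
    rw [divergence_contractCov (hc x) (hB x)]
    simp only [P, L, sum_inner]
  have hPc : Continuous P := continuous_iff_continuousAt.2 fun x =>
    (funSmoothAt_sum_inner_leviCivita (hc x) (hB x)).continuousAt
  have hXs : ∀ x, SmoothAt (contractCov (curl o B) B) x := fun x =>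
    smoothAt_contractCov (hc x) (hB x)
  have hLc : Continuous L := by
    have : L = fun x => divergence (contractCov (curl o B) B) x - P x := by
      rw [hdivX]
      exact funext fun x => (add_sub_cancel_left _ _).symm
    rw [this]
    exact (continuous_divergence hXs).sub hPc
  have hab : ∀ {x : M} (a b : TangentSpace (𝓡 3) x),
      |(inner ℝ a b : ℝ)| ≤ (‖a‖ ^ 2 + ‖b‖ ^ 2) / 2 := fun a b => by
    have := abs_real_inner_le_norm a b
    nlinarith [sq_nonneg (‖a‖ - ‖b‖)]
  have hPi : Integrable P (riemannianMeasure 3 M) := by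
    refine integrable_of_abs_le hPc h (by norm_num : (0 : ℝ) ≤ 3) fun x => ?_
    have h2 : |P x| ≤ ∑ i, (‖leviCivita (curl o B) x (frame x i)‖ ^ 2 +
        ‖leviCivita B x (frame x i)‖ ^ 2) / 2 :=
      (Finset.abs_sum_le_sum_abs _ _).trans (Finset.sum_le_sum fun i _ => hab _ _)
    rw [← Finset.sum_div, Finset.sum_add_distrib] at h2
    have h3 := normSqCov_curl_le o (hB x)
    have h4 := normSqCov_nonneg B x
    have h5 := normSqSecondCov_nonneg B x
    rw [normSqCov] at h3 h4
    rw [normSqCov]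
    linarith [sq_nonneg ‖B x‖]
  have hLi : Integrable L (riemannianMeasure 3 M) := by
    refine integrable_of_abs_le hLc h (by norm_num : (0 : ℝ) ≤ 9) fun x => ?_
    have h2 : |L x| ≤ _ := hab (∑ i, secondCov B x (frame x i) (frame x i)) (curl o B x)
    linarith [sq_norm_sum_secondCov_le B x, sq_norm_curl_le o B x, normSqCov_nonneg B x,
      normSqSecondCov_nonneg B x, sq_nonneg ‖B x‖]
  have hXi : Integrable (fun x => ‖contractCov (curl o B) B x‖) (riemannianMeasure 3 M) := by
    refine integrable_of_abs_le (continuous_norm_of_smooth hXs) h zero_le_three fun x => ?_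
    rw [abs_norm]
    have h2 := norm_contractCov_le (curl o B) B x
    have h3 := mul_le_mul_of_nonneg_right (norm_curl_le o B x)
      (Finset.sum_nonneg fun i (_ : i ∈ Finset.univ) => norm_nonneg (leviCivita B x (frame x i)))
    have h4 := sq_sum_norm_leviCivita_le B x
    linarith [normSqSecondCov_nonneg B x, sq_nonneg ‖B x‖]
  have h0 := integral_divergence_eq_zero o hXs hXi (by rw [hdivX]; exact hPi.add hLi)
  rw [hdivX, integral_add hPi hLi] at h0
  have hcc := (isSmoothL2_curl_curl o hB h).integrable_inner h1.curl
  have hP : (fun x => covPairing (flat (curl o B)) B x) = P := funext fun x =>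
    covPairing_flat (hc x).diffAt
  have hR : (fun x => (inner ℝ (ricci leviCivita x (B x)) (curl o B x) : ℝ)) =
      fun x => (inner ℝ (curl o (curl o B) x) (curl o B x) : ℝ) + L x := funext fun x => by
    rw [curl_curl o hB hdiv, inner_hodgeLaplacian_bochner hB hdiv]
    simp only [L, sum_inner]
    ring
  rw [hP, hR]
  refine ⟨hPi, hcc.add hLi, ?_⟩
  rw [integral_add hcc hLi]
  linarith

theorem isSmoothL2_leviCivita_self {B : VecField 3 M} (hB : ∀ x, SmoothAt B x)
    (h : sobolevSqOne B < ⊤) {C : ℝ} (hC : ∀ x, ‖B x‖ ≤ C) :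
    IsSmoothL2 (fun x => leviCivita B x (B x)) := by
  refine isSmoothL2_of_le (fun x => smoothAt_leviCivita (hB x) (hB x)) h
    (by positivity : 0 ≤ C ^ 2 * 3) fun x => ?_
  have h1 := pow_le_pow_left₀ (norm_nonneg _) (norm_leviCivita_apply_le B x (B x)) 2
  rw [mul_pow] at h1
  have h2 := mul_le_mul (pow_le_pow_left₀ (norm_nonneg _) (hC x) 2) (sq_sum_norm_leviCivita_le B x)
    (sq_nonneg _) (sq_nonneg C)
  nlinarith [mul_nonneg (sq_nonneg C) (sq_nonneg ‖B x‖)]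

theorem isSmoothL2_contractCov_self {B : VecField 3 M} (hB : ∀ x, SmoothAt B x)
    (h : sobolevSqOne B < ⊤) {C : ℝ} (hC : ∀ x, ‖B x‖ ≤ C) :
    IsSmoothL2 (contractCov B B) := by
  refine isSmoothL2_of_le (fun x => smoothAt_contractCov (hB x) (hB x)) h
    (by positivity : 0 ≤ C ^ 2 * 3) fun x => ?_
  have h1 := pow_le_pow_left₀ (norm_nonneg _) (norm_contractCov_le B B x) 2
  rw [mul_pow] at h1
  have h2 := mul_le_mul (pow_le_pow_left₀ (norm_nonneg _) (hC x) 2) (sq_sum_norm_leviCivita_le B x)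
    (sq_nonneg _) (sq_nonneg C)
  nlinarith [mul_nonneg (sq_nonneg C) (sq_nonneg ‖B x‖)]

/-- The convection term does not change the helicity: against `curl B` it equals half the gradient
of `|B|²`. -/
theorem curlPairing_leviCivita_self [CompleteSpace M] (o : ManifoldOrientation M)
    {B : VecField 3 M} (hB : ∀ x, SmoothAt B x) (h : sobolevSqOne B < ⊤) {C : ℝ}
    (hC : ∀ x, ‖B x‖ ≤ C) : curlPairing o B (fun x => leviCivita B x (B x)) = 0 := by
  have hg : grad (n := 3) (fun y => (inner ℝ (B y) (B y) : ℝ)) =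
      fun x => (2 : ℝ) • contractCov B B x := funext fun x => grad_inner_self (hB x).diffAt
  have h1 := curlPairing_grad (o := o) (.of_sobolevSqOne hB h) (fun x => (hB x).inner (hB x))
    (by rw [hg]; exact (isSmoothL2_contractCov_self hB h hC).const_smul 2)
  rw [hg, curlPairing_const_smul_right] at h1
  have h2 : curlPairing o B (contractCov B B) = 0 := by linarith
  rw [← h2, curlPairing, curlPairing]
  refine integral_congr_ae (Eventually.of_forall fun x => ?_)
  simp only
  rw [real_inner_comm, ← inner_leviCivita_self_curl,
    real_inner_comm (contractCov B B x) (curl o B x), inner_contractCov]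
  exact real_inner_comm _ _

/-- The two terms of the intrinsic Ricci tensor which contain `∇B` integrate to zero. -/
theorem integral_inner_velocityRicci [CompleteSpace M] (o : ManifoldOrientation M)
    {B : VecField 3 M} {ν : ℝ} (hν : ν ≠ 0) (hB : ∀ x, SmoothAt B x)
    (hdiv : ∀ x, divergence B x = 0) (h : sobolevSqTwo B < ⊤) {C : ℝ} (hC : ∀ x, ‖B x‖ ≤ C) :
    Integrable (fun x => (inner ℝ (curl o B x) (B x) : ℝ) * ‖B x‖ ^ 2) (riemannianMeasure 3 M) ∧
    Integrable (fun x => (inner ℝ (curl o B x) (velocityRicci ν B x (B x)) : ℝ))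
      (riemannianMeasure 3 M) ∧
    ∫ x, (inner ℝ (curl o B x) (velocityRicci ν B x (B x)) : ℝ) ∂(riemannianMeasure 3 M) =
      ∫ x, (inner ℝ (ricci leviCivita x (B x)) (curl o B x) : ℝ) ∂(riemannianMeasure 3 M) +
        1 / (2 * ν ^ 2) *
          ∫ x, (inner ℝ (curl o B x) (B x) : ℝ) * ‖B x‖ ^ 2 ∂(riemannianMeasure 3 M) := by
  have hfin1 := (sobolevSqOne_le_sobolevSqTwo B).trans_lt h
  have hBL : IsCurlL2 o B := .of_sobolevSqOne hB hfin1
  have hTi : Integrable (fun x => (inner ℝ (curl o B x) (B x) : ℝ) * ‖B x‖ ^ 2)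
      (riemannianMeasure 3 M) := by
    refine (hBL.curl.integrable_inner hBL.field).mul_bdd (c := C ^ 2)
      ((continuous_norm_of_smooth hB).pow 2).aestronglyMeasurable
      (Eventually.of_forall fun x => ?_)
    rw [Real.norm_of_nonneg (by positivity)]
    exact pow_le_pow_left₀ (norm_nonneg _) (hC x) 2
  have hRi := (integral_inner_curl_curl_eq o hB hdiv h).2.1
  have hai := hBL.curl.integrable_inner (isSmoothL2_leviCivita_self hB hfin1 hC)
  have heq : (fun x => (inner ℝ (curl o B x) (velocityRicci ν B x (B x)) : ℝ)) =
      fun x => inner ℝ (ricci leviCivita x (B x)) (curl o B x) -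
        1 / ν * inner ℝ (curl o B x) (leviCivita B x (B x)) +
        1 / (2 * ν ^ 2) * ((inner ℝ (curl o B x) (B x) : ℝ) * ‖B x‖ ^ 2) :=
    funext fun x => by
      rw [real_inner_comm, inner_velocityRicci hν (hB x), inner_leviCivita_self_curl,
        real_inner_comm (curl o B x) (leviCivita B x (B x)), real_inner_comm (curl o B x) (B x)]
      field_simp
      ring
  have hRai : Integrable (fun x => (inner ℝ (ricci leviCivita x (B x)) (curl o B x) : ℝ) -
      1 / ν * inner ℝ (curl o B x) (leviCivita B x (B x))) (riemannianMeasure 3 M) :=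
    hRi.sub (hai.const_mul _)
  have ha0 := curlPairing_leviCivita_self o hB hfin1 hC
  rw [curlPairing] at ha0
  rw [heq]
  refine ⟨hTi, hRai.add (hTi.const_mul _), ?_⟩
  rw [integral_add hRai (hTi.const_mul _), integral_sub hRi (hai.const_mul _), integral_const_mul,
    integral_const_mul, ha0, mul_zero, sub_zero]

/-- Only the viscous term of the Navier-Stokes equation contributes to the derivative of the
helicity. -/
theorem curlPairing_timeDeriv [CompleteSpace M] (o : ManifoldOrientation M) {ν : ℝ}
    {B w : VecField 3 M} {f : M → ℝ} (hB : ∀ x, SmoothAt B x) (h : sobolevSqTwo B < ⊤) {C : ℝ}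
    (hC : ∀ x, ‖B x‖ ≤ C)
    (hf : ∀ x, FunSmoothAt (n := 3) f x) (hw : IsSmoothL2 w)
    (heq : ∀ x, w x + leviCivita B x (B x) + ν • curl o (curl o B) x = -grad (n := 3) f x) :
    curlPairing o B w =
      -ν * ∫ x, (inner ℝ (curl o (curl o B) x) (curl o B x) : ℝ) ∂(riemannianMeasure 3 M) := by
  have hfin1 := (sobolevSqOne_le_sobolevSqTwo B).trans_lt h
  have hBL : IsCurlL2 o B := .of_sobolevSqOne hB hfin1
  have haL := isSmoothL2_leviCivita_self hB hfin1 hC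
  have hccL := isSmoothL2_curl_curl o hB h
  -- the momentum equation shows that the pressure gradient is square integrable
  have hg : grad (n := 3) f = fun x => (-1 : ℝ) • ((w x - (-1 : ℝ) • leviCivita B x (B x)) -
      (-ν) • curl o (curl o B) x) := funext fun x => by
    rw [← neg_eq_iff_eq_neg.2 (heq x)]
    module
  have hgL : IsSmoothL2 (grad (n := 3) f) := by
    rw [hg]
    exact ((hw.sub (haL.const_smul (-1))).sub (hccL.const_smul (-ν))).const_smul (-1)
  have hp0 := curlPairing_grad hBL hf hgL
  have ha0 := curlPairing_leviCivita_self o hB hfin1 hC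
  have hi1 := hBL.curl.integrable_inner hgL
  have hi2 := hBL.curl.integrable_inner haL
  have hi3 := hccL.integrable_inner hBL.curl
  rw [curlPairing] at hp0 ha0 ⊢
  have hpt : ∀ x, (inner ℝ (curl o B x) (w x) : ℝ) =
      -(inner ℝ (curl o B x) (grad (n := 3) f x) + inner ℝ (curl o B x) (leviCivita B x (B x))) -
        ν * inner ℝ (curl o (curl o B) x) (curl o B x) := fun x => by
    have : w x = -(grad (n := 3) f x + leviCivita B x (B x)) - ν • curl o (curl o B) x := by
      rw [← neg_eq_iff_eq_neg.2 (heq x)]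
      abel
    rw [this, inner_sub_right, inner_neg_right, inner_add_right, inner_smul_right,
      real_inner_comm (curl o B x) (curl o (curl o B) x)]
  simp only [hpt]
  have hi4 : Integrable (fun x => -((inner ℝ (curl o B x) (grad (n := 3) f x) : ℝ) +
      inner ℝ (curl o B x) (leviCivita B x (B x)))) (riemannianMeasure 3 M) := (hi1.add hi2).neg
  rw [integral_sub hi4 (hi3.const_mul ν), integral_neg, integral_add hi1 hi2, integral_const_mul,
    hp0, ha0]
  ring

end Helicity

end HelicityNS

end

open HelicityNS in
theorem mainTheorem3 {M : Type*} [MetricSpace M] [CompleteSpace M] [SecondCountableTopology M]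
    [ChartedSpace (EuclideanSpace ℝ (Fin 3)) M] [IsManifold (𝓡 3) ∞ M]
    [RiemannianBundle (fun x : M => TangentSpace (𝓡 3) x)]
    [IsContMDiffRiemannianBundle (𝓡 3) ∞ (EuclideanSpace ℝ (Fin 3))
      (fun x : M => TangentSpace (𝓡 3) x)]
    [IsRiemannianManifold (𝓡 3) M] [MeasurableSpace M] [BorelSpace M]
    (o : HelicityNS.ManifoldOrientation M)
    (ν : ℝ) (hν : 0 < ν) (J : Set ℝ) (hJ : IsOpen J)
    (u : ℝ → HelicityNS.VecField 3 M) (p : ℝ → M → ℝ)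
    (hsol : HelicityNS.IsSmoothSolution ν J u p)
    (hreg : HelicityNS.IsRegularVelocity J u)
    (vort : ℝ → HelicityNS.OneForm 3 M) (hvort : ∀ t, vort t = HelicityNS.vorticity o (u t))
    (t : ℝ) (ht : t ∈ J) :
    Integrable (fun x => vort t x (u t x)) (HelicityNS.riemannianMeasure 3 M) ∧
    Integrable (fun x => HelicityNS.innerTwo (HelicityNS.extDerivOne (vort t))
      (HelicityNS.starOne o (vort t)) x) (HelicityNS.riemannianMeasure 3 M) ∧
    Integrable (fun x => HelicityNS.covPairing (vort t) (u t) x)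
      (HelicityNS.riemannianMeasure 3 M) ∧
    Integrable (fun x => vort t x (HelicityNS.velocityRicci ν (u t) x (u t x)))
      (HelicityNS.riemannianMeasure 3 M) ∧
    Integrable (fun x => vort t x (u t x) * ‖u t x‖ ^ 2) (HelicityNS.riemannianMeasure 3 M) ∧
    HasDerivAt (fun s => ∫ x, vort s x (u s x) ∂(HelicityNS.riemannianMeasure 3 M))
      (-ν * (∫ x, HelicityNS.innerTwo (HelicityNS.extDerivOne (vort t))
            (HelicityNS.starOne o (vort t)) x ∂(HelicityNS.riemannianMeasure 3 M))
        - ν * (∫ x, HelicityNS.covPairing (vort t) (u t) x ∂(HelicityNS.riemannianMeasure 3 M))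
        - ν * (∫ x, vort t x (HelicityNS.velocityRicci ν (u t) x (u t x))
            ∂(HelicityNS.riemannianMeasure 3 M))
        + 1 / (2 * ν) * (∫ x, vort t x (u t x) * ‖u t x‖ ^ 2
            ∂(HelicityNS.riemannianMeasure 3 M))) t := by
  obtain rfl : vort = fun s => vorticity o (u s) := funext hvort
  have hJt : ∀ᶠ s in 𝓝 t, s ∈ J := hJ.mem_nhds ht
  have hs : ∀ s ∈ J, ∀ x, SmoothAt (u s) x := fun s hs => smoothAt_velocity hJ hsol hs
  have hω : ∀ s ∈ J, vorticity o (u s) = flat (curl o (u s)) := fun s hs' =>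
    funext fun x => vorticity_eq o (hs s hs' x).diffAt
  have hut := hs t ht
  have hdiv := hsol.incompressible t ht
  have hfin1 : ∀ s ∈ J, sobolevSqOne (u s) < ⊤ := fun s hs =>
    (sobolevSqOne_le_sobolevSqTwo _).trans_lt (hreg.sobolev s hs)
  have hfin2 := hreg.sobolev t ht
  obtain ⟨C, hC⟩ := hreg.bounded t ht
  have huL : IsCurlL2 o (u t) := .of_sobolevSqOne hut (hfin1 t ht)
  have hccL := isSmoothL2_curl_curl o hut hfin2
  have hmom : ∀ x, timeDeriv u t x + leviCivita (u t) x (u t x) + ν • curl o (curl o (u t)) x =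
      -grad (n := 3) (p t) x := fun x => by
    rw [curl_curl o hut hdiv]
    exact hsol.momentum t ht x
  have hps : ∀ x, FunSmoothAt (n := 3) (p t) x := fun x => (hsol.smooth_pressure t ht).contMDiffAt
  -- the smoothness of `∂_t u_t` in space is read off from the momentum equation
  have hws : ∀ x, SmoothAt (timeDeriv u t) x := fun x => by
    refine SmoothAt.congr (((smoothAt_grad (hps x)).neg.sub
      (smoothAt_leviCivita (hut x) (hut x))).sub ((hccL.smooth x).const_smul ν))
      (Eventually.of_forall fun y => ?_)
    rw [← hmom y]
    abel
  obtain ⟨hwL, hder⟩ := hasDerivAt_curlPairing o hws (hJt.mono hs) (hJt.mono hfin1)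
    (hreg.differentiable t ht)
  have hQw := curlPairing_timeDeriv o hut hfin2 hC hps hwL.field hmom
  obtain ⟨hBi, -, hBR⟩ := integral_inner_curl_curl_eq o hut hdiv hfin2
  obtain ⟨hTi, hVi, hV⟩ := integral_inner_velocityRicci o hν.ne' hut hdiv hfin2 hC
  have hcc : (fun x => innerTwo (extDerivOne (flat (curl o (u t))))
      (starOne o (flat (curl o (u t)))) x) =
      fun x => (inner ℝ (curl o (curl o (u t)) x) (curl o (u t) x) : ℝ) := funext fun x =>
    innerTwo_extDerivOne_starOne o (huL.curl.smooth x).diffAt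
  have hflat : ∀ x v, flat (curl o (u t)) x v = inner ℝ (curl o (u t) x) v := fun x v => rfl
  simp only [hω t ht, hcc, hflat]
  refine ⟨huL.curl.integrable_inner huL.field, hccL.integrable_inner huL.curl, hBi, hVi, hTi, ?_⟩
  refine (hder.congr_of_eventuallyEq (hJt.mono fun s hsJ => ?_)).congr_deriv ?_
  · simp only [hω s hsJ]
    rfl
  · rw [hQw, hV, hBR]
    field_simp
    ring
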